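/- **Setting.** For $n,d\in\mathbb N$ let $\Omega^{BC}_n(d)$ be the set of $d$-regular bipartite multigraphs on $[n]\sqcup[n]$; $G$ is identified with its matrix of edge multiplicities $\mathrm{mult}_G(i,j)$, $(i,j)\in[n]\times[n]$ (all row and column sums equal to $d$). Let $\Omega^{B}_n(d)$ be the subset of simple graphs (all multiplicities at most $1$), $\pi_u$ the uniform measure on it, and $\pi_{BC}$ the measure on $\Omega^{BC}_n(d)$ induced by the configuration model, i.e. the law of the multigraph with $\mathrm{mult}(i,j)=|\{a\in[d]:\sigma(i,a)\in\{j\}\times[d]\}|$ for a uniformly random permutation $\sigma$ of $[n]\times[d]$. For a probability measure $\mu$ on a finite set, $\mathrm{Var}_\mu(f)=\frac12\sum_{x,y}\mu(x)\mu(y)(f(x)-f(y))^2$. Put $\mathfrak z=\lfloor n/(d\log^2 n)\rfloor$, $\mathfrak n=\lceil n/d\rceil$, $\mathfrak m=d^2\lfloor\log n\rfloor$. *Switchings.* For $i_1\ne i_2$, $j_1\neq j_2$ and $G$ with $\mathrm{mult}_G(i_1,j_1),\mathrm{mult}_G(i_2,j_2)>0$, the switching $\langle i_1,i_2,j_1,j_2\rangle$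 lowers the multiplicities of $(i_1,j_1),(i_2,j_2)$ by one and raises those of $(i_1,j_2),(i_2,j_1)$ by one. Two multigraphs are adjacent if a switching transforms one into the other. $\mathrm{Cat}(k)$ is the set of multigraphs with all multiplicities at most $2$ and exactly $k$ edges of multiplicity $2$, no two of which share a vertex; $\mathrm{Cat}([1,\mathfrak m])=\bigcup_{k=1}^{\mathfrak m}\mathrm{Cat}(k)$. *$s$-neighborhoods.* Let $G\in\mathrm{Cat}(k)$ have double edges $(i_s,j_s)_{s=1}^k$, $i_1<\dots<i_k$. A simple path from $G$ applies successively switchings $\langle i_t,i_t',j_t,j_t'\rangle$, $t=1,\dots,k$, where $i'_t\notin\{i_s\}$, $j'_t\notin\{j_s\}$, the $i'_t$ are pairwise distinct, the $j'_t$ are pairwise distinct, and $\mathrm{mult}_G(i_t',j_t)=\mathrm{mult}_G(i_t,j_t')=0$ for all $t$. $\mathcal{SN}(G)\subset\Omega^B_n(d)$ is the set of endpoints of simple paths from $G$. For $f:\Omega^B_n(d)\to\mathbb R$ let $h(G)$ be the average of $f$ over $\mathcal{SN}(G)$ and $w(G)$ the average of $(f-h(G))^2$ over $\mathcal{SN}(G)$.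 *Anti-expansion.* For $G\in\Omega^B_n(d)$ let $\mathcal Z(G)$ be the number of edges $(i,j)$ of $G$ such that for some $k\ne i$, $(k,j)$ is an edge of $G$ and $i,k$ have at least two common neighbors; $\mathcal R=\{G\in\Omega^B_n(d):\mathcal Z(G)\le\mathfrak z\}$. *The Gaussian field.* Given $c_0>0$ and $f$, call a centered Gaussian field $(\xi_G)_{G\in\Omega^{BC}_n(d)}$ *admissible* if (i) $\mathrm{Var}\,\xi_G=1$ for all $G$; (ii) $\mathrm{Cov}(\xi_{G_1},\xi_{G_2})\ge1-4/\mathfrak n$ for adjacent $G_1,G_2$; (iii) with probability at least $c_0$, $\sum_{(G_1,G_2)\in\mathcal M}\eta_{G_1,G_2}L_{G_1,G_2}\ge c_0\sum_{(G_1,G_2)\in\mathcal M}L_{G_1,G_2}$, where $\mathcal M$ is the set of pairs in $\mathrm{Cat}([1,\mathfrak m])^2$ whose matrices differ in at least $\mathfrak n$ entries, $L_{G_1,G_2}=\frac{\pi_{BC}(G_1)\pi_{BC}(G_2)}{|\mathcal{SN}(G_1)||\mathcal{SN}(G_2)|}\sum_{G'\in\mathcal{SN}(G_1),G''\in\mathcal{SN}(G_2)}(f(G')-f(G''))^2$,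 and $\eta_{G_1,G_2}$ is the indicator of the event that $\xi_{G_1}(h(G_1)-h(G_2))\ge0$, $-\xi_{G_2}(h(G_1)-h(G_2))\ge0$, $\xi_{G_1}$ and $-\xi_{G_2}$ have the same sign, and $|\xi_{G_1}|,|\xi_{G_2}|\ge1$. For pairwise disjoint $T^1,\dots,T^{\mathfrak n}\subset[n]\times[n]$, $W\subset\{0,\dots,nd\}$ with complement $W^c=\{0,\dots,nd\}\setminus W$, and i.i.d. standard Gaussians $g^\ell,\tilde g^\ell$, put $\xi^{\mathcal T}_G=\mathfrak n^{-1/2}\sum_{\ell=1}^{\mathfrak n}\big(g^\ell\mathbf 1\{S_\ell\in W\}+\tilde g^\ell\mathbf 1\{S_\ell\in W^c\}\big)$ with $S_\ell=\sum_{(i,j)\in T^\ell}\mathrm{mult}_G(i,j)$. *The randomized extension.* Given an admissible field, $\tilde f:\Omega^{BC}_n(d)\to\mathbb R$ is defined as follows. For $G\in\Omega^B_n(d)$, $\tilde f(G)=f(G)$ if $\sum_{G',G''\in\mathcal R}\pi_u(G')\pi_u(G'')(f(G')-f(G''))^2\ge2^{-7}\mathrm{Var}_{\pi_u}(f)$ or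 $G\in\mathcal R$, and otherwise $\tilde f(G)=\pi_{BC}(\Omega^B_n(d))^{-1/2}(f(G)-\mathbb E_{\pi_u}f)+\mathbb E_{\pi_u}f$. For $G\in\mathrm{Cat}([1,\mathfrak m])$, $\tilde f(G)=h(G)+\xi_G\sqrt{w(G)}$. For all other $G$, $\tilde f(G)=\mathbb E_{\pi_u}f$. **Theorem.** There are universal constants $c_0,c>0$ and $N\in\mathbb N$ such that for all $n\ge N$, all integers $d$ with $3\le d\le n^{1/1143}$ and all $f:\Omega^B_n(d)\to\mathbb R$: there is a choice of $(T^\ell)_\ell$ and $W$ for which the field $\xi^{\mathcal T}$ is admissible with constant $c_0$; and for every admissible field with constant $c_0$ (on any probability space) the randomized extension $\tilde f$ satisfies $$\mathbb P\big\{\mathrm{Var}_{\pi_{BC}}(\tilde f)\ge c\,\mathrm{Var}_{\pi_u}(f)\big\}\ge c.$$ -/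

import Mathlib

open scoped ProbabilityTheory

noncomputable section

namespace SwitchChain

/-! ### Bipartite regular (multi)graphs, given by their biadjacency matrices -/

/-- `d`-regular bipartite multigraphs on `[n] ⊔ [n]`; `mult i j` is the multiplicity of the edge
between the left vertex `i` and the right vertex `j`. -/
@[ext]
structure Multigraph (n d : ℕ) where
  mult : Fin n → Fin n → ℕ
  row_sum : ∀ i, ∑ j, mult i j = d
  col_sum : ∀ j, ∑ i, mult i j = d

instance (n d : ℕ) : Finite (Multigraph n d) := by
  have hle : ∀ (G : Multigraph n d) (i j : Fin n), G.mult i j < d + 1 := fun G i j =>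
    Nat.lt_succ_of_le ((Finset.single_le_sum (f := fun j => G.mult i j)
      (fun _ _ => Nat.zero_le _) (Finset.mem_univ j)).trans (G.row_sum i).le)
  refine Finite.of_injective
    (fun G : Multigraph n d => fun (i j : Fin n) => (⟨G.mult i j, hle G i j⟩ : Fin (d + 1))) ?_
  intro G H h
  ext i j
  exact congrArg Fin.val (congrFun (congrFun h i) j)

instance (n d : ℕ) : Fintype (Multigraph n d) := Fintype.ofFinite _

/-- `G` has no multiple edges. -/
def Multigraph.IsSimple {n d : ℕ} (G : Multigraph n d) : Prop := ∀ i j, G.mult i j ≤ 1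

/-- The set of simple `d`-regular bipartite graphs on `[n] ⊔ [n]`. -/
abbrev SimpleBip (n d : ℕ) : Type := {G : Multigraph n d // G.IsSimple}

instance (n d : ℕ) : Fintype (SimpleBip n d) := Fintype.ofFinite _

/-! ### Probability weights and variance -/

/-- The multigraph of a configuration: vertex `i` carries the half-edges `(i, a)`, `a : Fin d`, and
the permutation `σ` matches left half-edges with right half-edges. -/
def configGraph {n d : ℕ} (σ : Equiv.Perm (Fin n × Fin d)) : Multigraph n d where
  mult i j := (Finset.univ.filter fun a : Fin d => (σ (i, a)).1 = j).card
  row_sum i := by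
    rw [← Finset.card_eq_sum_card_fiberwise (f := fun a : Fin d => (σ (i, a)).1)
      (t := Finset.univ) (fun _ _ => Finset.mem_coe.2 (Finset.mem_univ _))]
    simp
  col_sum j := by
    have h : ∀ i : Fin n, (Finset.univ.filter fun a : Fin d => (σ (i, a)).1 = j).card
        = ∑ a : Fin d, if (σ (i, a)).1 = j then 1 else 0 := fun i => by
      rw [Finset.card_filter]
    simp only [h]
    rw [← Fintype.sum_prod_type' (f := fun i a => if (σ (i, a)).1 = j then 1 else 0),
      Equiv.sum_comp σ (fun x : Fin n × Fin d => if x.1 = j then 1 else 0),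
      Fintype.sum_prod_type]
    simp [apply_ite Finset.card]

open Classical in
/-- The configuration-model weight of `G`: the probability that a uniformly random permutation of
the `nd` half-edges produces `G`. -/
def piBC {n d : ℕ} (G : Multigraph n d) : ℝ :=
  ((Finset.univ.filter fun σ : Equiv.Perm (Fin n × Fin d) => configGraph σ = G).card : ℝ)
    / (Fintype.card (Equiv.Perm (Fin n × Fin d)) : ℝ)

/-- The uniform weight on simple graphs. -/
def piU {n d : ℕ} (_G : SimpleBip n d) : ℝ := 1 / (Fintype.card (SimpleBip n d) : ℝ)

/-- The variance of `f` with respect to the weights `μ` on a finite set. -/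
def wVar {S : Type*} [Fintype S] (μ f : S → ℝ) : ℝ :=
  (1 / 2) * ∑ x, ∑ y, μ x * μ y * (f x - f y) ^ 2

/-- The mean of `f` with respect to the uniform measure on simple graphs. -/
def meanU {n d : ℕ} (f : SimpleBip n d → ℝ) : ℝ := ∑ G, piU G * f G

/-- The configuration-model probability of the set of simple graphs. -/
def probSimple (n d : ℕ) : ℝ := ∑ G : SimpleBip n d, piBC G.1

/-! ### Parameters -/

def parZ (n d : ℕ) : ℕ := ⌊(n : ℝ) / ((d : ℝ) * Real.log n ^ 2)⌋₊

def parN (n d : ℕ) : ℕ := ⌈(n : ℝ) / (d : ℝ)⌉₊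

def parM (n d : ℕ) : ℕ := d ^ 2 * ⌊Real.log n⌋₊

/-! ### Switchings, categories, simple paths -/

/-- `H` is obtained from `G` by the switching `⟨i₁, i₂, j₁, j₂⟩`, which replaces the non-incident
edges `(i₁, j₁)`, `(i₂, j₂)` by `(i₁, j₂)`, `(i₂, j₁)`. -/
structure IsSwitching {n d : ℕ} (i₁ i₂ j₁ j₂ : Fin n) (G H : Multigraph n d) : Prop where
  left_ne : i₁ ≠ i₂
  right_ne : j₁ ≠ j₂
  pos₁ : 0 < G.mult i₁ j₁
  pos₂ : 0 < G.mult i₂ j₂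
  rem₁ : H.mult i₁ j₁ + 1 = G.mult i₁ j₁
  rem₂ : H.mult i₂ j₂ + 1 = G.mult i₂ j₂
  add₁ : H.mult i₁ j₂ = G.mult i₁ j₂ + 1
  add₂ : H.mult i₂ j₁ = G.mult i₂ j₁ + 1
  other : ∀ i j, ¬ ((i = i₁ ∨ i = i₂) ∧ (j = j₁ ∨ j = j₂)) → H.mult i j = G.mult i j

/-- Adjacency of multigraphs. -/
def Adjacent {n d : ℕ} (G H : Multigraph n d) : Prop :=
  ∃ i₁ i₂ j₁ j₂, IsSwitching i₁ i₂ j₁ j₂ G H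

/-- Category `k`: exactly `k` edges of multiplicity two, no two of them incident, and no edge of
multiplicity three or more. -/
structure IsCat {n d : ℕ} (k : ℕ) (G : Multigraph n d) : Prop where
  le_two : ∀ i j, G.mult i j ≤ 2
  card_double : (Finset.univ.filter fun e : Fin n × Fin n => G.mult e.1 e.2 = 2).card = k
  row_unique : ∀ i j j', G.mult i j = 2 → G.mult i j' = 2 → j = j'
  col_unique : ∀ i i' j, G.mult i j = 2 → G.mult i' j = 2 → i = i'

/-- Membership in the union of the categories `1, …, 𝔪`. -/
def InCatRange {n d : ℕ} (G : Multigraph n d) : Prop :=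
  ∃ k, 1 ≤ k ∧ k ≤ parM n d ∧ IsCat k G

/-- `P` is a simple path of length `k` starting at the category `k` multigraph `G`: the double edges
`e 0, …, e (k-1)` of `G`, in increasing order of their left vertices, are removed one after the
other by switchings with the edges `(i' t, j' t)`. -/
def IsSimplePath {n d k : ℕ} (G : Multigraph n d) (P : Fin (k + 1) → Multigraph n d) : Prop :=
  IsCat k G ∧ P 0 = G ∧
  ∃ (e : Fin k → Fin n × Fin n) (i' j' : Fin k → Fin n),
    StrictMono (fun s => (e s).1) ∧
    (∀ x : Fin n × Fin n, G.mult x.1 x.2 = 2 ↔ ∃ s, e s = x) ∧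
    (∀ t, IsSwitching (e t).1 (i' t) (e t).2 (j' t) (P t.castSucc) (P t.succ)) ∧
    (∀ t s, i' t ≠ (e s).1) ∧ (∀ t s, j' t ≠ (e s).2) ∧
    Function.Injective i' ∧ Function.Injective j' ∧
    (∀ t, G.mult (i' t) (e t).2 = 0 ∧ G.mult (e t).1 (j' t) = 0)

open Classical in
/-- The `s`-neighborhood of `G`: the endpoints of the simple paths starting at `G` (these endpoints
are always simple graphs). -/
def sNbhd {n d : ℕ} (G : Multigraph n d) : Finset (SimpleBip n d) :=
  Finset.univ.filter fun H =>
    ∃ (k : ℕ) (P : Fin (k + 1) → Multigraph n d), IsSimplePath G P ∧ P (Fin.last k) = H.1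

open Classical in
/-- The measure of anti-expansion. -/
def antiExp {n d : ℕ} (G : Multigraph n d) : ℕ :=
  (Finset.univ.filter fun x : Fin n × Fin n =>
    ∃ k, k ≠ x.1 ∧ G.mult x.1 x.2 ≠ 0 ∧ G.mult k x.2 ≠ 0 ∧
      2 ≤ (Finset.univ.filter fun j => G.mult x.1 j ≠ 0 ∧ G.mult k j ≠ 0).card).card

/-- The set of simple graphs with small anti-expansion. -/
def goodSet (n d : ℕ) : Finset (SimpleBip n d) :=
  Finset.univ.filter fun G => antiExp G.1 ≤ parZ n d

/-! ### The Gaussian field -/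

/-- The average of `f` over the `s`-neighborhood. -/
def nbhdMean {n d : ℕ} (f : SimpleBip n d → ℝ) (G : Multigraph n d) : ℝ :=
  (1 / ((sNbhd G).card : ℝ)) * ∑ H ∈ sNbhd G, f H

/-- The variance of `f` over the `s`-neighborhood. -/
def nbhdVar {n d : ℕ} (f : SimpleBip n d → ℝ) (G : Multigraph n d) : ℝ :=
  (1 / ((sNbhd G).card : ℝ)) * ∑ H ∈ sNbhd G, (f H - nbhdMean f G) ^ 2

/-- The number of entries in which the biadjacency matrices differ. -/
def entryDist {n d : ℕ} (G H : Multigraph n d) : ℕ :=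
  (Finset.univ.filter fun e : Fin n × Fin n => G.mult e.1 e.2 ≠ H.mult e.1 e.2).card

open Classical in
/-- Pairs of multigraphs of categories `1, …, 𝔪` whose matrices differ in at least `𝔫` entries. -/
def farPairs (n d : ℕ) : Finset (Multigraph n d × Multigraph n d) :=
  Finset.univ.filter fun p => InCatRange p.1 ∧ InCatRange p.2 ∧ parN n d ≤ entryDist p.1 p.2

/-- The weight of a pair of multigraphs. -/
def pairWeight {n d : ℕ} (f : SimpleBip n d → ℝ) (p : Multigraph n d × Multigraph n d) : ℝ :=
  piBC p.1 * piBC p.2 / (((sNbhd p.1).card : ℝ) * ((sNbhd p.2).card : ℝ)) *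
    ∑ H₁ ∈ sNbhd p.1, ∑ H₂ ∈ sNbhd p.2, (f H₁ - f H₂) ^ 2

open Classical in
/-- The indicator `η` of a pair of multigraphs, for the realization `x` of the field. -/
def signInd {n d : ℕ} (f : SimpleBip n d → ℝ) (x : Multigraph n d → ℝ)
    (p : Multigraph n d × Multigraph n d) : ℝ :=
  if 0 ≤ x p.1 * (nbhdMean f p.1 - nbhdMean f p.2) ∧
      0 ≤ -x p.2 * (nbhdMean f p.1 - nbhdMean f p.2) ∧
      0 < x p.1 * (-x p.2) ∧ 1 ≤ |x p.1| ∧ 1 ≤ |x p.2|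
  then 1 else 0

/-- The properties that a centered Gaussian field must have to be used for the randomized extension
of `f`; `c₀` is the constant in the last property. -/
structure IsRandomizingField {n d : ℕ} {Ω : Type*} [MeasurableSpace Ω] (c₀ : ℝ)
    (f : SimpleBip n d → ℝ) (P : MeasureTheory.Measure Ω) (ξ : Multigraph n d → Ω → ℝ) : Prop where
  gaussian : ProbabilityTheory.IsGaussianProcess ξ P
  centered : ∀ G, ∫ ω, ξ G ω ∂P = 0
  variance_one : ∀ G, Var[ξ G; P] = 1
  cov_adjacent : ∀ G H, Adjacent G H → 1 - 4 / (parN n d : ℝ) ≤ cov[ξ G, ξ H; P]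
  sign : c₀ ≤ P.real {ω |
    c₀ * ∑ p ∈ farPairs n d, pairWeight f p ≤
      ∑ p ∈ farPairs n d, signInd f (fun G => ξ G ω) p * pairWeight f p}

/-- A collection of `𝔫` pairwise disjoint subsets of `[n] × [n]` and a subset of `{0, …, nd}`. -/
structure FieldData (n d : ℕ) where
  T : Fin (parN n d) → Finset (Fin n × Fin n)
  disjoint : ∀ ℓ ℓ', ℓ ≠ ℓ' → Disjoint (T ℓ) (T ℓ')
  W : Finset ℕ
  W_subset : W ⊆ Finset.range (n * d + 1)

/-- The law of the independent standard Gaussian variables `(g^ℓ)` (left summand) and `(g̃^ℓ)` (right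
summand). -/
def stdGauss (m : ℕ) : MeasureTheory.Measure (Fin m ⊕ Fin m → ℝ) :=
  MeasureTheory.Measure.pi fun _ => ProbabilityTheory.gaussianReal 0 1

/-- The Gaussian field built from the data `𝒯`. -/
def gaussField {n d : ℕ} (𝒯 : FieldData n d) (G : Multigraph n d)
    (ω : Fin (parN n d) ⊕ Fin (parN n d) → ℝ) : ℝ :=
  (1 / Real.sqrt (parN n d)) * ∑ ℓ : Fin (parN n d),
    ((if ∑ e ∈ 𝒯.T ℓ, G.mult e.1 e.2 ∈ 𝒯.W then ω (Sum.inl ℓ) else 0) +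
     (if ∑ e ∈ 𝒯.T ℓ, G.mult e.1 e.2 ∈ Finset.range (n * d + 1) \ 𝒯.W
        then ω (Sum.inr ℓ) else 0))

/-! ### The randomized extension -/

/-- The condition under which `f` is left unchanged on all simple graphs. -/
def GoodVariation {n d : ℕ} (f : SimpleBip n d → ℝ) : Prop :=
  (1 / 2 ^ 7 : ℝ) * wVar piU f ≤
    ∑ G ∈ goodSet n d, ∑ H ∈ goodSet n d, piU G * piU H * (f G - f H) ^ 2

open Classical in
/-- The extension of `f` to all multigraphs, for the realization `x` of the Gaussian field. -/
def extension {n d : ℕ} (f : SimpleBip n d → ℝ) (x : Multigraph n d → ℝ) (G : Multigraph n d) : ℝ :=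
  if hG : G.IsSimple then
    if GoodVariation f ∨ (⟨G, hG⟩ : SimpleBip n d) ∈ goodSet n d then f ⟨G, hG⟩
    else (1 / Real.sqrt (probSimple n d)) * (f ⟨G, hG⟩ - meanU f) + meanU f
  else if InCatRange G then nbhdMean f G + x G * Real.sqrt (nbhdVar f G)
  else meanU f

end SwitchChain

end

open scoped ProbabilityTheory

noncomputable section

namespace SwitchChain

/-! ### Counting permutations and functions with prescribed fibres -/

section Fibers

set_option linter.unusedSectionVars false

variable {α β : Type*} [Fintype α] [Fintype β] [DecidableEq α] [DecidableEq β]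

/-! In the configuration model the weight of a multigraph is inversely proportional to the product
of the factorials of its multiplicities (`piBC_mul`). All simple graphs therefore have one common
weight, and a multigraph of category `k` has `2 ^ (-k)` times that weight. The lower bound on the
variance of the extension has two cases, according to `GoodVariation f`.

Suppose first that `f` varies substantially on the good set. Draw `G` from the configuration model
restricted to the categories `1, …, 𝔪`, then a uniform point of its neighbourhood. The resulting law
`pushWeight` is at least `1/16` of the uniform weight at every good graph (`Large.le_pushWeight`).
This is double counting. A neighbourhood in category `k` has between `(nd)^k / 2` and `(nd)^k`
points. A simple graph lies in at most `(nd(d-1)²)^k / k!` neighbourhoods of category `k`, and a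
good graph in at least half as many, because small anti-expansion means that few of its paths of
length three are closed by an edge. The partial exponential sum `poisSum` with rate `(d-1)²/2`
enters both the normalisation (`Large.quarter_le`) and the lower bound on `pushWeight`. It cancels,
so no asymptotic formula for the number of simple graphs is needed.

Hence the variance of `f` is bounded by a constant times the total of `pairWeight`. Markov's
inequality shows that few multigraphs are close to a given one, and a relaxed triangle inequality
then passes to far pairs alone (`Large.sum_close_le`, `sum_le_sum_far`). A pair weight is the
product of the two probabilities times `(h₁ - h₂)² + w₁ + w₂`. When `η = 1`, the three terms of `(h₁
- h₂) + ξ₁√w₁ - ξ₂√w₂` have compatible signs and `|ξ₁|, |ξ₂| ≥ 1`, so the squared increment of the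
extension dominates. The sign property of the field concludes.

Otherwise almost all of the variance sits on the complement of the good set, which has uniform
measure at most `1/100`. There the rescaling by the inverse square root of the probability of being
simple exactly compensates the loss of mass. The extension cannot shift its mean to absorb this,
since on the large good set `f` stays near its old mean (`Large.wVar_extension_ge_of_not`). This
case is deterministic.

The field is found by the first moment method. Colour the entries uniformly with `𝔫` colours and
choose `W` uniformly. For a far pair each block has different selections with probability at least
`1/8`, so with probability at least `1/16` a sixteenth of the blocks disagree. The two Gaussian
variables then have a common part of variance at most `15/16` and independent remainders, and are
separated by `±1` with probability bounded below (`le_measureReal_separated`). Averaging over the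
pairs and then over the choices yields data with the sign property (`exists_fieldData_integral_ge`).
-/

lemma exists_perm_comp_eq (f g : α → β)
    (h : ∀ b, (Finset.univ.filter fun a => f a = b).card
      = (Finset.univ.filter fun a => g a = b).card) :
    ∃ e : Equiv.Perm α, f ∘ e = g := by
  have hb : ∀ b, Nonempty ({a // g a = b} ≃ {a // f a = b}) := fun b => by
    rw [← Fintype.card_eq, Fintype.card_subtype, Fintype.card_subtype, h b]
  have E := fun b => (hb b).some
  refine ⟨(Equiv.sigmaFiberEquiv g).symm.trans
    ((Equiv.sigmaCongrRight fun b => (E b)).trans (Equiv.sigmaFiberEquiv f)), ?_⟩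
  funext a
  exact ((E (g a)) ⟨a, rfl⟩).2

/-- The solutions `e` form a coset of the stabilizer of `f`, and the stabilizer permutes every fibre
of `f` independently. -/
lemma card_perm_comp_eq (f g : α → β)
    (h : ∀ b, (Finset.univ.filter fun a => f a = b).card
      = (Finset.univ.filter fun a => g a = b).card) :
    (Finset.univ.filter fun e : Equiv.Perm α => f ∘ e = g).card
      = ∏ b, (Finset.univ.filter fun a => f a = b).card.factorial := by
  obtain ⟨e₀, he₀⟩ := exists_perm_comp_eq f g h
  have h1 := DomMulAct.stabilizer_card f
  simp only [Fintype.card_subtype] at h1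
  rw [← h1]
  refine Finset.card_bij (fun e _ => e * e₀⁻¹) ?_ ?_ ?_
  · intro e he
    simp only [Finset.mem_filter, Finset.mem_univ, true_and] at he ⊢
    funext a
    have := congrFun (he.trans he₀.symm) (e₀⁻¹ a)
    simpa using this
  · intro e _ e' _ hee
    simpa using hee
  · intro s hs
    simp only [Finset.mem_filter, Finset.mem_univ, true_and] at hs
    refine ⟨s * e₀, ?_, by simp⟩
    simp only [Finset.mem_filter, Finset.mem_univ, true_and]
    funext a
    have := congrFun hs (e₀ a)
    rw [← he₀]
    simpa using this

lemma exists_fun_fibers (m : β → ℕ) (hm : ∑ b, m b = Fintype.card α) :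
    ∃ f : α → β, ∀ b, (Finset.univ.filter fun a => f a = b).card = m b := by
  have : Fintype.card (Σ b, Fin (m b)) = Fintype.card α := by simp [hm]
  let E := Fintype.equivOfCardEq this
  refine ⟨fun a => (E.symm a).1, fun b => ?_⟩
  have h2 : (Finset.univ.filter fun a => (E.symm a).1 = b).card
      = (Finset.univ.filter fun x : (Σ b, Fin (m b)) => x.1 = b).card := by
    refine Finset.card_bij (fun a _ => E.symm a) ?_ ?_ ?_
    · intro a ha; simpa using ha
    · intro a _ a' _ h; simpa using h
    · intro x hx; exact ⟨E x, by simpa using hx, by simp⟩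
  rw [h2, ← Fintype.card_subtype, ← Fintype.card_fin (m b)]
  exact Fintype.card_congr (Equiv.sigmaSubtype b)

/-- The multinomial coefficient: `e ↦ f ∘ e` maps the permutations onto the functions with these
fibre sizes, and all its fibres have the same size by `card_perm_comp_eq`. -/
lemma card_fun_fibers (m : β → ℕ) (hm : ∑ b, m b = Fintype.card α) :
    (Finset.univ.filter fun g : α → β =>
      ∀ b, (Finset.univ.filter fun a => g a = b).card = m b).card * ∏ b, (m b).factorial
      = (Fintype.card α).factorial := by
  obtain ⟨f, hf⟩ := exists_fun_fibers m hm
  have hcard : (Fintype.card α).factorial = (Finset.univ : Finset (Equiv.Perm α)).card := by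
    rw [Finset.card_univ, Fintype.card_perm]
  rw [hcard, Finset.card_eq_sum_card_fiberwise (f := fun e : Equiv.Perm α => f ∘ e)
    (t := Finset.univ.filter fun g : α → β =>
      ∀ b, (Finset.univ.filter fun a => g a = b).card = m b)]
  · rw [Finset.sum_congr rfl (g := fun _ => ∏ b, (m b).factorial), Finset.sum_const, smul_eq_mul]
    intro g hg
    simp only [Finset.mem_filter, Finset.mem_univ, true_and] at hg
    rw [card_perm_comp_eq f g (fun b => by rw [hf, hg])]
    simp [hf]
  · intro e _
    simp only [Finset.coe_filter, Finset.mem_univ, true_and, Set.mem_ofPred_eq]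
    intro b
    rw [← hf b]
    refine Finset.card_bij (fun a _ => e a) ?_ ?_ ?_
    · intro a ha; simpa using ha
    · intro a _ a' _ h; simpa using h
    · intro x hx; exact ⟨e.symm x, by simpa using hx, by simp⟩

/-- Number of permutations with prescribed values at `s` points. -/
lemma card_perm_prescribed {s : ℕ} (x y : Fin s ↪ α) :
    (Finset.univ.filter fun σ : Equiv.Perm α => ∀ r, σ (x r) = y r).card
      * (Fintype.card α).descFactorial s = (Fintype.card α).factorial := by
  have hpre : ∀ y y' : Fin s ↪ α, ∃ τ : Equiv.Perm α, ∀ r, τ (y r) = y' r := by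
    intro y y'
    have := Equiv.Perm.isMultiplyPretransitive α s
    obtain ⟨τ, hτ⟩ := MulAction.exists_smul_eq (Equiv.Perm α) y y'
    exact ⟨τ, fun r => by rw [← hτ]; rfl⟩
  -- Left multiplication by a permutation taking `y'` to `y` shows that all possible value tuples
  -- are equally frequent. These tuples partition the group, which gives the count.
  have heq : ∀ y' : Fin s ↪ α, (Finset.univ.filter fun σ : Equiv.Perm α => ∀ r, σ (x r) = y' r).card
      = (Finset.univ.filter fun σ : Equiv.Perm α => ∀ r, σ (x r) = y r).card := by
    intro y'
    obtain ⟨τ, hτ⟩ := hpre y' y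
    refine Finset.card_bij (fun σ _ => τ * σ) ?_ ?_ ?_
    · intro σ hσ
      simp only [Finset.mem_filter, Finset.mem_univ, true_and] at hσ ⊢
      intro r; simp [hσ r, hτ r]
    · intro σ _ σ' _ h; simpa using h
    · intro σ hσ
      simp only [Finset.mem_filter, Finset.mem_univ, true_and] at hσ
      refine ⟨τ⁻¹ * σ, ?_, by simp⟩
      simp only [Finset.mem_filter, Finset.mem_univ, true_and]
      intro r; simp [hσ r, ← hτ r]
  have hcard : (Fintype.card α).factorial = (Finset.univ : Finset (Equiv.Perm α)).card := by
    rw [Finset.card_univ, Fintype.card_perm]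
  rw [hcard, Finset.card_eq_sum_card_fiberwise (s := Finset.univ)
    (f := fun σ : Equiv.Perm α => x.trans σ.toEmbedding)
    (t := (Finset.univ : Finset (Fin s ↪ α))) (fun _ _ => by simp)]
  have hs : (Finset.univ : Finset (Fin s ↪ α)).card = (Fintype.card α).descFactorial s := by
    rw [Finset.card_univ, Fintype.card_embedding_eq, Fintype.card_fin]
  rw [mul_comm, ← hs, ← smul_eq_mul]
  refine (Finset.sum_const _).symm.trans (Finset.sum_congr rfl fun y' _ => ?_)
  rw [← heq y']
  congr 1
  ext σ
  simp [DFunLike.ext_iff]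

end Fibers

open scoped Classical

/-! ### The configuration model weight -/

/-- A configuration for `G` is built in two stages. Every left vertex distributes its `d` half-edges
over the right vertices in `d! / ∏ⱼ mult!` ways; then every right vertex matches the `d` half-edges
it received with its own in `d!` ways. -/
lemma card_config_mul {n d : ℕ} (G : Multigraph n d) :
    (Finset.univ.filter fun σ : Equiv.Perm (Fin n × Fin d) => configGraph σ = G).card
      * ∏ i, ∏ j, (G.mult i j).factorial = d.factorial ^ (2 * n) := by
  classical
  let S : Finset (Fin n → Fin d → Fin n) := Fintype.piFinset fun i =>
    Finset.univ.filter fun g : Fin d → Fin n =>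
      ∀ j, (Finset.univ.filter fun a => g a = j).card = G.mult i j
  have hS : S.card * ∏ i, ∏ j, (G.mult i j).factorial = d.factorial ^ n := by
    rw [Fintype.card_piFinset, ← Finset.prod_mul_distrib]
    rw [Finset.prod_congr rfl (g := fun _ => d.factorial)]
    · simp
    · intro i _
      have := card_fun_fibers (α := Fin d) (G.mult i) (by simpa using G.row_sum i)
      rw [Fintype.card_fin] at this
      convert this
  have hfst : ∀ b : Fin n,
      (Finset.univ.filter fun a : Fin n × Fin d => a.1 = b).card = d := by
    intro b
    rw [show (Finset.univ.filter fun a : Fin n × Fin d => a.1 = b)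
      = {b} ×ˢ Finset.univ by ext ⟨x, y⟩; simp [eq_comm]]
    simp
  have hfib : (Finset.univ.filter fun σ : Equiv.Perm (Fin n × Fin d) => configGraph σ = G).card
      = S.card * d.factorial ^ n := by
    rw [Finset.card_eq_sum_card_fiberwise
      (f := fun σ : Equiv.Perm (Fin n × Fin d) => fun i a => (σ (i, a)).1) (t := S)]
    · rw [Finset.sum_congr rfl (g := fun _ => d.factorial ^ n), Finset.sum_const, smul_eq_mul]
      intro g hg
      simp only [S, Fintype.mem_piFinset, Finset.mem_filter, Finset.mem_univ, true_and] at hg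
      have := card_perm_comp_eq (α := Fin n × Fin d) (β := Fin n) Prod.fst
        (fun x => g x.1 x.2) (fun b => by
          rw [hfst, Finset.card_filter, Fintype.sum_prod_type]
          refine (G.col_sum b).symm.trans (Finset.sum_congr rfl fun i _ => ?_)
          rw [← Finset.card_filter, hg])
      simp only [hfst, Finset.prod_const, Finset.card_univ, Fintype.card_fin] at this
      rw [← this]
      congr 1
      ext σ
      simp only [Finset.mem_filter, Finset.mem_univ, true_and]
      constructor
      · rintro ⟨_, h2⟩
        funext x
        exact congrFun (congrFun h2 x.1) x.2
      · intro h
        have h2 : ∀ i a, (σ (i, a)).1 = g i a := fun i a => congrFun h (i, a)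
        refine ⟨?_, funext fun i => funext fun a => h2 i a⟩
        ext i j
        simp only [configGraph, h2, hg]
    · intro σ hσ
      simp only [Finset.coe_filter, Finset.mem_univ, true_and, Set.mem_ofPred_eq] at hσ
      subst hσ
      simp only [S, Finset.mem_coe, Fintype.mem_piFinset, Finset.mem_filter, Finset.mem_univ,
        true_and]
      intro i j
      rfl
  rw [hfib, mul_right_comm, hS]
  ring

/-- The configuration weight of a simple graph. -/
def simpleWeight (n d : ℕ) : ℝ := (d.factorial : ℝ) ^ (2 * n) / ((n * d).factorial : ℝ)

lemma simpleWeight_pos (n d : ℕ) : 0 < simpleWeight n d := by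
  unfold simpleWeight; positivity

lemma piBC_nonneg {n d : ℕ} (G : Multigraph n d) : 0 ≤ piBC G := by
  unfold piBC; positivity

lemma piBC_mul {n d : ℕ} (G : Multigraph n d) :
    piBC G * ∏ i, ∏ j, ((G.mult i j).factorial : ℝ) = simpleWeight n d := by
  classical
  have h := card_config_mul G
  have h' : ((Finset.univ.filter fun σ : Equiv.Perm (Fin n × Fin d) => configGraph σ = G).card : ℝ)
      * ∏ i, ∏ j, ((G.mult i j).factorial : ℝ) = (d.factorial : ℝ) ^ (2 * n) := by
    exact_mod_cast h
  unfold piBC simpleWeight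
  rw [Fintype.card_perm, Fintype.card_prod, Fintype.card_fin, Fintype.card_fin, ← h']
  rw [div_mul_eq_mul_div]

lemma piBC_of_isCat {n d k : ℕ} {G : Multigraph n d} (hG : IsCat k G) :
    piBC G = simpleWeight n d / 2 ^ k := by
  rw [← piBC_mul G, eq_div_iff (by positivity)]
  congr 1
  have h1 : ∀ i j, ((G.mult i j).factorial : ℝ) = if G.mult i j = 2 then 2 else 1 := by
    intro i j
    have := hG.le_two i j
    interval_cases G.mult i j <;> simp
  simp only [h1]
  rw [← Fintype.prod_prod_type' (f := fun i j => if G.mult i j = 2 then (2 : ℝ) else 1),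
    Finset.prod_ite, Finset.prod_const_one, mul_one, Finset.prod_const, hG.card_double]

lemma isCat_zero_iff {n d : ℕ} {G : Multigraph n d} : IsCat 0 G ↔ G.IsSimple := by
  constructor
  · intro h i j
    have h2 := h.le_two i j
    have h3 := h.card_double
    rw [Finset.card_eq_zero, Finset.filter_eq_empty_iff] at h3
    have h4 := h3 (Finset.mem_univ (i, j))
    simp only at h4
    omega
  · intro h
    refine ⟨fun i j => (h i j).trans one_le_two, ?_, ?_, ?_⟩
    · rw [Finset.card_eq_zero, Finset.filter_eq_empty_iff]
      intro e _ he
      have := h e.1 e.2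
      omega
    · intro i j j' hj
      have := h i j
      omega
    · intro i i' j hj
      have := h i j
      omega

lemma piBC_of_isSimple {n d : ℕ} {G : Multigraph n d} (hG : G.IsSimple) :
    piBC G = simpleWeight n d := by
  simpa using piBC_of_isCat (isCat_zero_iff.2 hG)

lemma probSimple_eq (n d : ℕ) :
    probSimple n d = Fintype.card (SimpleBip n d) * simpleWeight n d := by
  unfold probSimple
  rw [Finset.sum_congr rfl fun G _ => piBC_of_isSimple G.2]
  simp

/-- Expectations under the configuration model are averages over permutations; the first moment
bounds are computed there. -/
lemma sum_piBC_mul {n d : ℕ} (φ : Multigraph n d → ℝ) :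
    ∑ G, piBC G * φ G = (∑ σ : Equiv.Perm (Fin n × Fin d), φ (configGraph σ))
      / ((n * d).factorial : ℝ) := by
  classical
  rw [← Finset.sum_fiberwise (s := Finset.univ) (g := fun σ => configGraph σ),
    Finset.sum_div]
  refine Finset.sum_congr rfl fun G _ => ?_
  rw [Finset.sum_congr rfl (g := fun _ => φ G)]
  · unfold piBC
    rw [Fintype.card_perm, Fintype.card_prod, Fintype.card_fin, Fintype.card_fin,
      Finset.sum_const, nsmul_eq_mul, div_mul_eq_mul_div]
  · intro σ hσ
    simp only [Finset.mem_filter, Finset.mem_univ, true_and] at hσ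
    rw [hσ]

lemma sum_piBC (n d : ℕ) : ∑ G : Multigraph n d, piBC G = 1 := by
  have := sum_piBC_mul (n := n) (d := d) fun _ => 1
  simp only [mul_one, Finset.sum_const, Finset.card_univ, Fintype.card_perm, Fintype.card_prod,
    Fintype.card_fin, nsmul_eq_mul] at this
  rw [this, div_self]
  positivity

end SwitchChain

namespace SwitchChain

open scoped Classical

/-! ### First moment bounds in the configuration model -/

/-- If exactly one of the two tuples is injective, no bijection fits them. Injectivity on one side
is therefore enough, and in `hitsCol` it is available only on the target side. -/
lemma card_perm_apply_eq_le {α : Type*} [Fintype α] [DecidableEq α] {s : ℕ} (x y : Fin s → α)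
    (h : Function.Injective x ∨ Function.Injective y) :
    (Finset.univ.filter fun σ : Equiv.Perm α => ∀ r, σ (x r) = y r).card
      * (Fintype.card α).descFactorial s ≤ (Fintype.card α).factorial := by
  by_cases hx : Function.Injective x
  · by_cases hy : Function.Injective y
    · exact (card_perm_prescribed ⟨x, hx⟩ ⟨y, hy⟩).le
    · rw [Finset.filter_eq_empty_iff.2, Finset.card_empty, zero_mul]
      · exact Nat.zero_le _
      · intro σ _ hσ
        refine hy ?_
        have : y = σ ∘ x := funext fun r => (hσ r).symm
        rw [this]
        exact σ.injective.comp hx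
  · have hy := h.resolve_left hx
    rw [Finset.filter_eq_empty_iff.2, Finset.card_empty, zero_mul]
    · exact Nat.zero_le _
    · intro σ _ hσ
      refine hx ?_
      have : y = σ ∘ x := funext fun r => (hσ r).symm
      rw [this] at hy
      exact hy.of_comp

/-- The number of parameters `κ` for which `σ` maps the points `x κ` to the points `y κ`. -/
def hits {α K : Type*} [Fintype K] {s : ℕ} (x y : K → Fin s → α) (σ : Equiv.Perm α) : ℕ :=
  (Finset.univ.filter fun κ : K => ∀ r, σ (x κ r) = y κ r).card

/-- Linearity of expectation. Under `2 * s ≤ card α` each factor of the falling factorial is at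
least half the cardinality, which gives the clean factor `(2 / card α) ^ s`. -/
lemma sum_hits_le_card {α K : Type*} [Fintype α] [DecidableEq α] [Fintype K] {s : ℕ} (x y : K → Fin s → α)
    (h : ∀ κ, Function.Injective (x κ) ∨ Function.Injective (y κ))
    (hs : 2 * s ≤ Fintype.card α) :
    (∑ σ : Equiv.Perm α, (hits x y σ : ℝ)) / ((Fintype.card α).factorial : ℝ)
      ≤ Fintype.card K * (2 / Fintype.card α) ^ s := by
  have hdesc : ((Fintype.card α : ℝ) / 2) ^ s ≤ ((Fintype.card α).descFactorial s : ℝ) := by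
    have h1 := Nat.pow_sub_le_descFactorial (Fintype.card α) s
    have h2 : ((Fintype.card α : ℝ) / 2) ≤ ((Fintype.card α + 1 - s : ℕ) : ℝ) := by
      rw [Nat.cast_sub (by omega)]
      have : (2 * s : ℝ) ≤ Fintype.card α := by exact_mod_cast hs
      push_cast
      linarith
    calc ((Fintype.card α : ℝ) / 2) ^ s ≤ ((Fintype.card α + 1 - s : ℕ) : ℝ) ^ s := by gcongr
      _ ≤ _ := by exact_mod_cast h1
  rcases Nat.eq_zero_or_pos s with rfl | hs0
  · simp only [hits, IsEmpty.forall_iff, Finset.filter_true, Finset.card_univ, pow_zero, mul_one,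
      Finset.sum_const, nsmul_eq_mul, Fintype.card_perm]
    rw [mul_div_assoc, mul_comm, div_mul_cancel₀]
    positivity
  have hpos : (0 : ℝ) < Fintype.card α := by
    have : 0 < Fintype.card α := by omega
    exact_mod_cast this
  have hswap : ∑ σ : Equiv.Perm α, hits x y σ
      = ∑ κ : K, (Finset.univ.filter fun σ : Equiv.Perm α => ∀ r, σ (x κ r) = y κ r).card := by
    simp only [hits, Finset.card_filter]
    rw [Finset.sum_comm]
    congr!
  have hswap' : ∑ σ : Equiv.Perm α, (hits x y σ : ℝ)
      = ∑ κ : K, ((Finset.univ.filter fun σ : Equiv.Perm α => ∀ r, σ (x κ r) = y κ r).card : ℝ) := by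
    exact_mod_cast hswap
  rw [hswap', Finset.sum_div]
  calc _ ≤ ∑ κ : K, (2 / (Fintype.card α : ℝ)) ^ s := by
        refine Finset.sum_le_sum fun κ _ => ?_
        have h1 : ((Finset.univ.filter fun σ : Equiv.Perm α => ∀ r, σ (x κ r) = y κ r).card : ℝ)
            * ((Fintype.card α).descFactorial s : ℝ) ≤ ((Fintype.card α).factorial : ℝ) := by
          exact_mod_cast card_perm_apply_eq_le (x κ) (y κ) (h κ)
        rw [div_le_iff₀ (by positivity)]
        have h2 : ((Finset.univ.filter fun σ : Equiv.Perm α => ∀ r, σ (x κ r) = y κ r).card : ℝ)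
            * ((Fintype.card α : ℝ) / 2) ^ s ≤ ((Fintype.card α).factorial : ℝ) :=
          (mul_le_mul_of_nonneg_left hdesc (by positivity)).trans h1
        calc _ = (2 / (Fintype.card α : ℝ)) ^ s * (((Finset.univ.filter
              fun σ : Equiv.Perm α => ∀ r, σ (x κ r) = y κ r).card : ℝ)
            * ((Fintype.card α : ℝ) / 2) ^ s) := by
              rw [mul_left_comm, ← mul_pow, div_mul_div_comm, mul_comm (2 : ℝ), div_self (by positivity),
                one_pow, mul_one]
          _ ≤ _ := by gcongr
    _ = _ := by simp

lemma sum_hits_le {α K : Type*} [Fintype α] [DecidableEq α] [Fintype K] {s N : ℕ} (x y : K → Fin s → α)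
    (hN : Fintype.card α = N) (h : ∀ κ, Function.Injective (x κ) ∨ Function.Injective (y κ))
    (hs : 2 * s ≤ N) :
    (∑ σ : Equiv.Perm α, (hits x y σ : ℝ)) / (N.factorial : ℝ) ≤ Fintype.card K * (2 / N) ^ s := by
  subst hN
  exact sum_hits_le_card x y h hs

section FirstMoment

variable {n d : ℕ}

/-- Index sets of the union bounds: vertices together with half-edge labels. Labels at the single
vertex form an embedding. On the opposite side arbitrary labels are allowed, which only enlarges the
count. -/
abbrev TripleParam (n d : ℕ) := Fin n × Fin n × (Fin 3 ↪ Fin d) × (Fin 3 → Fin d)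
abbrev DoubleParam (n d : ℕ) := Fin n × Fin n × (Fin 2 ↪ Fin d) × (Fin 2 → Fin d)
abbrev IncParam (n d : ℕ) := Fin n × (Fin 4 ↪ Fin d) × Fin n × Fin n × (Fin 4 → Fin d)

def blockPts {s : ℕ} (i : Fin n) (a : Fin s → Fin d) (r : Fin s) : Fin n × Fin d := (i, a r)

/-- The first two points belong to `i`, the last two to `i'`. The case `i = i'` and repeated labels
are not excluded, so this tuple need not be injective. -/
def twoBlockPts (i i' : Fin n) (a : Fin 4 → Fin d) (r : Fin 4) : Fin n × Fin d :=
  (if r < 2 then i else i', a r)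

lemma blockPts_injective {s : ℕ} (i : Fin n) (a : Fin s ↪ Fin d) :
    Function.Injective (blockPts i a) := fun _ _ h =>
  a.injective (Prod.ext_iff.1 h).2

def hitsTriple (σ : Equiv.Perm (Fin n × Fin d)) : ℕ :=
  hits (K := TripleParam n d) (fun κ => blockPts κ.1 κ.2.2.1) (fun κ => blockPts κ.2.1 κ.2.2.2) σ

def hitsDouble (σ : Equiv.Perm (Fin n × Fin d)) : ℕ :=
  hits (K := DoubleParam n d) (fun κ => blockPts κ.1 κ.2.2.1) (fun κ => blockPts κ.2.1 κ.2.2.2) σ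

def hitsRow (σ : Equiv.Perm (Fin n × Fin d)) : ℕ :=
  hits (K := IncParam n d) (fun κ => blockPts κ.1 κ.2.1)
    (fun κ => twoBlockPts κ.2.2.1 κ.2.2.2.1 κ.2.2.2.2) σ

def hitsCol (σ : Equiv.Perm (Fin n × Fin d)) : ℕ :=
  hits (K := IncParam n d) (fun κ => twoBlockPts κ.2.2.1 κ.2.2.2.1 κ.2.2.2.2)
    (fun κ => blockPts κ.1 κ.2.1) σ

lemma hits_pos {α K : Type*} [Fintype K] {s : ℕ} {x y : K → Fin s → α} {σ : Equiv.Perm α}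
    (κ : K) (h : ∀ r, σ (x κ r) = y κ r) : 1 ≤ hits x y σ :=
  Finset.card_pos.2 ⟨κ, by simpa using h⟩

lemma mem_fiber_of_mult {σ : Equiv.Perm (Fin n × Fin d)} {i j : Fin n} {s : ℕ}
    (h : s ≤ (configGraph σ).mult i j) : ∃ a : Fin s ↪ Fin d, ∀ r, (σ (i, a r)).1 = j := by
  have h' : Fintype.card (Fin s)
      ≤ Fintype.card {a : Fin d // (σ (i, a)).1 = j} := by
    rw [Fintype.card_fin, Fintype.card_subtype]
    exact h
  have e := (Function.Embedding.nonempty_of_card_le h').some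
  exact ⟨e.trans (Function.Embedding.subtype _), fun r => (e r).2⟩

lemma one_le_hitsTriple {σ : Equiv.Perm (Fin n × Fin d)} {i j : Fin n}
    (h : 3 ≤ (configGraph σ).mult i j) : 1 ≤ hitsTriple σ := by
  obtain ⟨a, ha⟩ := mem_fiber_of_mult h
  refine hits_pos (i, j, a, fun r => (σ (i, a r)).2) fun r => ?_
  exact Prod.ext (ha r) rfl

lemma card_double_le_hitsDouble (σ : Equiv.Perm (Fin n × Fin d)) :
    (Finset.univ.filter fun e : Fin n × Fin n => (configGraph σ).mult e.1 e.2 = 2).card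
      ≤ hitsDouble σ := by
  refine Finset.card_le_card_of_surjOn (fun κ : DoubleParam n d => (κ.1, κ.2.1)) ?_
  rintro ⟨i, j⟩ he
  simp only [Finset.coe_filter, Finset.mem_univ, true_and, Set.mem_ofPred_eq] at he
  obtain ⟨a, ha⟩ := mem_fiber_of_mult he.ge
  refine ⟨(i, j, a, fun r => (σ (i, a r)).2), ?_, rfl⟩
  simp only [Finset.coe_filter, Finset.mem_univ, true_and, Set.mem_ofPred_eq]
  exact fun r => Prod.ext (ha r) rfl

/-- Joins two pairs into a quadruple. -/
def joinPairs {α : Type*} (a b : Fin 2 → α) : Fin 4 → α := ![a 0, a 1, b 0, b 1]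

lemma one_le_hitsRow {σ : Equiv.Perm (Fin n × Fin d)} {i j j' : Fin n} (hj : j ≠ j')
    (h : 2 ≤ (configGraph σ).mult i j) (h' : 2 ≤ (configGraph σ).mult i j') : 1 ≤ hitsRow σ := by
  obtain ⟨a, ha⟩ := mem_fiber_of_mult h
  obtain ⟨b, hb⟩ := mem_fiber_of_mult h'
  have hab : ∀ r s, a r ≠ b s := fun r s h => hj (by rw [← ha r, ← hb s, h])
  have ha01 : a 0 ≠ a 1 := fun h => by simpa using a.injective h
  have hb01 : b 0 ≠ b 1 := fun h => by simpa using b.injective h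
  have hinj : Function.Injective (joinPairs a b) := by
    intro r s hrs
    fin_cases r <;> fin_cases s <;>
      simp_all [joinPairs, eq_comm]
  refine hits_pos (i, ⟨joinPairs a b, hinj⟩, j, j', fun r => (σ (i, joinPairs a b r)).2) fun r => ?_
  refine Prod.ext ?_ rfl
  fin_cases r
  · exact ha 0
  · exact ha 1
  · exact hb 0
  · exact hb 1

lemma one_le_hitsCol {σ : Equiv.Perm (Fin n × Fin d)} {i i' j : Fin n} (hi : i ≠ i')
    (h : 2 ≤ (configGraph σ).mult i j) (h' : 2 ≤ (configGraph σ).mult i' j) : 1 ≤ hitsCol σ := by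
  obtain ⟨a, ha⟩ := mem_fiber_of_mult h
  obtain ⟨b, hb⟩ := mem_fiber_of_mult h'
  have ha01 : a 0 ≠ a 1 := fun h => by simpa using a.injective h
  have hb01 : b 0 ≠ b 1 := fun h => by simpa using b.injective h
  have hinj : Function.Injective (twoBlockPts i i' (joinPairs a b)) := by
    intro r s hrs
    fin_cases r <;> fin_cases s <;>
      simp_all [joinPairs, twoBlockPts, eq_comm]
  have hfst : ∀ r, (σ (twoBlockPts i i' (joinPairs a b) r)).1 = j := by
    intro r
    fin_cases r
    · exact ha 0
    · exact ha 1
    · exact hb 0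
    · exact hb 1
  -- All four images are half-edges of the same right vertex `j`, so distinct images have distinct
  -- labels.
  have hinj' : Function.Injective fun r => (σ (twoBlockPts i i' (joinPairs a b) r)).2 := by
    intro r s hrs
    exact hinj (σ.injective (Prod.ext ((hfst r).trans (hfst s).symm) hrs))
  refine hits_pos (j, ⟨_, hinj'⟩, i, i', joinPairs a b) fun r => ?_
  exact Prod.ext (hfst r) rfl

/-- The multigraphs of category at most `m`. -/
def CatLe (m : ℕ) (G : Multigraph n d) : Prop := ∃ k ≤ m, IsCat k G

/-- There are four ways to fail: a triple edge, two double edges sharing a left vertex, two sharing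
a right vertex, or more than `m` double edges. The first three are bounded by plain counts, the last
one in the manner of Markov's inequality. -/
lemma not_catLe_le (σ : Equiv.Perm (Fin n × Fin d)) {m : ℕ} (hm : 0 < m) :
    (if CatLe m (configGraph σ) then (0 : ℝ) else 1)
      ≤ hitsTriple σ + hitsRow σ + hitsCol σ + hitsDouble σ / m := by
  have hm' : (0 : ℝ) < m := by exact_mod_cast hm
  split_ifs with hc
  · positivity
  by_cases h3 : ∃ i j, 3 ≤ (configGraph σ).mult i j
  · obtain ⟨i, j, h⟩ := h3
    have : (1 : ℝ) ≤ hitsTriple σ := by exact_mod_cast one_le_hitsTriple h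
    have : (0 : ℝ) ≤ hitsDouble σ / m := by positivity
    have : (0 : ℝ) ≤ hitsRow σ := by positivity
    have : (0 : ℝ) ≤ hitsCol σ := by positivity
    linarith
  by_cases hr : ∃ i j j', j ≠ j' ∧ 2 ≤ (configGraph σ).mult i j ∧ 2 ≤ (configGraph σ).mult i j'
  · obtain ⟨i, j, j', hj, h, h'⟩ := hr
    have : (1 : ℝ) ≤ hitsRow σ := by exact_mod_cast one_le_hitsRow hj h h'
    have : (0 : ℝ) ≤ hitsDouble σ / m := by positivity
    have : (0 : ℝ) ≤ hitsTriple σ := by positivity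
    have : (0 : ℝ) ≤ hitsCol σ := by positivity
    linarith
  by_cases hcol : ∃ i i' j, i ≠ i' ∧ 2 ≤ (configGraph σ).mult i j ∧ 2 ≤ (configGraph σ).mult i' j
  · obtain ⟨i, j, j', hj, h, h'⟩ := hcol
    have : (1 : ℝ) ≤ hitsCol σ := by exact_mod_cast one_le_hitsCol hj h h'
    have : (0 : ℝ) ≤ hitsDouble σ / m := by positivity
    have : (0 : ℝ) ≤ hitsTriple σ := by positivity
    have : (0 : ℝ) ≤ hitsRow σ := by positivity
    linarith
  push Not at h3 hr hcol
  have hcard : m < (Finset.univ.filter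
      fun e : Fin n × Fin n => (configGraph σ).mult e.1 e.2 = 2).card := by
    by_contra hle
    refine hc ⟨_, not_lt.1 hle, fun i j => Nat.lt_succ_iff.1 (h3 i j), rfl, ?_, ?_⟩
    · intro i j j' h h'
      by_contra hne
      exact absurd (hr i j j' hne h.ge) (by omega)
    · intro i i' j h h'
      by_contra hne
      exact absurd (hcol i i' j hne h.ge) (by omega)
  have : (m : ℝ) ≤ hitsDouble σ := by
    exact_mod_cast hcard.le.trans (card_double_le_hitsDouble σ)
  have : (1 : ℝ) ≤ hitsDouble σ / m := by rwa [one_le_div hm']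
  have : (0 : ℝ) ≤ hitsTriple σ := by positivity
  have : (0 : ℝ) ≤ hitsRow σ := by positivity
  have : (0 : ℝ) ≤ hitsCol σ := by positivity
  linarith

lemma card_embedding_fin_le (s d : ℕ) : (Fintype.card (Fin s ↪ Fin d) : ℝ) ≤ (d : ℝ) ^ s := by
  have h := Nat.descFactorial_le_pow d s
  rw [Fintype.card_embedding_eq, Fintype.card_fin, Fintype.card_fin]
  exact_mod_cast h

/-- Counting parameters gives `n² d⁶ (2/nd)³` for triple edges, `n³ d⁸ (2/nd)⁴` for each kind of
incident double edges, and an expected number of double edges of at most `n² d⁴ (2/nd)² = 4d²`. -/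
lemma sum_piBC_not_catLe_le (hn : 0 < n) (hd : 0 < d) (hnd : 8 ≤ n * d) {m : ℕ} (hm : 0 < m) :
    ∑ G : Multigraph n d, piBC G * (if CatLe m G then 0 else 1)
      ≤ 8 * d ^ 3 / n + 32 * d ^ 4 / n + 4 * d ^ 2 / m := by
  have hcard : Fintype.card (Fin n × Fin d) = n * d := by simp
  have hnR : (0 : ℝ) < n := by exact_mod_cast hn
  have hdR : (0 : ℝ) < d := by exact_mod_cast hd
  have hmR : (0 : ℝ) < m := by exact_mod_cast hm
  have h1 : (∑ σ : Equiv.Perm (Fin n × Fin d), (hitsTriple σ : ℝ)) / ((n * d).factorial : ℝ)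
      ≤ 8 * d ^ 3 / n := by
    have := sum_hits_le (K := TripleParam n d) (fun κ => blockPts κ.1 κ.2.2.1)
      (fun κ => blockPts κ.2.1 κ.2.2.2) hcard (fun κ => Or.inl (blockPts_injective _ _))
      (by omega)
    refine this.trans ?_
    simp only [TripleParam, Fintype.card_prod, Fintype.card_fin, Nat.cast_mul, Fintype.card_fun,
      Nat.cast_pow]
    calc _ ≤ (n : ℝ) * (n * ((d : ℝ) ^ 3 * (d : ℝ) ^ 3)) * (2 / (n * d)) ^ 3 := by
          gcongr; exact card_embedding_fin_le 3 d
      _ = _ := by field_simp; ring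
  have h2 : (∑ σ : Equiv.Perm (Fin n × Fin d), (hitsRow σ : ℝ)) / ((n * d).factorial : ℝ)
      ≤ 16 * d ^ 4 / n := by
    have := sum_hits_le (K := IncParam n d) (fun κ => blockPts κ.1 κ.2.1)
      (fun κ => twoBlockPts κ.2.2.1 κ.2.2.2.1 κ.2.2.2.2)
      hcard (fun κ => Or.inl (blockPts_injective _ _)) (by omega)
    refine this.trans ?_
    simp only [IncParam, Fintype.card_prod, Fintype.card_fin, Nat.cast_mul, Fintype.card_fun,
      Nat.cast_pow]
    calc _ ≤ (n : ℝ) * ((d : ℝ) ^ 4 * (n * (n * (d : ℝ) ^ 4))) * (2 / (n * d)) ^ 4 := by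
          gcongr; exact card_embedding_fin_le 4 d
      _ = _ := by field_simp; ring
  have h3 : (∑ σ : Equiv.Perm (Fin n × Fin d), (hitsCol σ : ℝ)) / ((n * d).factorial : ℝ)
      ≤ 16 * d ^ 4 / n := by
    have := sum_hits_le (K := IncParam n d)
      (fun κ => twoBlockPts κ.2.2.1 κ.2.2.2.1 κ.2.2.2.2) (fun κ => blockPts κ.1 κ.2.1)
      hcard (fun κ => Or.inr (blockPts_injective _ _)) (by omega)
    refine this.trans ?_
    simp only [IncParam, Fintype.card_prod, Fintype.card_fin, Nat.cast_mul, Fintype.card_fun,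
      Nat.cast_pow]
    calc _ ≤ (n : ℝ) * ((d : ℝ) ^ 4 * (n * (n * (d : ℝ) ^ 4))) * (2 / (n * d)) ^ 4 := by
          gcongr; exact card_embedding_fin_le 4 d
      _ = _ := by field_simp; ring
  have h4 : (∑ σ : Equiv.Perm (Fin n × Fin d), (hitsDouble σ : ℝ)) / ((n * d).factorial : ℝ)
      ≤ 4 * d ^ 2 := by
    have := sum_hits_le (K := DoubleParam n d) (fun κ => blockPts κ.1 κ.2.2.1)
      (fun κ => blockPts κ.2.1 κ.2.2.2) hcard (fun κ => Or.inl (blockPts_injective _ _))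
      (by omega)
    refine this.trans ?_
    simp only [DoubleParam, Fintype.card_prod, Fintype.card_fin, Nat.cast_mul, Fintype.card_fun,
      Nat.cast_pow]
    calc _ ≤ (n : ℝ) * (n * ((d : ℝ) ^ 2 * (d : ℝ) ^ 2)) * (2 / (n * d)) ^ 2 := by
          gcongr; exact card_embedding_fin_le 2 d
      _ = _ := by field_simp; ring
  rw [sum_piBC_mul]
  calc _ ≤ (∑ σ : Equiv.Perm (Fin n × Fin d),
        ((hitsTriple σ : ℝ) + hitsRow σ + hitsCol σ + hitsDouble σ / m))
        / ((n * d).factorial : ℝ) := by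
        gcongr with σ; exact not_catLe_le σ hm
    _ = (∑ σ : Equiv.Perm (Fin n × Fin d), (hitsTriple σ : ℝ)) / ((n * d).factorial : ℝ)
        + (∑ σ : Equiv.Perm (Fin n × Fin d), (hitsRow σ : ℝ)) / ((n * d).factorial : ℝ)
        + (∑ σ : Equiv.Perm (Fin n × Fin d), (hitsCol σ : ℝ)) / ((n * d).factorial : ℝ)
        + (∑ σ : Equiv.Perm (Fin n × Fin d), (hitsDouble σ : ℝ)) / ((n * d).factorial : ℝ) / m := by
        simp only [Finset.sum_add_distrib, ← Finset.sum_div]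
        field_simp
    _ ≤ 8 * d ^ 3 / n + 16 * d ^ 4 / n + 16 * d ^ 4 / n + 4 * d ^ 2 / m := by gcongr
    _ = _ := by ring

/-- The expected multiplicity of a given pair of vertices is `d / n`. -/
lemma sum_piBC_mult_le (hn : 0 < n) (hd : 0 < d) (i j : Fin n) :
    ∑ G : Multigraph n d, piBC G * (G.mult i j : ℝ) ≤ d / n := by
  have hnR : (0 : ℝ) < n := by exact_mod_cast hn
  have hdR : (0 : ℝ) < d := by exact_mod_cast hd
  have hmult : ∀ σ : Equiv.Perm (Fin n × Fin d), ((configGraph σ).mult i j)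
      ≤ (Finset.univ.filter fun κ : Fin d × Fin d => σ (i, κ.1) = (j, κ.2)).card := by
    intro σ
    simp only [configGraph]
    refine Finset.card_le_card_of_injOn (fun a => (a, (σ (i, a)).2)) ?_ ?_
    · intro a ha
      simp only [Finset.coe_filter, Finset.mem_univ, true_and, Set.mem_ofPred_eq] at ha ⊢
      exact Prod.ext ha rfl
    · intro a _ b _ h
      exact (Prod.ext_iff.1 h).1
  have hone : ∀ x y : Fin n × Fin d,
      ((Finset.univ.filter fun σ : Equiv.Perm (Fin n × Fin d) => σ x = y).card : ℝ)
        / ((n * d).factorial : ℝ) ≤ 1 / (n * d) := by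
    intro x y
    have := card_perm_apply_eq_le (s := 1) (fun _ => x) (fun _ => y)
      (Or.inl (Function.injective_of_subsingleton _))
    simp only [forall_const, Fintype.card_prod, Fintype.card_fin, Nat.descFactorial_one] at this
    have h' : ((Finset.univ.filter fun σ : Equiv.Perm (Fin n × Fin d) => σ x = y).card : ℝ) * (n * d)
      ≤ ((n * d).factorial : ℝ) := by exact_mod_cast this
    rw [div_le_div_iff₀ (by positivity) (by positivity), one_mul]
    exact h'
  rw [sum_piBC_mul]
  calc _ ≤ (∑ σ : Equiv.Perm (Fin n × Fin d),
        ((Finset.univ.filter fun κ : Fin d × Fin d => σ (i, κ.1) = (j, κ.2)).card : ℝ))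
        / ((n * d).factorial : ℝ) := by
        gcongr with σ; exact hmult σ
    _ = ∑ κ : Fin d × Fin d, ((Finset.univ.filter
        fun σ : Equiv.Perm (Fin n × Fin d) => σ (i, κ.1) = (j, κ.2)).card : ℝ)
        / ((n * d).factorial : ℝ) := by
        rw [← Finset.sum_div]
        congr 1
        simp only [Finset.card_filter]
        push_cast
        exact Finset.sum_comm
    _ ≤ ∑ κ : Fin d × Fin d, (1 / (n * d) : ℝ) := Finset.sum_le_sum fun κ _ => hone _ _
    _ = _ := by simp; field_simp

end FirstMoment

end SwitchChain

namespace SwitchChain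

open scoped Classical

/-! ### Multigraphs from integer matrices -/

section Links

variable {n d k : ℕ}

/-- The multigraph with a given nonnegative integer matrix. -/
def Multigraph.ofInt (M : Fin n → Fin n → ℤ) (h0 : ∀ i j, 0 ≤ M i j)
    (hr : ∀ i, ∑ j, M i j = d) (hc : ∀ j, ∑ i, M i j = d) : Multigraph n d where
  mult i j := (M i j).toNat
  row_sum i := by
    have : ((∑ j, (M i j).toNat : ℕ) : ℤ) = d := by
      push_cast
      rw [← hr i]
      exact Finset.sum_congr rfl fun j _ => Int.toNat_of_nonneg (h0 i j)
    exact_mod_cast this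
  col_sum j := by
    have : ((∑ i, (M i j).toNat : ℕ) : ℤ) = d := by
      push_cast
      rw [← hc j]
      exact Finset.sum_congr rfl fun i _ => Int.toNat_of_nonneg (h0 i j)
    exact_mod_cast this

lemma Multigraph.ofInt_mult (M : Fin n → Fin n → ℤ) (h0 : ∀ i j, 0 ≤ M i j)
    (hr : ∀ i, ∑ j, M i j = d) (hc : ∀ j, ∑ i, M i j = d) (i j : Fin n) :
    (((Multigraph.ofInt M h0 hr hc).mult i j : ℕ) : ℤ) = M i j :=
  Int.toNat_of_nonneg (h0 i j)

lemma Multigraph.row_sum_int (G : Multigraph n d) (i : Fin n) : ∑ j, (G.mult i j : ℤ) = d := by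
  exact_mod_cast G.row_sum i

lemma Multigraph.col_sum_int (G : Multigraph n d) (j : Fin n) : ∑ i, (G.mult i j : ℤ) = d := by
  exact_mod_cast G.col_sum j

lemma Multigraph.ext_int {G H : Multigraph n d} (h : ∀ i j, (G.mult i j : ℤ) = H.mult i j) :
    G = H := by
  ext i j
  exact_mod_cast h i j

/-! ### The matrix of a switching -/

/-- A pair of (left, right) pairs `((i, j), (i', j'))`, which codes the switching
`⟨i, i', j, j'⟩`. -/
abbrev Quad (n : ℕ) : Type := (Fin n × Fin n) × (Fin n × Fin n)

/-- The change of the multiplicities under the switching coded by `q`. -/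
def sw (q : Quad n) (a b : Fin n) : ℤ :=
  ((if a = q.2.1 then 1 else 0) - (if a = q.1.1 then 1 else 0)) *
    ((if b = q.1.2 then 1 else 0) - (if b = q.2.2 then 1 else 0))

lemma sw_eq_zero_of_row {q : Quad n} {a : Fin n} (h1 : a ≠ q.1.1) (h2 : a ≠ q.2.1) (b : Fin n) :
    sw q a b = 0 := by simp [sw, h1, h2]

lemma sw_eq_zero_of_col {q : Quad n} {b : Fin n} (h1 : b ≠ q.1.2) (h2 : b ≠ q.2.2) (a : Fin n) :
    sw q a b = 0 := by simp [sw, h1, h2]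

/-- Together with `sum_sw_col`, this means that adding switching matrices preserves the degrees, so
a sum `G + ∑ sw` is a multigraph as soon as its entries are nonnegative. -/
lemma sum_sw_row (q : Quad n) (a : Fin n) : ∑ b, sw q a b = 0 := by
  simp [sw, ← Finset.mul_sum]

lemma sum_sw_col (q : Quad n) (b : Fin n) : ∑ a, sw q a b = 0 := by
  simp [sw, ← Finset.sum_mul]

/-- The four vertices of `q` are distinct. -/
def Quad.Proper (q : Quad n) : Prop := q.1.1 ≠ q.2.1 ∧ q.1.2 ≠ q.2.2

/-- The quadruples `q` and `q'` have no common vertex. -/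
structure Quad.Separated (q q' : Quad n) : Prop where
  l₁ : q.1.1 ≠ q'.1.1
  l₂ : q.1.1 ≠ q'.2.1
  l₃ : q.2.1 ≠ q'.1.1
  l₄ : q.2.1 ≠ q'.2.1
  r₁ : q.1.2 ≠ q'.1.2
  r₂ : q.1.2 ≠ q'.2.2
  r₃ : q.2.2 ≠ q'.1.2
  r₄ : q.2.2 ≠ q'.2.2

lemma Quad.Separated.symm {q q' : Quad n} (h : q.Separated q') : q'.Separated q :=
  ⟨h.l₁.symm, h.l₃.symm, h.l₂.symm, h.l₄.symm, h.r₁.symm, h.r₃.symm, h.r₂.symm, h.r₄.symm⟩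

lemma sw_ij {q : Quad n} (h : q.Proper) : sw q q.1.1 q.1.2 = -1 := by simp [sw, h.1, h.2]

lemma sw_ij' {q : Quad n} (h : q.Proper) : sw q q.1.1 q.2.2 = 1 := by simp [sw, h.1, h.2.symm]

lemma sw_i'j {q : Quad n} (h : q.Proper) : sw q q.2.1 q.1.2 = 1 := by simp [sw, h.1.symm, h.2]

lemma sw_i'j' {q : Quad n} (h : q.Proper) : sw q q.2.1 q.2.2 = -1 := by
  simp [sw, h.1.symm, h.2.symm]

/-- In additive form the order of several switchings becomes irrelevant: their matrices are simply
summed. -/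
lemma isSwitching_iff {q : Quad n} {G H : Multigraph n d} :
    IsSwitching q.1.1 q.2.1 q.1.2 q.2.2 G H ↔
      q.Proper ∧ 0 < G.mult q.1.1 q.1.2 ∧ 0 < G.mult q.2.1 q.2.2 ∧
        ∀ a b, (H.mult a b : ℤ) = G.mult a b + sw q a b := by
  constructor
  · intro h
    have hp : q.Proper := ⟨h.left_ne, h.right_ne⟩
    refine ⟨hp, h.pos₁, h.pos₂, fun a b => ?_⟩
    by_cases hab : (a = q.1.1 ∨ a = q.2.1) ∧ (b = q.1.2 ∨ b = q.2.2)
    · obtain ⟨rfl | rfl, rfl | rfl⟩ := hab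
      · rw [sw_ij hp]; have := h.rem₁; omega
      · rw [sw_ij' hp]; have := h.add₁; omega
      · rw [sw_i'j hp]; have := h.add₂; omega
      · rw [sw_i'j' hp]; have := h.rem₂; omega
    · rw [h.other a b hab]
      by_cases ha : a = q.1.1 ∨ a = q.2.1
      · have hb : ¬ (b = q.1.2 ∨ b = q.2.2) := fun hb => hab ⟨ha, hb⟩
        push Not at hb
        simp [sw_eq_zero_of_col hb.1 hb.2]
      · push Not at ha
        simp [sw_eq_zero_of_row ha.1 ha.2]
  · rintro ⟨hp, h1, h2, h⟩
    refine ⟨hp.1, hp.2, h1, h2, ?_, ?_, ?_, ?_, ?_⟩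
    · have := h q.1.1 q.1.2; rw [sw_ij hp] at this; omega
    · have := h q.2.1 q.2.2; rw [sw_i'j' hp] at this; omega
    · have := h q.1.1 q.2.2; rw [sw_ij' hp] at this; omega
    · have := h q.2.1 q.1.2; rw [sw_i'j hp] at this; omega
    · intro a b hab
      have := h a b
      by_cases ha : a = q.1.1 ∨ a = q.2.1
      · have hb : ¬ (b = q.1.2 ∨ b = q.2.2) := fun hb => hab ⟨ha, hb⟩
        push Not at hb
        rw [sw_eq_zero_of_col hb.1 hb.2] at this
        omega
      · push Not at ha
        rw [sw_eq_zero_of_row ha.1 ha.2] at this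
        omega

/-! ### Families of vertex disjoint switchings -/

/-- A family of quadruples in which all vertices are distinct. -/
structure QuadFamily (q : Fin k → Quad n) : Prop where
  sep : ∀ t s, t ≠ s → (q t).Separated (q s)
  proper : ∀ t, (q t).Proper

lemma QuadFamily.comp_perm {q : Fin k → Quad n} (h : QuadFamily q) (π : Equiv.Perm (Fin k)) :
    QuadFamily (q ∘ π) :=
  ⟨fun _ _ hts => h.sep _ _ fun hπ => hts (π.injective hπ), fun _ => h.proper _⟩

lemma QuadFamily.injective {q : Fin k → Quad n} (h : QuadFamily q) : Function.Injective q := by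
  intro t s hts
  by_contra hne
  exact (h.sep t s hne).l₁ (by rw [hts])

lemma QuadFamily.sw_ne_row {q : Fin k → Quad n} (h : QuadFamily q) {t s : Fin k} (hts : s ≠ t)
    {a : Fin n} (ha : a = (q t).1.1 ∨ a = (q t).2.1) (b : Fin n) : sw (q s) a b = 0 := by
  have := h.sep t s hts.symm
  rcases ha with rfl | rfl
  · exact sw_eq_zero_of_row this.l₁ this.l₂ b
  · exact sw_eq_zero_of_row this.l₃ this.l₄ b

lemma QuadFamily.sw_ne_col {q : Fin k → Quad n} (h : QuadFamily q) {t s : Fin k} (hts : s ≠ t)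
    {b : Fin n} (hb : b = (q t).1.2 ∨ b = (q t).2.2) (a : Fin n) : sw (q s) a b = 0 := by
  have := h.sep t s hts.symm
  rcases hb with rfl | rfl
  · exact sw_eq_zero_of_col this.r₁ this.r₂ a
  · exact sw_eq_zero_of_col this.r₃ this.r₄ a

lemma QuadFamily.sum_row {q : Fin k → Quad n} (h : QuadFamily q) (t : Fin k)
    {a : Fin n} (ha : a = (q t).1.1 ∨ a = (q t).2.1) (b : Fin n) :
    ∑ s, sw (q s) a b = sw (q t) a b :=
  Finset.sum_eq_single t (fun _ _ hs => h.sw_ne_row hs ha b) (fun h => absurd (Finset.mem_univ t) h)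

lemma QuadFamily.sum_col {q : Fin k → Quad n} (h : QuadFamily q) (t : Fin k)
    {b : Fin n} (hb : b = (q t).1.2 ∨ b = (q t).2.2) (a : Fin n) :
    ∑ s, sw (q s) a b = sw (q t) a b :=
  Finset.sum_eq_single t (fun _ _ hs => h.sw_ne_col hs hb a) (fun h => absurd (Finset.mem_univ t) h)

/-- Vertex disjointness lets at most one member act on a given entry, and only on its four corners.
All bounds on entries reduce to these corners. -/
lemma QuadFamily.sum_cases {q : Fin k → Quad n} (h : QuadFamily q) (S : Finset (Fin k))
    (a b : Fin n) :
    ∑ s ∈ S, sw (q s) a b = 0 ∨ ∃ t ∈ S, ∑ s ∈ S, sw (q s) a b = sw (q t) a b ∧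
      (a = (q t).1.1 ∨ a = (q t).2.1) ∧ (b = (q t).1.2 ∨ b = (q t).2.2) := by
  by_cases ha : ∃ t ∈ S, a = (q t).1.1 ∨ a = (q t).2.1
  · obtain ⟨t, htS, ht⟩ := ha
    have hs : ∑ s ∈ S, sw (q s) a b = sw (q t) a b :=
      Finset.sum_eq_single t (fun s _ hs => h.sw_ne_row hs ht b) (fun h => absurd htS h)
    by_cases hb : b = (q t).1.2 ∨ b = (q t).2.2
    · exact Or.inr ⟨t, htS, hs, ht, hb⟩
    · push Not at hb
      exact Or.inl (hs.trans (sw_eq_zero_of_col hb.1 hb.2 a))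
  · push Not at ha
    exact Or.inl (Finset.sum_eq_zero fun s hs => sw_eq_zero_of_row (ha s hs).1 (ha s hs).2 b)

lemma sum_sum_sw_row (q : Fin k → Quad n) (S : Finset (Fin k)) (a : Fin n) :
    ∑ b, ∑ s ∈ S, sw (q s) a b = 0 := by
  rw [Finset.sum_comm]; simp [sum_sw_row]

lemma sum_sum_sw_col (q : Fin k → Quad n) (S : Finset (Fin k)) (b : Fin n) :
    ∑ a, ∑ s ∈ S, sw (q s) a b = 0 := by
  rw [Finset.sum_comm]; simp [sum_sw_col]

/-- `H` arises from `G`, whose double edges are the first components of the quadruples `q t`, by the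
switchings coded by the family `q`. -/
structure Link (G H : Multigraph n d) (q : Fin k → Quad n) : Prop where
  family : QuadFamily q
  le_two : ∀ a b, G.mult a b ≤ 2
  double : ∀ x : Fin n × Fin n, G.mult x.1 x.2 = 2 ↔ ∃ t, (q t).1 = x
  one : ∀ t, G.mult (q t).2.1 (q t).2.2 = 1
  zero₁ : ∀ t, G.mult (q t).2.1 (q t).1.2 = 0
  zero₂ : ∀ t, G.mult (q t).1.1 (q t).2.2 = 0
  eq : ∀ a b, (H.mult a b : ℤ) = G.mult a b + ∑ t, sw (q t) a b

namespace Link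

variable {G H : Multigraph n d} {q : Fin k → Quad n}

lemma two (h : Link G H q) (t : Fin k) : G.mult (q t).1.1 (q t).1.2 = 2 :=
  (h.double (q t).1).2 ⟨t, rfl⟩

lemma comp_perm (h : Link G H q) (π : Equiv.Perm (Fin k)) : Link G H (q ∘ π) where
  family := h.family.comp_perm π
  le_two := h.le_two
  double x := by
    rw [h.double x]
    exact ⟨fun ⟨t, ht⟩ => ⟨π.symm t, by simpa using ht⟩, fun ⟨t, ht⟩ => ⟨π t, ht⟩⟩
  one t := h.one _
  zero₁ t := h.zero₁ _
  zero₂ t := h.zero₂ _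
  eq a b := by
    rw [h.eq a b]
    congr 1
    exact (Equiv.sum_comp π fun t => sw (q t) a b).symm

lemma isCat (h : Link G H q) : IsCat k G where
  le_two := h.le_two
  card_double := by
    have : (Finset.univ.filter fun e : Fin n × Fin n => G.mult e.1 e.2 = 2)
        = Finset.univ.image fun t => (q t).1 := by
      ext x
      simp [h.double x]
    rw [this, Finset.card_image_of_injective, Finset.card_univ, Fintype.card_fin]
    intro t s hts
    by_contra hne
    exact (h.family.sep t s hne).l₁ (by rw [show (q t).1 = (q s).1 from hts])
  row_unique i j j' hj hj' := by
    obtain ⟨t, ht⟩ := (h.double (i, j)).1 hj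
    obtain ⟨s, hs⟩ := (h.double (i, j')).1 hj'
    have hts : t = s := by
      by_contra hne
      exact (h.family.sep t s hne).l₁ (by rw [ht, hs])
    rw [hts, hs] at ht
    exact (Prod.ext_iff.1 ht).2.symm
  col_unique i i' j hj hj' := by
    obtain ⟨t, ht⟩ := (h.double (i, j)).1 hj
    obtain ⟨s, hs⟩ := (h.double (i', j)).1 hj'
    have hts : t = s := by
      by_contra hne
      exact (h.family.sep t s hne).r₁ (by rw [ht, hs])
    rw [hts, hs] at ht
    exact (Prod.ext_iff.1 ht).1.symm

lemma target_ij (h : Link G H q) (t : Fin k) : H.mult (q t).1.1 (q t).1.2 = 1 := by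
  have := h.eq (q t).1.1 (q t).1.2
  rw [h.family.sum_row t (Or.inl rfl), sw_ij (h.family.proper t), h.two t] at this
  omega

lemma target_ij' (h : Link G H q) (t : Fin k) : H.mult (q t).1.1 (q t).2.2 = 1 := by
  have := h.eq (q t).1.1 (q t).2.2
  rw [h.family.sum_row t (Or.inl rfl), sw_ij' (h.family.proper t), h.zero₂ t] at this
  omega

lemma target_i'j (h : Link G H q) (t : Fin k) : H.mult (q t).2.1 (q t).1.2 = 1 := by
  have := h.eq (q t).2.1 (q t).1.2
  rw [h.family.sum_row t (Or.inr rfl), sw_i'j (h.family.proper t), h.zero₁ t] at this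
  omega

/-- The family of switchings is determined by `G` and `H` up to the order. -/
lemma exists_eq (h : Link G H q) {q' : Fin k → Quad n} (h' : Link G H q') (t : Fin k) :
    ∃ s, q t = q' s := by
  obtain ⟨s, hs⟩ := (h'.double (q t).1).1 (h.two t)
  have hp := h.family.proper t
  have hp' := h'.family.proper s
  refine ⟨s, Prod.ext hs.symm (Prod.ext ?_ ?_)⟩
  -- If the second left vertices differed, the entry at `((q t).2.1, (q t).1.2)` would grow by one
  -- according to `q` and be unchanged according to `q'`. The next bullet is the same argument for
  -- the right vertices.
  · by_contra hne
    have e1 := h.eq (q t).2.1 (q t).1.2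
    have e2 := h'.eq (q t).2.1 (q t).1.2
    rw [h.family.sum_col t (Or.inl rfl), sw_i'j hp] at e1
    rw [h'.family.sum_col s (Or.inl (by rw [hs])),
      sw_eq_zero_of_row (by rw [hs]; exact hp.1.symm) hne] at e2
    omega
  · by_contra hne
    have e1 := h.eq (q t).1.1 (q t).2.2
    have e2 := h'.eq (q t).1.1 (q t).2.2
    rw [h.family.sum_row t (Or.inl rfl), sw_ij' hp] at e1
    rw [h'.family.sum_row s (Or.inl (by rw [hs])),
      sw_eq_zero_of_col (by rw [hs]; exact hp.2.symm) hne] at e2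
    omega

/-- This is the source of the factor `k!` in the counts of `sources`: each source corresponds to
exactly the `k!` orderings of one family. -/
lemma exists_perm (h : Link G H q) {q' : Fin k → Quad n} (h' : Link G H q') :
    ∃ π : Equiv.Perm (Fin k), q = q' ∘ π := by
  choose s hs using h.exists_eq h'
  have hinj : Function.Injective s := fun t t' htt =>
    h.family.injective (by rw [hs t, hs t', htt])
  exact ⟨Equiv.ofBijective s hinj.bijective_of_finite, funext hs⟩

/-- It holds for every subfamily `S`, so the switchings may be performed in any order without
leaving the multigraphs. -/
lemma partial_nonneg (h : Link G H q) (S : Finset (Fin k)) (a b : Fin n) :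
    0 ≤ (G.mult a b : ℤ) + ∑ s ∈ S, sw (q s) a b := by
  rcases h.family.sum_cases S a b with h0 | ⟨t, -, ht, rfl | rfl, rfl | rfl⟩
  · rw [h0]; positivity
  · rw [ht, sw_ij (h.family.proper t), h.two t]; norm_num
  · rw [ht, sw_ij' (h.family.proper t)]; positivity
  · rw [ht, sw_i'j (h.family.proper t)]; positivity
  · rw [ht, sw_i'j' (h.family.proper t), h.one t]; norm_num

end Link

/-- The partial sums of a family of switchings. -/
def Link.stage {G H : Multigraph n d} {q : Fin k → Quad n} (h : Link G H q)
    (S : Finset (Fin k)) : Multigraph n d :=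
  Multigraph.ofInt (fun a b => (G.mult a b : ℤ) + ∑ s ∈ S, sw (q s) a b) (h.partial_nonneg S)
    (fun a => by rw [Finset.sum_add_distrib, sum_sum_sw_row, G.row_sum_int, add_zero])
    (fun b => by rw [Finset.sum_add_distrib, sum_sum_sw_col, G.col_sum_int, add_zero])

lemma Link.stage_mult {G H : Multigraph n d} {q : Fin k → Quad n} (h : Link G H q)
    (S : Finset (Fin k)) (a b : Fin n) :
    ((h.stage S).mult a b : ℤ) = G.mult a b + ∑ s ∈ S, sw (q s) a b :=
  Multigraph.ofInt_mult _ _ _ _ a b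

/-- A simple path treats the double edges by increasing left vertex, so the family is sorted first.
The intermediate multigraphs are the partial sums over initial segments. -/
lemma Link.mem_sNbhd {G : Multigraph n d} {H : SimpleBip n d} {q : Fin k → Quad n}
    (h : Link G H.1 q) : H ∈ sNbhd G := by
  have hinj : Function.Injective fun t => (q t).1.1 := by
    intro t s hts
    by_contra hne
    exact (h.family.sep t s hne).l₁ hts
  let π := Tuple.sort fun t => (q t).1.1
  have hmono : StrictMono fun t => ((q ∘ π) t).1.1 :=
    (Tuple.monotone_sort fun t => (q t).1.1).strictMono_of_injective (hinj.comp π.injective)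
  have h' := h.comp_perm π
  generalize q ∘ π = r at hmono h'
  simp only [sNbhd, Finset.mem_filter, Finset.mem_univ, true_and]
  refine ⟨k, fun s => h'.stage (Finset.univ.filter fun t => t.1 < s.1), ⟨h.isCat, ?_,
    fun t => (r t).1, fun t => (r t).2.1, fun t => (r t).2.2, hmono, h'.double, ?_, ?_, ?_, ?_, ?_,
    fun t => ⟨h'.zero₁ t, h'.zero₂ t⟩⟩, ?_⟩
  · refine Multigraph.ext_int fun a b => ?_
    rw [h'.stage_mult]
    simp
  · intro t
    rw [isSwitching_iff (q := r t)]
    have hne : ∀ s ∈ Finset.univ.filter (fun s : Fin k => s.1 < t.1), s ≠ t := by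
      intro s hs hst
      simp [hst] at hs
    refine ⟨h'.family.proper t, ?_, ?_, ?_⟩
    · have := h'.stage_mult (Finset.univ.filter fun s : Fin k => s.1 < t.1) (r t).1.1 (r t).1.2
      rw [Finset.sum_eq_zero fun s hs => h'.family.sw_ne_row (hne s hs) (Or.inl rfl) _,
        h'.two t] at this
      simp only [Fin.val_castSucc]
      omega
    · have := h'.stage_mult (Finset.univ.filter fun s : Fin k => s.1 < t.1) (r t).2.1 (r t).2.2
      rw [Finset.sum_eq_zero fun s hs => h'.family.sw_ne_row (hne s hs) (Or.inr rfl) _,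
        h'.one t] at this
      simp only [Fin.val_castSucc]
      omega
    · intro a b
      rw [h'.stage_mult, h'.stage_mult]
      have : (Finset.univ.filter fun s : Fin k => s.1 < (Fin.succ t).1)
          = insert t (Finset.univ.filter fun s : Fin k => s.1 < (Fin.castSucc t).1) := by
        ext s
        simp only [Finset.mem_filter, Finset.mem_univ, true_and, Fin.val_succ, Finset.mem_insert,
          Fin.val_castSucc, Fin.ext_iff]
        omega
      rw [this, Finset.sum_insert (by simp)]
      ring
  · intro t s
    by_cases hts : t = s
    · rw [hts]; exact (h'.family.proper s).1.symm
    · exact (h'.family.sep t s hts).l₃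
  · intro t s
    by_cases hts : t = s
    · rw [hts]; exact (h'.family.proper s).2.symm
    · exact (h'.family.sep t s hts).r₃
  · intro t s hts
    by_contra hne
    exact (h'.family.sep t s hne).l₄ hts
  · intro t s hts
    by_contra hne
    exact (h'.family.sep t s hne).r₄ hts
  · refine Multigraph.ext_int fun a b => ?_
    rw [h'.stage_mult, h'.eq a b]
    congr 2
    ext s
    simp

lemma IsSimplePath.exists_link {G : Multigraph n d} {P : Fin (k + 1) → Multigraph n d}
    (h : IsSimplePath G P) : ∃ q : Fin k → Quad n, Link G (P (Fin.last k)) q := by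
  obtain ⟨hcat, h0, e, i', j', hmono, hdbl, hsw, hi, hj, hi', hj', hz⟩ := h
  let q : Fin k → Quad n := fun t => (e t, (i' t, j' t))
  have hfam : QuadFamily q := by
    refine ⟨fun t s hts => ⟨?_, ?_, ?_, ?_, ?_, ?_, ?_, ?_⟩, fun t => ⟨?_, ?_⟩⟩
    · exact fun h => hts (hmono.injective h)
    · exact (hi s t).symm
    · exact hi t s
    · exact fun h => hts (hi' h)
    · intro hh
      have h1 := (hdbl (e t)).2 ⟨t, rfl⟩
      have h2 := (hdbl (e s)).2 ⟨s, rfl⟩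
      change (e t).2 = (e s).2 at hh
      rw [← hh] at h2
      exact hts (hmono.injective (hcat.col_unique _ _ _ h1 h2))
    · exact (hj s t).symm
    · exact hj t s
    · exact fun h => hts (hj' h)
    · exact (hi t t).symm
    · exact (hj t t).symm
  -- The path is recovered as the sequence of partial sums; its last term gives the equation of the
  -- link.
  have hP : ∀ m (hm : m < k + 1), ∀ a b, ((P ⟨m, hm⟩).mult a b : ℤ)
      = G.mult a b + ∑ t ∈ Finset.univ.filter (fun t : Fin k => t.1 < m), sw (q t) a b := by
    intro m
    induction m with
    | zero =>
      intro hm a b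
      have : P ⟨0, hm⟩ = G := h0
      rw [this]
      simp
    | succ m ih =>
      intro hm a b
      let t : Fin k := ⟨m, by omega⟩
      have h1 := (isSwitching_iff (q := q t)).1 (hsw t)
      have h2 := h1.2.2.2 a b
      have h3 := ih (by omega) a b
      have e1 : P t.succ = P ⟨m + 1, hm⟩ := rfl
      have e2 : P t.castSucc = P ⟨m, by omega⟩ := rfl
      rw [e1, e2, h3] at h2
      have : (Finset.univ.filter fun s : Fin k => s.1 < m + 1)
          = insert t (Finset.univ.filter fun s : Fin k => s.1 < m) := by
        ext s
        simp only [Finset.mem_filter, Finset.mem_univ, true_and, Finset.mem_insert, Fin.ext_iff, t]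
        omega
      rw [h2, this, Finset.sum_insert (by simp [t])]
      ring
  refine ⟨q, hfam, hcat.le_two, hdbl, ?_, fun t => (hz t).1, fun t => (hz t).2, ?_⟩
  -- The edge `(i' t, j' t)` is present at stage `t`, and earlier switchings do not touch the row
  -- `i' t`, so it is present in `G`. It is not double because `i' t` is no endpoint of a double
  -- edge.
  · intro t
    have h1 := (isSwitching_iff (q := q t)).1 (hsw t)
    have h2 := h1.2.2.1
    have e2 : P t.castSucc = P ⟨t.1, by omega⟩ := rfl
    have h3 := hP t.1 (by omega) (q t).2.1 (q t).2.2
    rw [Finset.sum_eq_zero (fun s hs => hfam.sw_ne_row (t := t) (s := s) (by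
      intro hst; simp [hst] at hs) (Or.inr rfl) _), ← e2] at h3
    have h4 := hcat.le_two (q t).2.1 (q t).2.2
    have h5 : G.mult (q t).2.1 (q t).2.2 ≠ 2 := by
      intro h5
      obtain ⟨s, hs⟩ := (hdbl (q t).2).1 h5
      exact hi t s (by rw [hs])
    omega
  · intro a b
    have := hP k (by omega) a b
    rw [show Fin.last k = ⟨k, by omega⟩ from rfl, this]
    congr 2
    ext s
    simp

lemma IsCat.unique {k' : ℕ} {G : Multigraph n d} (h : IsCat k G) (h' : IsCat k' G) : k = k' := by
  rw [← h.card_double, ← h'.card_double]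

/-- Paths are eliminated here: from now on a neighbourhood is described by unordered, vertex
disjoint families of switchings. -/
lemma mem_sNbhd_iff {G : Multigraph n d} {H : SimpleBip n d} (hG : IsCat k G) :
    H ∈ sNbhd G ↔ ∃ q : Fin k → Quad n, Link G H.1 q := by
  constructor
  · intro h
    simp only [sNbhd, Finset.mem_filter, Finset.mem_univ, true_and] at h
    obtain ⟨k', P, hP, hlast⟩ := h
    obtain rfl := hG.unique hP.1
    obtain ⟨q, hq⟩ := hP.exists_link
    exact ⟨q, hlast ▸ hq⟩
  · rintro ⟨q, hq⟩
    exact hq.mem_sNbhd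

/-- Existence of the target of a family of switchings. -/
lemma exists_link_of_source {G : Multigraph n d} {q : Fin k → Quad n} (hfam : QuadFamily q)
    (hle : ∀ a b, G.mult a b ≤ 2)
    (hdbl : ∀ x : Fin n × Fin n, G.mult x.1 x.2 = 2 ↔ ∃ t, (q t).1 = x)
    (hone : ∀ t, G.mult (q t).2.1 (q t).2.2 = 1) (hz₁ : ∀ t, G.mult (q t).2.1 (q t).1.2 = 0)
    (hz₂ : ∀ t, G.mult (q t).1.1 (q t).2.2 = 0) : ∃ H : SimpleBip n d, Link G H.1 q := by
  have htwo : ∀ t, G.mult (q t).1.1 (q t).1.2 = 2 := fun t => (hdbl _).2 ⟨t, rfl⟩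
  have hrange : ∀ a b, 0 ≤ (G.mult a b : ℤ) + ∑ s, sw (q s) a b ∧
      (G.mult a b : ℤ) + ∑ s, sw (q s) a b ≤ 1 := by
    intro a b
    rcases hfam.sum_cases Finset.univ a b with h0 | ⟨t, -, ht, rfl | rfl, rfl | rfl⟩
    · rw [h0]
      have h2 := hle a b
      -- A double edge is a corner of its own quadruple, where the total change is `-1` and not `0`.
      have h3 : G.mult a b ≠ 2 := by
        intro h3
        obtain ⟨t, ht⟩ := (hdbl (a, b)).1 h3
        have ha : a = (q t).1.1 := by rw [ht]
        have hb : b = (q t).1.2 := by rw [ht]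
        rw [hfam.sum_row t (Or.inl ha), ha, hb, sw_ij (hfam.proper t)] at h0
        omega
      omega
    · rw [ht, sw_ij (hfam.proper t), htwo t]; norm_num
    · rw [ht, sw_ij' (hfam.proper t), hz₂ t]; norm_num
    · rw [ht, sw_i'j (hfam.proper t), hz₁ t]; norm_num
    · rw [ht, sw_i'j' (hfam.proper t), hone t]; norm_num
  let H : Multigraph n d :=
    Multigraph.ofInt (fun a b => (G.mult a b : ℤ) + ∑ s, sw (q s) a b) (fun a b => (hrange a b).1)
    (fun a => by rw [Finset.sum_add_distrib, sum_sum_sw_row, G.row_sum_int, add_zero])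
    (fun b => by rw [Finset.sum_add_distrib, sum_sum_sw_col, G.col_sum_int, add_zero])
  have hH : ∀ a b, (H.mult a b : ℤ) = (G.mult a b : ℤ) + ∑ s, sw (q s) a b := fun a b =>
    Multigraph.ofInt_mult _ _ _ _ a b
  refine ⟨⟨H, fun a b => ?_⟩, hfam, hle, hdbl, hone, hz₁, hz₂, hH⟩
  have := (hrange a b).2
  rw [← hH] at this
  omega

/-- Existence of the source of a family of switchings. -/
lemma exists_link_of_target {H : Multigraph n d} (hs : H.IsSimple) {q : Fin k → Quad n}
    (hfam : QuadFamily q) (h1 : ∀ t, H.mult (q t).1.1 (q t).1.2 = 1)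
    (h2 : ∀ t, H.mult (q t).1.1 (q t).2.2 = 1) (h3 : ∀ t, H.mult (q t).2.1 (q t).1.2 = 1)
    (h4 : ∀ t, H.mult (q t).2.1 (q t).2.2 = 0) : ∃ G : Multigraph n d, Link G H q := by
  have hnn : ∀ a b, 0 ≤ (H.mult a b : ℤ) - ∑ s, sw (q s) a b := by
    intro a b
    rcases hfam.sum_cases Finset.univ a b with h0 | ⟨t, -, ht, rfl | rfl, rfl | rfl⟩
    · rw [h0]; simp
    · rw [ht, sw_ij (hfam.proper t), h1 t]; norm_num
    · rw [ht, sw_ij' (hfam.proper t), h2 t]; norm_num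
    · rw [ht, sw_i'j (hfam.proper t), h3 t]; norm_num
    · rw [ht, sw_i'j' (hfam.proper t), h4 t]; norm_num
  let G : Multigraph n d :=
    Multigraph.ofInt (fun a b => (H.mult a b : ℤ) - ∑ s, sw (q s) a b) hnn
    (fun a => by rw [Finset.sum_sub_distrib, sum_sum_sw_row, H.row_sum_int, sub_zero])
    (fun b => by rw [Finset.sum_sub_distrib, sum_sum_sw_col, H.col_sum_int, sub_zero])
  have hG : ∀ a b, (G.mult a b : ℤ) = (H.mult a b : ℤ) - ∑ s, sw (q s) a b := fun a b =>
    Multigraph.ofInt_mult _ _ _ _ a b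
  have g1 : ∀ t, G.mult (q t).1.1 (q t).1.2 = 2 := fun t => by
    have := hG (q t).1.1 (q t).1.2
    rw [hfam.sum_row t (Or.inl rfl), sw_ij (hfam.proper t), h1 t] at this
    omega
  have g2 : ∀ t, G.mult (q t).1.1 (q t).2.2 = 0 := fun t => by
    have := hG (q t).1.1 (q t).2.2
    rw [hfam.sum_row t (Or.inl rfl), sw_ij' (hfam.proper t), h2 t] at this
    omega
  have g3 : ∀ t, G.mult (q t).2.1 (q t).1.2 = 0 := fun t => by
    have := hG (q t).2.1 (q t).1.2
    rw [hfam.sum_row t (Or.inr rfl), sw_i'j (hfam.proper t), h3 t] at this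
    omega
  have g4 : ∀ t, G.mult (q t).2.1 (q t).2.2 = 1 := fun t => by
    have := hG (q t).2.1 (q t).2.2
    rw [hfam.sum_row t (Or.inr rfl), sw_i'j' (hfam.proper t), h4 t] at this
    omega
  have hcases : ∀ a b, G.mult a b ≤ 1 ∨ (G.mult a b = 2 ∧ ∃ t, (q t).1 = (a, b)) := by
    intro a b
    rcases hfam.sum_cases Finset.univ a b with h0 | ⟨t, -, ht, rfl | rfl, rfl | rfl⟩
    · left
      have := hG a b
      have := hs a b
      omega
    · exact Or.inr ⟨g1 t, t, rfl⟩
    · left; rw [g2]; norm_num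
    · left; rw [g3]; norm_num
    · left; rw [g4]
  refine ⟨G, hfam, fun a b => ?_, fun x => ⟨fun hx => ?_, ?_⟩, g4, g3, g2, fun a b => ?_⟩
  · rcases hcases a b with h | h <;> omega
  · rcases hcases x.1 x.2 with h | h
    · omega
    · exact h.2
  · rintro ⟨t, rfl⟩
    exact g1 t
  · rw [hG a b]; ring

end Links

end SwitchChain

namespace SwitchChain

open scoped Classical

/-! ### Greedy counting -/

/-- The tuples `x` with `x t ∈ A t` without conflicts. -/
def greedyTuples {X : Type*} [Fintype X] {k : ℕ} (conf : X → X → Prop) (A : Fin k → Finset X) :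
    Finset (Fin k → X) :=
  Finset.univ.filter fun x => (∀ t, x t ∈ A t) ∧ ∀ s t, s < t → ¬ conf (x s) (x t)

lemma mem_greedyTuples {X : Type*} [Fintype X] {k : ℕ} {conf : X → X → Prop} {A : Fin k → Finset X}
    {x : Fin k → X} :
    x ∈ greedyTuples conf A ↔ (∀ t, x t ∈ A t) ∧ ∀ s t, s < t → ¬ conf (x s) (x t) := by
  simp [greedyTuples]

/-- Choose the coordinates one after the other: each earlier choice forbids at most `b` values, so
at least `a - k * b` remain at every stage. -/
lemma pow_le_card_greedyTuples {X : Type*} [Fintype X] (conf : X → X → Prop) {a b : ℕ}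
    (hb : ∀ x, (Finset.univ.filter fun y => conf x y).card ≤ b) :
    ∀ (k : ℕ) (A : Fin k → Finset X), (∀ t, a ≤ (A t).card) →
      (a - k * b) ^ k ≤ (greedyTuples conf A).card := by
  intro k
  induction k with
  | zero => intro A _; simp [greedyTuples]
  | succ k ih =>
    intro A hA
    have ihpow := ih (fun t => A t.castSucc) (fun t => hA _)
    set S := greedyTuples conf fun t => A t.castSucc with hS
    have hstep : ∀ x : Fin k → X, a - k * b
        ≤ ((A (Fin.last k)).filter fun y => ∀ s, ¬ conf (x s) y).card := by
      intro x
      let B : Finset X := Finset.univ.biUnion fun s : Fin k => Finset.univ.filter fun y => conf (x s) y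
      have hB : B.card ≤ k * b := by
        have := Finset.card_biUnion_le_card_mul (Finset.univ : Finset (Fin k))
          (fun s => Finset.univ.filter fun y => conf (x s) y) b (fun s _ => hb (x s))
        simpa using this
      have hsub : A (Fin.last k) \ B ⊆ (A (Fin.last k)).filter fun y => ∀ s, ¬ conf (x s) y := by
        intro y hy
        simp only [B, Finset.mem_sdiff, Finset.mem_biUnion, Finset.mem_univ, true_and,
          Finset.mem_filter, not_exists] at hy ⊢
        exact hy
      have h1 := Finset.card_le_card hsub
      have h2 := Finset.le_card_sdiff B (A (Fin.last k))
      have h3 := hA (Fin.last k)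
      omega
    have hsig : S.card * (a - k * b) ≤ (S.sigma fun x =>
        (A (Fin.last k)).filter fun y => ∀ s, ¬ conf (x s) y).card := by
      rw [Finset.card_sigma, ← smul_eq_mul]
      exact Finset.card_nsmul_le_sum _ _ _ fun x _ => hstep x
    have hinj : (S.sigma fun x => (A (Fin.last k)).filter fun y => ∀ s, ¬ conf (x s) y).card
        ≤ (greedyTuples conf A).card := by
      refine Finset.card_le_card_of_injOn
        (fun p => (Fin.snoc p.1 p.2 : Fin (k + 1) → X)) ?_ ?_
      · rintro ⟨x, y⟩ hp
        simp only [Finset.coe_sigma, Set.mem_sigma_iff, Finset.mem_coe, hS, Finset.mem_filter,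
          mem_greedyTuples] at hp
        obtain ⟨⟨h1, h2⟩, h3, h4⟩ := hp
        simp only [Finset.mem_coe, mem_greedyTuples]
        refine ⟨fun t => ?_, fun s t hst => ?_⟩
        · refine Fin.lastCases ?_ (fun t => ?_) t
          · simpa using h3
          · simpa using h1 t
        · induction t using Fin.lastCases with
          | last =>
            induction s using Fin.lastCases with
            | last => exact absurd hst (lt_irrefl _)
            | cast s => simpa using h4 s
          | cast t =>
            induction s using Fin.lastCases with
            | last => exact absurd hst (not_lt.2 (Fin.le_last _))
            | cast s => simpa using h2 s t (by simpa using hst)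
      · rintro ⟨x, y⟩ _ ⟨x', y'⟩ _ h
        have h1 := congrArg (fun z : Fin (k + 1) → X => Fin.init (α := fun _ => X) z) h
        have h2 := congrFun h (Fin.last k)
        simp only [Fin.init_snoc] at h1
        simp only [Fin.snoc_last] at h2
        subst h1 h2
        rfl
    refine le_trans ?_ (hsig.trans hinj)
    have hle : a - (k + 1) * b ≤ a - k * b := by
      have : k * b ≤ (k + 1) * b := Nat.mul_le_mul_right _ (Nat.le_succ k)
      omega
    calc (a - (k + 1) * b) ^ (k + 1) ≤ (a - k * b) ^ (k + 1) := Nat.pow_le_pow_left hle _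
      _ = (a - k * b) ^ k * (a - k * b) := pow_succ _ _
      _ ≤ S.card * (a - k * b) := Nat.mul_le_mul_right _ ihpow

/-! ### Degree bounds -/

section Degrees

variable {n d k : ℕ}

/-- The set of edges, without multiplicities. -/
def supp (G : Multigraph n d) : Finset (Fin n × Fin n) :=
  Finset.univ.filter fun x => G.mult x.1 x.2 ≠ 0

lemma mem_supp {G : Multigraph n d} {x : Fin n × Fin n} : x ∈ supp G ↔ G.mult x.1 x.2 ≠ 0 := by
  simp [supp]

lemma sum_mult (G : Multigraph n d) : ∑ x : Fin n × Fin n, G.mult x.1 x.2 = n * d := by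
  rw [Fintype.sum_prod_type]
  simp [G.row_sum]

lemma sum_supp_mult (G : Multigraph n d) : ∑ x ∈ supp G, G.mult x.1 x.2 = n * d := by
  rw [← sum_mult G]
  exact Finset.sum_filter_ne_zero _

lemma card_supp_le (G : Multigraph n d) : (supp G).card ≤ n * d := by
  rw [← sum_supp_mult G, Finset.card_eq_sum_ones]
  exact Finset.sum_le_sum fun x hx => Nat.one_le_iff_ne_zero.2 (mem_supp.1 hx)

lemma card_row_le (G : Multigraph n d) (a : Fin n) :
    (Finset.univ.filter fun b => G.mult a b ≠ 0).card ≤ d := by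
  refine le_trans ?_ (G.row_sum a).le
  rw [Finset.card_filter]
  refine Finset.sum_le_sum fun b _ => ?_
  split_ifs with h <;> omega

lemma card_col_le (G : Multigraph n d) (b : Fin n) :
    (Finset.univ.filter fun a => G.mult a b ≠ 0).card ≤ d := by
  refine le_trans ?_ (G.col_sum b).le
  rw [Finset.card_filter]
  refine Finset.sum_le_sum fun a _ => ?_
  split_ifs with h <;> omega

lemma card_supp_rows_le (G : Multigraph n d) (R : Finset (Fin n)) :
    ((supp G).filter fun x => x.1 ∈ R).card ≤ R.card * d := by
  have : ((supp G).filter fun x => x.1 ∈ R)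
      ⊆ R.biUnion fun a => (Finset.univ.filter fun b => G.mult a b ≠ 0).image fun b => (a, b) := by
    rintro ⟨a, b⟩ h
    simp only [Finset.mem_filter, mem_supp] at h
    simp only [Finset.mem_biUnion, Finset.mem_image, Finset.mem_filter, Finset.mem_univ, true_and]
    exact ⟨a, h.2, b, h.1, rfl⟩
  exact (Finset.card_le_card this).trans (Finset.card_biUnion_le_card_mul _ _ _ fun a _ =>
    Finset.card_image_le.trans (card_row_le G a))

lemma card_supp_cols_le (G : Multigraph n d) (R : Finset (Fin n)) :
    ((supp G).filter fun x => x.2 ∈ R).card ≤ R.card * d := by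
  have : ((supp G).filter fun x => x.2 ∈ R)
      ⊆ R.biUnion fun b => (Finset.univ.filter fun a => G.mult a b ≠ 0).image fun a => (a, b) := by
    rintro ⟨a, b⟩ h
    simp only [Finset.mem_filter, mem_supp] at h
    simp only [Finset.mem_biUnion, Finset.mem_image, Finset.mem_filter, Finset.mem_univ, true_and]
    exact ⟨b, h.2, a, h.1, rfl⟩
  exact (Finset.card_le_card this).trans (Finset.card_biUnion_le_card_mul _ _ _ fun b _ =>
    Finset.card_image_le.trans (card_col_le G b))

/-! ### The size of the neighbourhoods -/

lemma IsCat.exists_enum {G : Multigraph n d} (hG : IsCat k G) :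
    ∃ e : Fin k → Fin n × Fin n, Function.Injective e ∧
      ∀ x : Fin n × Fin n, G.mult x.1 x.2 = 2 ↔ ∃ t, e t = x := by
  let E := Finset.equivFinOfCardEq hG.card_double
  refine ⟨fun t => (E.symm t).1, fun t s h => E.symm.injective (Subtype.ext h), fun x => ?_⟩
  constructor
  · intro hx
    exact ⟨E ⟨x, by simpa using hx⟩, by simp⟩
  · rintro ⟨t, rfl⟩
    exact (Finset.mem_filter.1 (E.symm t).2).2

/-- Every element of the neighbourhood is reached by switchings with the double edges in a given
order. -/
lemma exists_link_enum {G : Multigraph n d} (hG : IsCat k G) {e : Fin k → Fin n × Fin n}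
    (he : Function.Injective e) (hdbl : ∀ x : Fin n × Fin n, G.mult x.1 x.2 = 2 ↔ ∃ t, e t = x)
    {H : SimpleBip n d} (hH : H ∈ sNbhd G) :
    ∃ x : Fin k → Fin n × Fin n, Link G H.1 fun t => (e t, x t) := by
  obtain ⟨q, hq⟩ := (mem_sNbhd_iff hG).1 hH
  have hs : ∀ t, ∃ s, (q s).1 = e t := fun t => (hq.double (e t)).1 ((hdbl _).2 ⟨t, rfl⟩)
  choose s hs using hs
  have hinj : Function.Injective s := fun t t' htt => he (by rw [← hs t, ← hs t', htt])
  let π : Equiv.Perm (Fin k) := Equiv.ofBijective s hinj.bijective_of_finite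
  refine ⟨fun t => (q (π t)).2, ?_⟩
  have := hq.comp_perm π
  convert this using 2 with t
  exact Prod.ext (hs t).symm rfl

/-- Once the double edges are enumerated, the endpoint is determined by the tuple of auxiliary
edges, each of which is an edge of `G`. -/
lemma card_sNbhd_le {G : Multigraph n d} (hG : IsCat k G) : (sNbhd G).card ≤ (n * d) ^ k := by
  obtain ⟨e, he, hdbl⟩ := hG.exists_enum
  rcases (sNbhd G).eq_empty_or_nonempty with hemp | ⟨H₀, hH₀⟩
  · simp [hemp]
  have : Nonempty (Fin k → Fin n × Fin n) := ⟨(exists_link_enum hG he hdbl hH₀).choose⟩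
  choose! x hx using fun H (hH : H ∈ sNbhd G) => exists_link_enum hG he hdbl hH
  calc (sNbhd G).card ≤ (Fintype.piFinset fun _ : Fin k => supp G).card := by
        refine Finset.card_le_card_of_injOn x ?_ ?_
        · intro H hH
          simp only [Finset.mem_coe, Fintype.mem_piFinset, mem_supp]
          intro t
          have := (hx H hH).one t
          simp only at this
          omega
        · intro H hH H' hH' hxx
          refine Subtype.ext (Multigraph.ext_int fun a b => ?_)
          rw [(hx H hH).eq a b, (hx H' hH').eq a b, hxx]
    _ = (supp G).card ^ k := by simp
    _ ≤ (n * d) ^ k := Nat.pow_le_pow_left (card_supp_le G) k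

/-- `y` is an edge which shares a vertex with `x`. -/
def edgeConf (G : Multigraph n d) (x y : Fin n × Fin n) : Prop :=
  y ∈ supp G ∧ (y.1 = x.1 ∨ y.2 = x.2)

/-- Greedy choice of the auxiliary edges. From `nd` one loses `2k` because of the double edges,
`2kd` for edges meeting an endpoint of a double edge, and `2d²` for edges starting at a neighbour of
`j_t` or ending at a neighbour of `i_t`. Each edge already chosen excludes at most `2d` more. -/
lemma le_card_sNbhd {G : Multigraph n d} (hG : IsCat k G) :
    (n * d - (2 * k + 2 * (k * d) + 2 * (d * d)) - k * (2 * d)) ^ k ≤ (sNbhd G).card := by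
  obtain ⟨e, he, hdbl⟩ := hG.exists_enum
  have hb : ∀ x, (Finset.univ.filter fun y => edgeConf G x y).card ≤ 2 * d := by
    intro x
    have hsub : (Finset.univ.filter fun y => edgeConf G x y)
        ⊆ ((supp G).filter fun y => y.1 ∈ ({x.1} : Finset (Fin n)))
          ∪ ((supp G).filter fun y => y.2 ∈ ({x.2} : Finset (Fin n))) := by
      intro y hy
      obtain ⟨h1, h2⟩ := (Finset.mem_filter.1 hy).2
      simp only [Finset.mem_union, Finset.mem_filter, Finset.mem_singleton]
      tauto
    have h1 := card_supp_rows_le G {x.1}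
    have h2 := card_supp_cols_le G {x.2}
    have h3 := (Finset.card_le_card hsub).trans (Finset.card_union_le _ _)
    simp only [Finset.card_singleton, one_mul] at h1 h2
    omega
  let I : Finset (Fin n) := Finset.univ.image fun s => (e s).1
  let J : Finset (Fin n) := Finset.univ.image fun s => (e s).2
  have hI : I.card ≤ k := Finset.card_image_le.trans (by simp)
  have hJ : J.card ≤ k := Finset.card_image_le.trans (by simp)
  let I' : Fin k → Finset (Fin n) := fun t => Finset.univ.filter fun a => G.mult a (e t).2 ≠ 0
  let J' : Fin k → Finset (Fin n) := fun t => Finset.univ.filter fun b => G.mult (e t).1 b ≠ 0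
  let D : Finset (Fin n × Fin n) := Finset.univ.filter fun x => G.mult x.1 x.2 = 2
  have hD : D.card = k := hG.card_double
  let A : Fin k → Finset (Fin n × Fin n) := fun t => (supp G).filter fun x =>
    x ∉ D ∧ x.1 ∉ I ∧ x.2 ∉ J ∧ x.1 ∉ I' t ∧ x.2 ∉ J' t
  -- The sum of multiplicities counts each of the `k` double edges twice and every other edge once.
  have hsupp : n * d ≤ (supp G).card + k := by
    rw [← sum_supp_mult G, ← hD, Finset.card_eq_sum_ones (supp G), Finset.card_filter,
      ← Finset.sum_filter_of_ne (s := Finset.univ) (p := fun x : Fin n × Fin n => G.mult x.1 x.2 ≠ 0)]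
    · change _ ≤ _ + ∑ x ∈ supp G, _
      rw [← Finset.sum_add_distrib]
      refine Finset.sum_le_sum fun x _ => ?_
      have := hG.le_two x.1 x.2
      split_ifs <;> omega
    · intro x _ hx
      split_ifs at hx with h
      · omega
      · exact absurd rfl hx
  have hA : ∀ t, n * d - (2 * k + 2 * (k * d) + 2 * (d * d)) ≤ (A t).card := by
    intro t
    have hcov : supp G ⊆ A t ∪ (D ∪ (((supp G).filter fun x => x.1 ∈ I)
        ∪ (((supp G).filter fun x => x.2 ∈ J) ∪ (((supp G).filter fun x => x.1 ∈ I' t)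
        ∪ ((supp G).filter fun x => x.2 ∈ J' t))))) := by
      intro x hx
      simp only [Finset.mem_union, Finset.mem_filter, A]
      tauto
    have hI' : (I' t).card ≤ d := card_col_le G _
    have hJ' : (J' t).card ≤ d := card_row_le G _
    have c1 := (card_supp_rows_le G I).trans (Nat.mul_le_mul_right d hI)
    have c2 := (card_supp_cols_le G J).trans (Nat.mul_le_mul_right d hJ)
    have c3 := (card_supp_rows_le G (I' t)).trans (Nat.mul_le_mul_right d hI')
    have c4 := (card_supp_cols_le G (J' t)).trans (Nat.mul_le_mul_right d hJ')
    have c5 := Finset.card_le_card hcov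
    have u1 := Finset.card_union_le (A t) (D ∪ (((supp G).filter fun x => x.1 ∈ I)
        ∪ (((supp G).filter fun x => x.2 ∈ J) ∪ (((supp G).filter fun x => x.1 ∈ I' t)
        ∪ ((supp G).filter fun x => x.2 ∈ J' t)))))
    have u2 := Finset.card_union_le D (((supp G).filter fun x => x.1 ∈ I)
        ∪ (((supp G).filter fun x => x.2 ∈ J) ∪ (((supp G).filter fun x => x.1 ∈ I' t)
        ∪ ((supp G).filter fun x => x.2 ∈ J' t))))
    have u3 := Finset.card_union_le ((supp G).filter fun x => x.1 ∈ I)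
        (((supp G).filter fun x => x.2 ∈ J) ∪ (((supp G).filter fun x => x.1 ∈ I' t)
        ∪ ((supp G).filter fun x => x.2 ∈ J' t)))
    have u4 := Finset.card_union_le ((supp G).filter fun x => x.2 ∈ J)
        (((supp G).filter fun x => x.1 ∈ I' t) ∪ ((supp G).filter fun x => x.2 ∈ J' t))
    have u5 := Finset.card_union_le ((supp G).filter fun x => x.1 ∈ I' t)
        ((supp G).filter fun x => x.2 ∈ J' t)
    omega
  refine (pow_le_card_greedyTuples (edgeConf G) hb k A hA).trans ?_
  set V := greedyTuples (edgeConf G) A with hV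
  have hlink : ∀ x ∈ V, ∃ H : SimpleBip n d, Link G H.1 fun t => (e t, x t) := by
    intro x hx
    simp only [hV, mem_greedyTuples, Finset.mem_filter, Finset.mem_univ, true_and, A, edgeConf, I, J, I', J', D, mem_supp,
      Finset.mem_image, not_exists, not_and, not_or, not_not] at hx
    obtain ⟨hx, hc⟩ := hx
    have hc' : ∀ s t, s ≠ t → (x s).1 ≠ (x t).1 ∧ (x s).2 ≠ (x t).2 := by
      intro s t hst
      rcases lt_or_gt_of_ne hst with h | h
      · exact ⟨fun h' => (hc s t h (hx t).1).1 h'.symm, fun h' => (hc s t h (hx t).1).2 h'.symm⟩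
      · exact hc t s h (hx s).1
    have hee : ∀ s t, s ≠ t → (e s).1 ≠ (e t).1 ∧ (e s).2 ≠ (e t).2 := by
      intro s t hst
      have h1 := (hdbl (e s)).2 ⟨s, rfl⟩
      have h2 := (hdbl (e t)).2 ⟨t, rfl⟩
      refine ⟨fun h => hst (he (Prod.ext h ?_)), fun h => hst (he (Prod.ext ?_ h))⟩
      · rw [← h] at h2; exact hG.row_unique _ _ _ h1 h2
      · rw [← h] at h2; exact hG.col_unique _ _ _ h1 h2
    refine exists_link_of_source ?_ hG.le_two hdbl ?_ ?_ ?_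
    · refine ⟨fun t s hts => ⟨(hee t s hts).1, (hx s).2.2.1 t, fun h => (hx t).2.2.1 s h.symm,
        (hc' t s hts).1, (hee t s hts).2, (hx s).2.2.2.1 t, fun h => (hx t).2.2.2.1 s h.symm,
        (hc' t s hts).2⟩, fun t => ⟨(hx t).2.2.1 t, (hx t).2.2.2.1 t⟩⟩
    · intro t
      have h1 := (hx t).1
      have h2 := (hx t).2.1
      have h3 := hG.le_two (x t).1 (x t).2
      simp only
      omega
    · intro t
      exact (hx t).2.2.2.2.1
    · intro t
      exact (hx t).2.2.2.2.2
  rcases V.eq_empty_or_nonempty with hemp | ⟨x₀, hx₀⟩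
  · simp [hemp]
  have : Nonempty (SimpleBip n d) := ⟨(hlink x₀ hx₀).choose⟩
  choose! H hH using hlink
  refine Finset.card_le_card_of_injOn H (fun x hx => (hH x hx).mem_sNbhd) ?_
  intro x hx x' hx' hxx
  funext t
  have h1 := hH x hx
  rw [hxx] at h1
  obtain ⟨s, hs⟩ := h1.exists_eq (hH x' hx') t
  obtain ⟨h2, h3⟩ := Prod.ext_iff.1 hs
  simp only at h2 h3
  rw [h3, he h2]

/-! ### The number of multigraphs with a given graph in their neighbourhood -/

/-- The multigraphs of category `k` whose neighbourhood contains `H`. -/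
def sources (k : ℕ) (H : SimpleBip n d) : Finset (Multigraph n d) :=
  Finset.univ.filter fun G => IsCat k G ∧ H ∈ sNbhd G

/-- The paths `i' - j - i - j'` of length three in `H`. -/
def threePaths (H : Multigraph n d) : Finset (Quad n) :=
  Finset.univ.filter fun q => H.mult q.1.1 q.1.2 ≠ 0 ∧
    (H.mult q.2.1 q.1.2 ≠ 0 ∧ q.2.1 ≠ q.1.1) ∧ (H.mult q.1.1 q.2.2 ≠ 0 ∧ q.2.2 ≠ q.1.2)

lemma card_row_of_simple {H : Multigraph n d} (hH : H.IsSimple) (a : Fin n) :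
    (Finset.univ.filter fun b => H.mult a b ≠ 0).card = d := by
  refine Eq.trans ?_ (H.row_sum a)
  rw [Finset.card_filter]
  refine Finset.sum_congr rfl fun b _ => ?_
  have := hH a b
  split_ifs with h <;> omega

lemma card_col_of_simple {H : Multigraph n d} (hH : H.IsSimple) (b : Fin n) :
    (Finset.univ.filter fun a => H.mult a b ≠ 0).card = d := by
  refine Eq.trans ?_ (H.col_sum b)
  rw [Finset.card_filter]
  refine Finset.sum_congr rfl fun a _ => ?_
  have := hH a b
  split_ifs with h <;> omega

lemma card_supp_of_simple {H : Multigraph n d} (hH : H.IsSimple) : (supp H).card = n * d := by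
  rw [← sum_supp_mult H, Finset.card_eq_sum_ones]
  refine Finset.sum_congr rfl fun x hx => ?_
  have := hH x.1 x.2
  have := mem_supp.1 hx
  omega

lemma card_threePaths_fiber {H : Multigraph n d} (hH : H.IsSimple) {x : Fin n × Fin n}
    (hx : x ∈ supp H) :
    (Finset.univ.filter fun y : Fin n × Fin n => (H.mult y.1 x.2 ≠ 0 ∧ y.1 ≠ x.1) ∧
      (H.mult x.1 y.2 ≠ 0 ∧ y.2 ≠ x.2)).card = (d - 1) ^ 2 := by
  have h : (Finset.univ.filter fun y : Fin n × Fin n => (H.mult y.1 x.2 ≠ 0 ∧ y.1 ≠ x.1) ∧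
      (H.mult x.1 y.2 ≠ 0 ∧ y.2 ≠ x.2))
      = ((Finset.univ.filter fun a => H.mult a x.2 ≠ 0).erase x.1)
        ×ˢ ((Finset.univ.filter fun b => H.mult x.1 b ≠ 0).erase x.2) := by
    ext y
    simp only [Finset.mem_filter, Finset.mem_univ, true_and, Finset.mem_product, Finset.mem_erase]
    tauto
  rw [h, Finset.card_product, Finset.card_erase_of_mem, Finset.card_erase_of_mem,
    card_row_of_simple hH, card_col_of_simple hH, sq]
  · simpa using mem_supp.1 hx
  · simpa using mem_supp.1 hx

lemma card_threePaths {H : Multigraph n d} (hH : H.IsSimple) :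
    (threePaths H).card = n * d * (d - 1) ^ 2 := by
  have h : threePaths H = (supp H).biUnion fun x => (Finset.univ.filter fun y : Fin n × Fin n =>
      (H.mult y.1 x.2 ≠ 0 ∧ y.1 ≠ x.1) ∧ (H.mult x.1 y.2 ≠ 0 ∧ y.2 ≠ x.2)).image fun y => (x, y) := by
    ext ⟨x, y⟩
    simp only [threePaths, Finset.mem_filter, Finset.mem_univ, true_and, Finset.mem_biUnion,
      mem_supp, Finset.mem_image, Prod.mk.injEq]
    constructor
    · rintro ⟨h1, h2, h3⟩
      exact ⟨x, h1, y, ⟨h2, h3⟩, rfl, rfl⟩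
    · rintro ⟨x', h1, y', ⟨h2, h3⟩, rfl, rfl⟩
      exact ⟨h1, h2, h3⟩
  rw [h, Finset.card_biUnion, ← card_supp_of_simple hH, ← smul_eq_mul, ← Finset.sum_const]
  · refine Finset.sum_congr rfl fun x hx => ?_
    rw [Finset.card_image_of_injective _ (fun y y' h => (Prod.ext_iff.1 h).2),
      card_threePaths_fiber hH hx]
  · intro x _ x' _ hxx
    rw [Function.onFun, Finset.disjoint_left]
    intro q hq hq'
    simp only [Finset.mem_image] at hq hq'
    obtain ⟨y, -, rfl⟩ := hq
    obtain ⟨y', -, h'⟩ := hq'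
    exact hxx (Prod.ext_iff.1 h').1.symm

/-- In the target `H`, every switching leaves a path `i' - j - i - j'` of length three. A source
together with an ordering of its switchings is determined by the resulting `k`-tuple of paths. -/
lemma card_sources_mul_factorial_le (k : ℕ) (H : SimpleBip n d) :
    (sources k H).card * k.factorial ≤ (n * d * (d - 1) ^ 2) ^ k := by
  have hlink : ∀ G ∈ sources k H, ∃ q : Fin k → Quad n, Link G H.1 q := by
    intro G hG
    simp only [sources, Finset.mem_filter, Finset.mem_univ, true_and] at hG
    exact (mem_sNbhd_iff hG.1).1 hG.2
  rcases (sources k H).eq_empty_or_nonempty with hemp | ⟨G₀, hG₀⟩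
  · simp [hemp]
  have : Nonempty (Fin k → Quad n) := ⟨(hlink G₀ hG₀).choose⟩
  choose! q hq using hlink
  have h1 : (sources k H ×ˢ (Finset.univ : Finset (Equiv.Perm (Fin k)))).card
      ≤ (Fintype.piFinset fun _ : Fin k => threePaths H.1).card := by
    refine Finset.card_le_card_of_injOn (fun p => q p.1 ∘ p.2) ?_ ?_
    · rintro ⟨G, π⟩ hp
      simp only [Finset.mem_coe, Finset.mem_product, Finset.mem_univ, and_true] at hp
      simp only [Finset.mem_coe, Fintype.mem_piFinset, threePaths, Finset.mem_filter,
        Finset.mem_univ, true_and, Function.comp]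
      intro t
      have h := hq G hp
      rw [h.target_ij, h.target_i'j, h.target_ij']
      have hp := h.family.proper (π t)
      exact ⟨one_ne_zero, ⟨one_ne_zero, hp.1.symm⟩, one_ne_zero, hp.2.symm⟩
    · rintro ⟨G, π⟩ hp ⟨G', π'⟩ hp' h
      simp only [Finset.mem_coe, Finset.mem_product, Finset.mem_univ, and_true] at hp hp'
      simp only at h
      have hGG : G = G' := by
        refine Multigraph.ext_int fun a b => ?_
        have e1 := ((hq G hp).comp_perm π).eq a b
        have e2 := ((hq G' hp').comp_perm π').eq a b
        rw [h] at e1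
        omega
      subst hGG
      have : π = π' := by
        ext t
        exact congrArg Fin.val ((hq G hp).family.injective (congrFun h t))
      rw [this]
  rw [Finset.card_product, Finset.card_univ, Fintype.card_perm, Fintype.card_fin,
    Fintype.card_piFinset_const, card_threePaths H.2] at h1
  simpa using h1

/-- From any prescribed vertex the path is completed by three successive choices of a neighbour. -/
lemma card_threePaths_through_le {H : Multigraph n d} (v : Fin n) :
    ((threePaths H).filter fun q => q.1.1 = v).card ≤ d ^ 3 ∧
    ((threePaths H).filter fun q => q.2.1 = v).card ≤ d ^ 3 ∧
    ((threePaths H).filter fun q => q.1.2 = v).card ≤ d ^ 3 ∧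
    ((threePaths H).filter fun q => q.2.2 = v).card ≤ d ^ 3 := by
  let R : Fin n → Finset (Fin n) := fun a => Finset.univ.filter fun b => H.mult a b ≠ 0
  let C : Fin n → Finset (Fin n) := fun b => Finset.univ.filter fun a => H.mult a b ≠ 0
  have hR : ∀ a, (R a).card ≤ d := card_row_le H
  have hC : ∀ b, (C b).card ≤ d := card_col_le H
  have gen : ∀ (A : Finset (Fin n)) (B : Fin n → Finset (Fin n)) (D : Fin n → Fin n → Finset (Fin n))
      (F : Fin n → Fin n → Fin n → Quad n), A.card ≤ d → (∀ a, (B a).card ≤ d) →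
      (∀ a b, (D a b).card ≤ d) →
      (A.biUnion fun a => (B a).biUnion fun b => (D a b).image fun c => F a b c).card ≤ d ^ 3 := by
    intro A B D F hA hB hD
    calc _ ≤ A.card * (d * d) := Finset.card_biUnion_le_card_mul _ _ _ fun a _ =>
          (Finset.card_biUnion_le_card_mul _ _ d fun b _ => Finset.card_image_le.trans (hD a b)).trans
            (Nat.mul_le_mul_right d (hB a))
      _ ≤ d * (d * d) := Nat.mul_le_mul_right _ hA
      _ = d ^ 3 := by ring
  refine ⟨?_, ?_, ?_, ?_⟩
  · refine (Finset.card_le_card ?_).trans (gen (R v) (fun j => C j) (fun _ _ => R v)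
      (fun j i' j' => ((v, j), (i', j'))) (hR v) hC (fun _ _ => hR v))
    rintro ⟨⟨i, j⟩, ⟨i', j'⟩⟩ h
    simp only [threePaths, Finset.mem_filter, Finset.mem_univ, true_and] at h
    obtain ⟨⟨h1, h2, h3⟩, rfl⟩ := h
    simp only [Finset.mem_biUnion, Finset.mem_image, R, C, Finset.mem_filter, Finset.mem_univ,
      true_and]
    exact ⟨j, h1, i', h2.1, j', h3.1, rfl⟩
  · refine (Finset.card_le_card ?_).trans (gen (R v) (fun j => C j) (fun _ i => R i)
      (fun j i j' => ((i, j), (v, j'))) (hR v) hC (fun _ i => hR i))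
    rintro ⟨⟨i, j⟩, ⟨i', j'⟩⟩ h
    simp only [threePaths, Finset.mem_filter, Finset.mem_univ, true_and] at h
    obtain ⟨⟨h1, h2, h3⟩, rfl⟩ := h
    simp only [Finset.mem_biUnion, Finset.mem_image, R, C, Finset.mem_filter, Finset.mem_univ,
      true_and]
    exact ⟨j, h2.1, i, h1, j', h3.1, rfl⟩
  · refine (Finset.card_le_card ?_).trans (gen (C v) (fun _ => C v) (fun i _ => R i)
      (fun i i' j' => ((i, v), (i', j'))) (hC v) (fun _ => hC v) (fun i _ => hR i))
    rintro ⟨⟨i, j⟩, ⟨i', j'⟩⟩ h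
    simp only [threePaths, Finset.mem_filter, Finset.mem_univ, true_and] at h
    obtain ⟨⟨h1, h2, h3⟩, rfl⟩ := h
    simp only [Finset.mem_biUnion, Finset.mem_image, R, C, Finset.mem_filter, Finset.mem_univ,
      true_and]
    exact ⟨i, h1, i', h2.1, j', h3.1, rfl⟩
  · refine (Finset.card_le_card ?_).trans (gen (C v) (fun i => R i) (fun _ j => C j)
      (fun i j i' => ((i, j), (i', v))) (hC v) hR (fun _ j => hC j))
    rintro ⟨⟨i, j⟩, ⟨i', j'⟩⟩ h
    simp only [threePaths, Finset.mem_filter, Finset.mem_univ, true_and] at h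
    obtain ⟨⟨h1, h2, h3⟩, rfl⟩ := h
    simp only [Finset.mem_biUnion, Finset.mem_image, R, C, Finset.mem_filter, Finset.mem_univ,
      true_and]
    exact ⟨i, h3.1, j, h1, i', h2.1, rfl⟩

/-- `q'` is a path of length three which shares a vertex with `q`. -/
def quadConf (H : Multigraph n d) (q q' : Quad n) : Prop := q' ∈ threePaths H ∧ ¬ q.Separated q'

lemma card_quadConf_le (H : Multigraph n d) (q : Quad n) :
    (Finset.univ.filter fun q' => quadConf H q q').card ≤ 8 * d ^ 3 := by
  have hsub : (Finset.univ.filter fun q' => quadConf H q q')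
      ⊆ (((threePaths H).filter fun q' => q'.1.1 = q.1.1)
        ∪ ((threePaths H).filter fun q' => q'.2.1 = q.1.1))
        ∪ (((threePaths H).filter fun q' => q'.1.1 = q.2.1)
        ∪ ((threePaths H).filter fun q' => q'.2.1 = q.2.1))
        ∪ ((((threePaths H).filter fun q' => q'.1.2 = q.1.2)
        ∪ ((threePaths H).filter fun q' => q'.2.2 = q.1.2))
        ∪ (((threePaths H).filter fun q' => q'.1.2 = q.2.2)
        ∪ ((threePaths H).filter fun q' => q'.2.2 = q.2.2))) := by
    intro q' hq'
    obtain ⟨h1, h2⟩ := (Finset.mem_filter.1 hq').2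
    simp only [Finset.mem_union, Finset.mem_filter, h1, true_and]
    by_contra hcon
    push Not at hcon
    obtain ⟨⟨⟨c1, c2⟩, c3, c4⟩, ⟨c5, c6⟩, c7, c8⟩ := hcon
    exact h2 ⟨c1.symm, c2.symm, c3.symm, c4.symm, c5.symm, c6.symm, c7.symm, c8.symm⟩
  obtain ⟨a1, a2, -, -⟩ := card_threePaths_through_le (H := H) q.1.1
  obtain ⟨b1, b2, -, -⟩ := card_threePaths_through_le (H := H) q.2.1
  obtain ⟨-, -, c1, c2⟩ := card_threePaths_through_le (H := H) q.1.2
  obtain ⟨-, -, d1, d2⟩ := card_threePaths_through_le (H := H) q.2.2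
  refine (Finset.card_le_card hsub).trans ((Finset.card_union_le _ _).trans ?_)
  refine (add_le_add ((Finset.card_union_le _ _).trans (add_le_add
    ((Finset.card_union_le _ _).trans (add_le_add a1 a2))
    ((Finset.card_union_le _ _).trans (add_le_add b1 b2)))) ((Finset.card_union_le _ _).trans
    (add_le_add ((Finset.card_union_le _ _).trans (add_le_add c1 c2))
    ((Finset.card_union_le _ _).trans (add_le_add d1 d2))))).trans ?_
  omega

/-- Only open paths can be reversed into a double edge. If the middle edge is not counted by
`antiExp`, all of its `(d - 1)²` extensions are open. -/
lemma le_card_open_threePaths {H : Multigraph n d} (hH : H.IsSimple) :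
    (n * d - antiExp H) * (d - 1) ^ 2
      ≤ ((threePaths H).filter fun q => H.mult q.2.1 q.2.2 = 0).card := by
  set Z := Finset.univ.filter fun x : Fin n × Fin n =>
    ∃ k, k ≠ x.1 ∧ H.mult x.1 x.2 ≠ 0 ∧ H.mult k x.2 ≠ 0 ∧
      2 ≤ (Finset.univ.filter fun j => H.mult x.1 j ≠ 0 ∧ H.mult k j ≠ 0).card with hZ
  have hZc : Z.card = antiExp H := rfl
  have hsub : ((supp H \ Z).biUnion fun x => (Finset.univ.filter fun y : Fin n × Fin n =>
      (H.mult y.1 x.2 ≠ 0 ∧ y.1 ≠ x.1) ∧ (H.mult x.1 y.2 ≠ 0 ∧ y.2 ≠ x.2)).image fun y => (x, y))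
      ⊆ (threePaths H).filter fun q => H.mult q.2.1 q.2.2 = 0 := by
    intro q hq
    simp only [Finset.mem_biUnion, Finset.mem_sdiff, mem_supp, Finset.mem_image, Finset.mem_filter,
      Finset.mem_univ, true_and] at hq
    obtain ⟨x, ⟨h1, h2⟩, y, ⟨h3, h4⟩, rfl⟩ := hq
    simp only [threePaths, Finset.mem_filter, Finset.mem_univ, true_and]
    refine ⟨⟨h1, h3, h4⟩, ?_⟩
    -- A closing edge would make the two right vertices of the path common neighbours of the two
    -- left vertices.
    by_contra h0
    refine h2 ?_
    simp only [hZ, Finset.mem_filter, Finset.mem_univ, true_and]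
    refine ⟨y.1, h3.2, h1, h3.1, ?_⟩
    rw [← Finset.card_pair h4.2]
    refine Finset.card_le_card fun j hj => ?_
    simp only [Finset.mem_insert, Finset.mem_singleton] at hj
    simp only [Finset.mem_filter, Finset.mem_univ, true_and]
    rcases hj with rfl | rfl
    · exact ⟨h4.1, h0⟩
    · exact ⟨h1, h3.1⟩
  refine le_trans ?_ (Finset.card_le_card hsub)
  rw [Finset.card_biUnion]
  · have h1 : n * d - antiExp H ≤ (supp H \ Z).card := by
      rw [← hZc, ← card_supp_of_simple hH]
      exact Finset.le_card_sdiff _ _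
    refine (Nat.mul_le_mul_right _ h1).trans ?_
    rw [← smul_eq_mul]
    refine Finset.card_nsmul_le_sum _ _ _ fun x hx => ?_
    rw [Finset.card_image_of_injective _ (fun y y' h => (Prod.ext_iff.1 h).2),
      card_threePaths_fiber hH (Finset.mem_sdiff.1 hx).1]
  · intro x _ x' _ hxx
    rw [Function.onFun, Finset.disjoint_left]
    intro q hq hq'
    simp only [Finset.mem_image] at hq hq'
    obtain ⟨y, -, rfl⟩ := hq
    obtain ⟨y', -, h'⟩ := hq'
    exact hxx (Prod.ext_iff.1 h').1.symm

/-- Greedy choice of `k` open paths of length three without common vertices. A path meets at most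
`8d³` others, and every admissible tuple reverses to a source. -/
lemma le_card_sources_mul_factorial (k : ℕ) (H : SimpleBip n d) :
    ((n * d - antiExp H.1) * (d - 1) ^ 2 - k * (8 * d ^ 3)) ^ k
      ≤ (sources k H).card * k.factorial := by
  let A : Fin k → Finset (Quad n) := fun _ => (threePaths H.1).filter fun q => H.1.mult q.2.1 q.2.2 = 0
  refine (pow_le_card_greedyTuples (quadConf H.1) (card_quadConf_le H.1) k A
    (fun _ => le_card_open_threePaths H.2)).trans ?_
  set V := greedyTuples (quadConf H.1) A with hV
  have hlink : ∀ q ∈ V, ∃ G : Multigraph n d, Link G H.1 q := by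
    intro q hq
    simp only [hV, mem_greedyTuples, Finset.mem_filter, A, quadConf, not_and, not_not] at hq
    obtain ⟨hq, hc⟩ := hq
    have hq' : ∀ t, _ := fun t => by
      have := (hq t).1
      simp only [threePaths, Finset.mem_filter, Finset.mem_univ, true_and] at this
      exact this
    refine exists_link_of_target H.2 ⟨?_, ?_⟩ ?_ ?_ ?_ fun t => (hq t).2
    · intro t s hts
      rcases lt_or_gt_of_ne hts with h | h
      · exact hc t s h (hq s).1
      · exact (hc s t h (hq t).1).symm
    · exact fun t => ⟨(hq' t).2.1.2.symm, (hq' t).2.2.2.symm⟩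
    · intro t
      have := (hq' t).1
      have := H.2 (q t).1.1 (q t).1.2
      omega
    · intro t
      have := (hq' t).2.2.1
      have := H.2 (q t).1.1 (q t).2.2
      omega
    · intro t
      have := (hq' t).2.1.1
      have := H.2 (q t).2.1 (q t).1.2
      omega
  rcases V.eq_empty_or_nonempty with hemp | ⟨x₀, hx₀⟩
  · simp [hemp]
  have : Nonempty (Multigraph n d) := ⟨H.1⟩
  have : Nonempty (Fin k → Quad n) := ⟨x₀⟩
  choose! G hG using hlink
  have hsrc : ∀ q ∈ V, G q ∈ sources k H := by
    intro q hq
    simp only [sources, Finset.mem_filter, Finset.mem_univ, true_and]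
    exact ⟨(hG q hq).isCat, (hG q hq).mem_sNbhd⟩
  have hlink' : ∀ G ∈ sources k H, ∃ q : Fin k → Quad n, Link G H.1 q := by
    intro G hG
    simp only [sources, Finset.mem_filter, Finset.mem_univ, true_and] at hG
    exact (mem_sNbhd_iff hG.1).1 hG.2
  choose! r hr using hlink'
  have hπ : ∀ q ∈ V, ∃ π : Equiv.Perm (Fin k), q = r (G q) ∘ π := fun q hq =>
    (hG q hq).exists_perm (hr _ (hsrc q hq))
  choose! π hπ using hπ
  -- A tuple is recovered from its source and the permutation relating it to the reference family
  -- `r` of that source.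
  have h1 : V.card ≤ (sources k H ×ˢ (Finset.univ : Finset (Equiv.Perm (Fin k)))).card := by
    refine Finset.card_le_card_of_injOn (fun q => (G q, π q)) ?_ ?_
    · intro q hq
      simp only [Finset.mem_coe, Finset.mem_product, Finset.mem_univ, and_true]
      exact hsrc q hq
    · intro q hq q' hq' h
      obtain ⟨e1, e2⟩ := Prod.ext_iff.1 h
      simp only at e1 e2
      rw [hπ q hq, hπ q' hq', e1, e2]
  rwa [Finset.card_product, Finset.card_univ, Fintype.card_perm, Fintype.card_fin] at h1

end Degrees

end SwitchChain

namespace SwitchChain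

open scoped Classical

/-! ### Short cycles in uniformly random simple graphs -/

section ShortCycles

variable {n d : ℕ}

lemma sw_neg {q : Quad n} {a b : Fin n} (h : sw q a b < 0) : (a, b) = q.1 ∨ (a, b) = q.2 := by
  by_contra hcon
  push Not at hcon
  obtain ⟨h1, h2⟩ := hcon
  obtain ⟨⟨i, j⟩, ⟨i', j'⟩⟩ := q
  simp only [ne_eq, Prod.mk.injEq, not_and] at h1 h2
  unfold sw at h
  simp only at h
  split_ifs at h <;> simp_all

lemma exists_switch_of_simple {H : Multigraph n d} (hH : H.IsSimple) {q : Quad n}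
    (hq : q.Proper) (h1 : H.mult q.1.1 q.1.2 ≠ 0) (h2 : H.mult q.2.1 q.2.2 ≠ 0)
    (h3 : H.mult q.2.1 q.1.2 = 0) (h4 : H.mult q.1.1 q.2.2 = 0) :
    ∃ H' : SimpleBip n d, ∀ a b, (H'.1.mult a b : ℤ) = H.mult a b + sw q a b := by
  have h1' : H.mult q.1.1 q.1.2 = 1 := by have := hH q.1.1 q.1.2; omega
  have h2' : H.mult q.2.1 q.2.2 = 1 := by have := hH q.2.1 q.2.2; omega
  have hrange : ∀ a b, 0 ≤ (H.mult a b : ℤ) + sw q a b ∧ (H.mult a b : ℤ) + sw q a b ≤ 1 := by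
    intro a b
    have hs := hH a b
    by_cases ha : a = q.1.1 ∨ a = q.2.1
    · by_cases hb : b = q.1.2 ∨ b = q.2.2
      · rcases ha with rfl | rfl <;> rcases hb with rfl | rfl
        · rw [sw_ij hq, h1']; norm_num
        · rw [sw_ij' hq, h4]; norm_num
        · rw [sw_i'j hq, h3]; norm_num
        · rw [sw_i'j' hq, h2']; norm_num
      · push Not at hb
        rw [sw_eq_zero_of_col hb.1 hb.2]
        omega
    · push Not at ha
      rw [sw_eq_zero_of_row ha.1 ha.2]
      omega
  let M : Multigraph n d := Multigraph.ofInt (fun a b => (H.mult a b : ℤ) + sw q a b)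
    (fun a b => (hrange a b).1)
    (fun a => by rw [Finset.sum_add_distrib, sum_sw_row, H.row_sum_int, add_zero])
    (fun b => by rw [Finset.sum_add_distrib, sum_sw_col, H.col_sum_int, add_zero])
  have hM : ∀ a b, (M.mult a b : ℤ) = (H.mult a b : ℤ) + sw q a b := fun a b =>
    Multigraph.ofInt_mult _ _ _ _ a b
  refine ⟨⟨M, fun a b => ?_⟩, hM⟩
  have := (hrange a b).2
  rw [← hM] at this
  omega

/-- The simple graphs which contain the edges in `E`. -/
def containing (n d : ℕ) (E : Finset (Fin n × Fin n)) : Finset (SimpleBip n d) :=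
  Finset.univ.filter fun H => ∀ x ∈ E, H.1.mult x.1 x.2 ≠ 0

/-- Switching argument: remove the edge `x` together with an edge `y ∉ E` for which the two new
positions are vacant. There are at least `nd - 2d² - c` such `y`. Conversely, the result and `y`
determine the original graph, and `y` joins a neighbour of `x.2` to a neighbour of `x.1`, which
leaves at most `d²` choices. -/
lemma card_containing_insert_mul_le (E : Finset (Fin n × Fin n)) {x : Fin n × Fin n} (hx : x ∉ E)
    {c : ℕ} (hc : E.card ≤ c) :
    (containing n d (insert x E)).card * (n * d - 2 * (d * d) - c)
      ≤ (containing n d E).card * (d * d) := by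
  let Y : SimpleBip n d → Finset (Fin n × Fin n) := fun H => (supp H.1).filter fun y =>
    y ∉ E ∧ H.1.mult y.1 x.2 = 0 ∧ H.1.mult x.1 y.2 = 0
  let Y' : SimpleBip n d → Finset (Fin n × Fin n) := fun H => Finset.univ.filter fun y =>
    H.1.mult y.1 x.2 ≠ 0 ∧ H.1.mult x.1 y.2 ≠ 0
  have hY : ∀ H, n * d - 2 * (d * d) - c ≤ (Y H).card := by
    intro H
    let C : Finset (Fin n) := Finset.univ.filter fun a => H.1.mult a x.2 ≠ 0
    let R : Finset (Fin n) := Finset.univ.filter fun b => H.1.mult x.1 b ≠ 0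
    have hcov : supp H.1 ⊆ Y H ∪ (E ∪ (((supp H.1).filter fun y => y.1 ∈ C)
        ∪ ((supp H.1).filter fun y => y.2 ∈ R))) := by
      intro y hy
      simp only [Finset.mem_union, Finset.mem_filter, Y, C, R, Finset.mem_univ, true_and]
      tauto
    have c1 := (card_supp_rows_le H.1 C).trans (Nat.mul_le_mul_right d (card_col_le H.1 x.2))
    have c2 := (card_supp_cols_le H.1 R).trans (Nat.mul_le_mul_right d (card_row_le H.1 x.1))
    have c3 := Finset.card_le_card hcov
    rw [card_supp_of_simple H.2] at c3
    have u1 := Finset.card_union_le (Y H) (E ∪ (((supp H.1).filter fun y => y.1 ∈ C)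
        ∪ ((supp H.1).filter fun y => y.2 ∈ R)))
    have u2 := Finset.card_union_le E (((supp H.1).filter fun y => y.1 ∈ C)
        ∪ ((supp H.1).filter fun y => y.2 ∈ R))
    have u3 := Finset.card_union_le ((supp H.1).filter fun y => y.1 ∈ C)
        ((supp H.1).filter fun y => y.2 ∈ R)
    omega
  have hY' : ∀ H, (Y' H).card ≤ d * d := by
    intro H
    have : Y' H = (Finset.univ.filter fun a => H.1.mult a x.2 ≠ 0)
        ×ˢ (Finset.univ.filter fun b => H.1.mult x.1 b ≠ 0) := by
      ext y
      simp [Y']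
    rw [this, Finset.card_product]
    exact Nat.mul_le_mul (card_col_le _ _) (card_row_le _ _)
  have hex : ∀ p : (Σ _ : SimpleBip n d, Fin n × Fin n), ∃ H' : SimpleBip n d,
      p ∈ (containing n d (insert x E)).sigma Y →
        Quad.Proper (x, p.2) ∧ ∀ a b, (H'.1.mult a b : ℤ) = p.1.1.mult a b + sw (x, p.2) a b := by
    rintro ⟨H, y⟩
    by_cases hp : (⟨H, y⟩ : Σ _ : SimpleBip n d, Fin n × Fin n)
        ∈ (containing n d (insert x E)).sigma Y
    · simp only [Finset.mem_sigma, containing, Finset.mem_filter, Finset.mem_univ, true_and,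
        Finset.mem_insert, Y, mem_supp, forall_eq_or_imp] at hp
      obtain ⟨⟨h1, h2⟩, h3, h4, h5, h6⟩ := hp
      have hprop : Quad.Proper (x, y) := by
        refine ⟨fun h => h1 ?_, fun h => h1 ?_⟩
        · simp only at h; rw [h]; exact h5
        · simp only at h; rw [h]; exact h6
      obtain ⟨H', hH'⟩ := exists_switch_of_simple H.2 (q := (x, y)) hprop h1 h3 h5 h6
      exact ⟨H', fun _ => ⟨hprop, hH'⟩⟩
    · exact ⟨H, fun h => absurd h hp⟩
  choose T hT using hex
  have hmap : ((containing n d (insert x E)).sigma Y).card ≤ ((containing n d E).sigma Y').card := by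
    refine Finset.card_le_card_of_injOn (fun p => ⟨T p, p.2⟩) ?_ ?_
    · rintro ⟨H, y⟩ hp
      obtain ⟨hprop, hT'⟩ := hT _ hp
      have hp' := hp
      simp only [Finset.coe_sigma, Set.mem_sigma_iff, Finset.mem_coe, containing, Finset.mem_filter,
        Finset.mem_univ, true_and, Finset.mem_insert, Y, mem_supp, forall_eq_or_imp] at hp'
      obtain ⟨⟨h1, h2⟩, h3, h4, h5, h6⟩ := hp'
      simp only [Finset.coe_sigma, Set.mem_sigma_iff, Finset.mem_coe, containing, Finset.mem_filter,
        Finset.mem_univ, true_and, Y']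
      refine ⟨fun z hz => ?_, ?_, ?_⟩
      · have h := hT' z.1 z.2
        have hz0 := h2 z hz
        -- The only edges lost are `x` and `y`, and neither belongs to `E`.
        have hnn : 0 ≤ sw (x, y) z.1 z.2 := by
          by_contra hneg
          rcases sw_neg (not_le.1 hneg) with h | h
          · have hzx : z = x := h
            exact hx (hzx ▸ hz)
          · have hzy : z = y := h
            exact h4 (hzy ▸ hz)
        simp only at h
        omega
      · have h := hT' y.1 x.2
        have h' := sw_i'j hprop
        simp only at h h'
        rw [h'] at h
        omega
      · have h := hT' x.1 y.2
        have h' := sw_ij' hprop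
        simp only at h h'
        rw [h'] at h
        omega
    · rintro ⟨H, y⟩ hp ⟨H', y'⟩ hp' h
      simp only [Sigma.mk.injEq, heq_eq_eq] at h
      obtain ⟨h1, h2⟩ := h
      subst h2
      have : H = H' := by
        refine Subtype.ext (Multigraph.ext_int fun a b => ?_)
        have e1 := (hT _ hp).2 a b
        have e2 := (hT _ hp').2 a b
        rw [h1] at e1
        simp only at e1 e2
        omega
      rw [this]
  rw [Finset.card_sigma, Finset.card_sigma] at hmap
  calc _ ≤ ∑ H ∈ containing n d (insert x E), (Y H).card := by
        rw [← smul_eq_mul]; exact Finset.card_nsmul_le_sum _ _ _ fun H _ => hY H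
    _ ≤ _ := hmap
    _ ≤ _ := by
        rw [← smul_eq_mul]; exact Finset.sum_le_card_nsmul _ _ _ fun H _ => hY' H

/-- The edges of the four-cycle are imposed one at a time. The hypothesis on `n` gives `nd - 2d² - 3
≥ nd/2`, so each edge costs a factor `2d/n`. -/
lemma card_containing_four_le (hd : 0 < d) (hn : 4 * d + 6 ≤ n) {i k j j' : Fin n}
    (hik : k ≠ i) (hj : j' ≠ j) :
    ((containing n d {(i, j), (k, j), (i, j'), (k, j')}).card : ℝ)
      ≤ (2 * d / n) ^ 4 * Fintype.card (SimpleBip n d) := by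
  have hdR : (0 : ℝ) < d := by exact_mod_cast hd
  have hnR : (0 : ℝ) < n := by
    have : 0 < n := by omega
    exact_mod_cast this
  have hM : ((n * d : ℝ)) / 2 ≤ ((n * d - 2 * (d * d) - 3 : ℕ) : ℝ) := by
    have h1 : (4 * d + 6) * d ≤ n * d := Nat.mul_le_mul_right d hn
    have h2 : 2 * (d * d) + 3 ≤ n * d := by nlinarith
    rw [Nat.sub_sub, Nat.cast_sub h2]
    have h1' : ((4 * d + 6) * d : ℝ) ≤ n * d := by exact_mod_cast h1
    have hd1 : (1 : ℝ) ≤ d := by exact_mod_cast hd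
    push_cast
    nlinarith
  have step : ∀ (E : Finset (Fin n × Fin n)) (x : Fin n × Fin n), x ∉ E → E.card ≤ 3 →
      ((containing n d (insert x E)).card : ℝ) ≤ (2 * d / n) * (containing n d E).card := by
    intro E x hx hE
    have h1 : ((containing n d (insert x E)).card : ℝ) * ((n * d - 2 * (d * d) - 3 : ℕ) : ℝ)
        ≤ (containing n d E).card * (d * d) := by
      exact_mod_cast card_containing_insert_mul_le E hx hE
    have h2 : ((containing n d (insert x E)).card : ℝ) * ((n * d : ℝ) / 2)
        ≤ (containing n d E).card * (d * d) :=
      (mul_le_mul_of_nonneg_left hM (by positivity)).trans h1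
    rw [div_mul_eq_mul_div, le_div_iff₀ hnR]
    have : ((containing n d (insert x E)).card : ℝ) * n * d
        ≤ 2 * d * (containing n d E).card * d := by linarith
    exact le_of_mul_le_mul_right this hdR
  have h4 := step {(k, j), (i, j'), (k, j')} (i, j) (by simp [hik.symm, hj.symm]) Finset.card_le_three
  have h3 := step {(i, j'), (k, j')} (k, j) (by simp [hj.symm]) (Finset.card_le_two.trans (by norm_num))
  have h2 := step {(k, j')} (i, j') (by simp [hik.symm]) (by simp)
  have h1 := step ∅ (k, j') (by simp) (by simp)
  have h0 : (containing n d ∅).card = Fintype.card (SimpleBip n d) := by simp [containing]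
  rw [h0] at h1
  have hr : (0 : ℝ) ≤ 2 * d / n := by positivity
  calc _ ≤ _ := h4
    _ ≤ (2 * d / n) * ((2 * d / n) * ((2 * d / n) * ((2 * d / n)
        * Fintype.card (SimpleBip n d)))) := by
        refine mul_le_mul_of_nonneg_left (h3.trans ?_) hr
        refine mul_le_mul_of_nonneg_left (h2.trans ?_) hr
        exact mul_le_mul_of_nonneg_left h1 hr
    _ = _ := by ring

/-- Every edge counted by `antiExp` lies on a four-cycle: two common neighbours provide one
different from `j`. -/
lemma antiExp_le (H : Multigraph n d) :
    antiExp H ≤ (Finset.univ.filter fun q : Quad n => q.Proper ∧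
      ∀ x ∈ ({(q.1.1, q.1.2), (q.2.1, q.1.2), (q.1.1, q.2.2), (q.2.1, q.2.2)} :
        Finset (Fin n × Fin n)), H.mult x.1 x.2 ≠ 0).card := by
  refine Finset.card_le_card_of_surjOn Prod.fst ?_
  rintro ⟨i, j⟩ hx
  simp only [Finset.coe_filter, Finset.mem_univ, true_and, Set.mem_ofPred_eq] at hx
  obtain ⟨k, hk, h1, h2, h3⟩ := hx
  obtain ⟨j', hj', hne⟩ := Finset.exists_mem_ne h3 j
  simp only [Finset.mem_filter, Finset.mem_univ, true_and] at hj'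
  refine ⟨((i, j), (k, j')), ?_, rfl⟩
  simp only [Finset.coe_filter, Finset.mem_univ, true_and, Set.mem_ofPred_eq, Finset.mem_insert,
    Finset.mem_singleton, forall_eq_or_imp, forall_eq]
  exact ⟨⟨hk.symm, hne.symm⟩, h1, h2, hj'.1, hj'.2⟩

lemma sum_antiExp_le (hd : 0 < d) (hn : 4 * d + 6 ≤ n) :
    ∑ H : SimpleBip n d, (antiExp H.1 : ℝ) ≤ 16 * d ^ 4 * Fintype.card (SimpleBip n d) := by
  have hnR : (0 : ℝ) < n := by
    have : 0 < n := by omega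
    exact_mod_cast this
  calc _ ≤ ∑ H : SimpleBip n d, ((Finset.univ.filter fun q : Quad n => q.Proper ∧
      ∀ x ∈ ({(q.1.1, q.1.2), (q.2.1, q.1.2), (q.1.1, q.2.2), (q.2.1, q.2.2)} :
        Finset (Fin n × Fin n)), H.1.mult x.1 x.2 ≠ 0).card : ℝ) :=
        Finset.sum_le_sum fun H _ => by exact_mod_cast antiExp_le H.1
    _ = ∑ q : Quad n, ((Finset.univ.filter fun H : SimpleBip n d => q.Proper ∧
      ∀ x ∈ ({(q.1.1, q.1.2), (q.2.1, q.1.2), (q.1.1, q.2.2), (q.2.1, q.2.2)} :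
        Finset (Fin n × Fin n)), H.1.mult x.1 x.2 ≠ 0).card : ℝ) := by
        simp only [Finset.card_filter, Nat.cast_sum]
        exact Finset.sum_comm
    _ ≤ ∑ q : Quad n, (2 * d / n) ^ 4 * (Fintype.card (SimpleBip n d) : ℝ) := by
        refine Finset.sum_le_sum fun q _ => ?_
        by_cases hq : q.Proper
        · refine le_trans ?_ (card_containing_four_le hd hn (i := q.1.1) (k := q.2.1) (j := q.1.2)
            (j' := q.2.2) hq.1.symm hq.2.symm)
          simp only [hq, true_and]
          rfl
        · simp only [hq, false_and, Finset.filter_false, Finset.card_empty, Nat.cast_zero]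
          positivity
    _ = _ := by
        simp only [Finset.sum_const, Finset.card_univ, Fintype.card_prod, Fintype.card_fin,
          nsmul_eq_mul]
        push_cast
        field_simp
        ring

/-- Markov's inequality. Being an integer above `parZ`, the anti-expansion is at least `parZ + 1`,
which undoes the rounding down in `parZ`. -/
lemma card_not_good_mul_le (hd : 0 < d) (hn : 4 * d + 6 ≤ n) :
    ((Finset.univ.filter fun H : SimpleBip n d => H ∉ goodSet n d).card : ℝ) * (parZ n d + 1)
      ≤ 16 * d ^ 4 * Fintype.card (SimpleBip n d) := by
  refine le_trans ?_ (sum_antiExp_le hd hn)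
  rw [← nsmul_eq_mul]
  calc _ ≤ ∑ H ∈ Finset.univ.filter (fun H : SimpleBip n d => H ∉ goodSet n d),
        (antiExp H.1 : ℝ) := by
        refine Finset.card_nsmul_le_sum _ _ _ fun H hH => ?_
        simp only [goodSet, Finset.mem_filter, Finset.mem_univ, true_and, not_le] at hH
        exact_mod_cast hH
    _ ≤ _ := Finset.sum_le_sum_of_subset_of_nonneg (Finset.filter_subset _ _)
        fun _ _ _ => by positivity

end ShortCycles

end SwitchChain

namespace SwitchChain

open scoped Classical

/-! ### Estimates for large `n` -/

/-- The range of parameters in which all the estimates hold. -/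
structure Large (n d : ℕ) : Prop where
  three_le : 3 ≤ d
  log_ge : 1000 ≤ Real.log n
  pow_le : 10 ^ 6 * (d : ℝ) ^ 10 * Real.log n ^ 4 ≤ n

lemma cast_sub_le_cast (a b : ℕ) : (a : ℝ) - b ≤ ((a - b : ℕ) : ℝ) := by
  have h : a ≤ (a - b) + b := by omega
  have : (a : ℝ) ≤ ((a - b : ℕ) : ℝ) + b := by exact_mod_cast h
  linarith

/-- Bernoulli's inequality: `(1 - X/A) ^ k ≥ 1 - kX/A ≥ 1/2`. It turns the greedy products into main
terms with a loss of one half. -/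
lemma half_pow_le_sub_pow {A X : ℝ} (hA : 0 < A) {k : ℕ} (h : k * X ≤ A / 2) (hX : 0 ≤ X) {B : ℝ}
    (hB : A - X ≤ B) : A ^ k / 2 ≤ B ^ k := by
  rcases Nat.eq_zero_or_pos k with rfl | hk
  · norm_num
  have hk1 : (1 : ℝ) ≤ k := by exact_mod_cast hk
  have hXA : X ≤ A / 2 := by nlinarith
  have hb := one_add_mul_le_pow (a := -(X / A)) (by
    have : X / A ≤ 1 := by rw [div_le_one hA]; linarith
    linarith) k
  have h1 : (1 : ℝ) / 2 ≤ (1 + -(X / A)) ^ k := by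
    refine le_trans ?_ hb
    have : (k : ℝ) * (X / A) ≤ 1 / 2 := by
      rw [← mul_div_assoc, div_le_iff₀ hA]; linarith
    linarith
  calc A ^ k / 2 = A ^ k * (1 / 2) := by ring
    _ ≤ A ^ k * (1 + -(X / A)) ^ k := by gcongr
    _ = (A - X) ^ k := by rw [← mul_pow]; congr 1; field_simp; ring
    _ ≤ B ^ k := by
        have : 0 ≤ A - X := by linarith
        gcongr

/-! ### Sizes of neighbourhoods and source sets up to a factor two, and the masses of the
categories. -/

section Estimates

variable {n d k : ℕ}

namespace Large

lemma d_ge (L : Large n d) : (3 : ℝ) ≤ d := by exact_mod_cast L.three_le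

lemma d_pos (L : Large n d) : 0 < d := lt_of_lt_of_le (by norm_num) L.three_le

lemma pow_mul_log_le (L : Large n d) {a b : ℕ} (ha : a ≤ 10) (hb : b ≤ 4) :
    10 ^ 6 * (d : ℝ) ^ a * Real.log n ^ b ≤ n := by
  have h1 : (1 : ℝ) ≤ d := by linarith [L.d_ge]
  have h2 : (1 : ℝ) ≤ Real.log n := by linarith [L.log_ge]
  refine le_trans ?_ L.pow_le
  gcongr

lemma pow_le' (L : Large n d) {a : ℕ} (ha : a ≤ 10) : 10 ^ 6 * (d : ℝ) ^ a ≤ n := by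
  simpa using L.pow_mul_log_le ha (Nat.zero_le 4)

lemma n_ge (L : Large n d) : 10 ^ 6 ≤ n := by
  have := L.pow_le' (Nat.zero_le 10)
  rw [pow_zero, mul_one] at this
  exact_mod_cast this

lemma n_pos (L : Large n d) : (0 : ℝ) < n := by
  exact_mod_cast lt_of_lt_of_le (by norm_num) L.n_ge

lemma parM_le (L : Large n d) : (parM n d : ℝ) ≤ d ^ 2 * Real.log n := by
  unfold parM
  push_cast
  have := Nat.floor_le (a := Real.log n) (by linarith [L.log_ge])
  gcongr

lemma le_parM (L : Large n d) : (999 : ℝ) * d ^ 2 ≤ parM n d := by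
  unfold parM
  push_cast
  have h : (1000 : ℕ) ≤ ⌊Real.log n⌋₊ := Nat.le_floor (by simpa using L.log_ge)
  have h' : (1000 : ℝ) ≤ ⌊Real.log n⌋₊ := by exact_mod_cast h
  nlinarith [sq_nonneg (d : ℝ)]

lemma parM_sq_le (L : Large n d) : (parM n d : ℝ) ^ 2 ≤ d ^ 4 * Real.log n ^ 2 := by
  have := L.parM_le
  calc (parM n d : ℝ) ^ 2 ≤ (d ^ 2 * Real.log n) ^ 2 := by gcongr
    _ = _ := by ring

/-- The four kinds of loss in `le_card_sNbhd` amount to at most `8 𝔪 d`, and `𝔪` times this is small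
compared with `nd`. -/
lemma half_pow_le_card_sNbhd (L : Large n d) {G : Multigraph n d} (hG : IsCat k G) (hk : k ≤ parM n d) :
    ((n : ℝ) * d) ^ k / 2 ≤ ((sNbhd G).card : ℝ) := by
  have hd := L.d_ge
  have hn := L.n_pos
  have hkR : (k : ℝ) ≤ parM n d := by exact_mod_cast hk
  have hm := L.le_parM
  have hm2 := L.parM_sq_le
  have hbig := L.pow_mul_log_le (a := 4) (b := 2) (by norm_num) (by norm_num)
  have hcard : (((n * d - (2 * k + 2 * (k * d) + 2 * (d * d)) - k * (2 * d) : ℕ) : ℝ)) ^ k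
      ≤ ((sNbhd G).card : ℝ) := by exact_mod_cast le_card_sNbhd hG
  refine le_trans (half_pow_le_sub_pow (A := (n : ℝ) * d) (X := 8 * parM n d * d)
    (by positivity) ?_ (by positivity) ?_) hcard
  · calc (k : ℝ) * (8 * parM n d * d) ≤ parM n d * (8 * parM n d * d) := by gcongr
      _ = 8 * parM n d ^ 2 * d := by ring
      _ ≤ 8 * (d ^ 4 * Real.log n ^ 2) * d := by gcongr
      _ ≤ n * d / 2 := by
        have : 16 * ((d : ℝ) ^ 4 * Real.log n ^ 2) ≤ n := by
          refine le_trans ?_ hbig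
          have : 0 ≤ (d : ℝ) ^ 4 * Real.log n ^ 2 := by positivity
          linarith
        nlinarith
  · rw [Nat.sub_sub]
    refine le_trans ?_ (cast_sub_le_cast _ _)
    push_cast
    have h1 : (k : ℝ) * d ≤ parM n d * d := by gcongr
    have h2 : (k : ℝ) ≤ parM n d * d := by nlinarith
    have h3 : (d : ℝ) * d ≤ parM n d * d := by nlinarith
    linarith

/-- The critical loss comes from closed paths: over `k ≤ 𝔪` choices it costs the relative amount `𝔪
𝔷 / (nd) ≤ 1 / log n`. The square of the logarithm in `parZ` provides for this. -/
lemma half_pow_le_card_sources (L : Large n d) {H : SimpleBip n d} (hH : H ∈ goodSet n d) (hk : k ≤ parM n d) :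
    ((n : ℝ) * d * ((d - 1 : ℕ) : ℝ) ^ 2) ^ k / 2 ≤ ((sources k H).card : ℝ) * k.factorial := by
  have hd := L.d_ge
  have hn := L.n_pos
  have hlog := L.log_ge
  have hkR : (k : ℝ) ≤ parM n d := by exact_mod_cast hk
  have hm2 := L.parM_sq_le
  have hm := L.parM_le
  have hbig := L.pow_mul_log_le (a := 7) (b := 2) (by norm_num) (by norm_num)
  have hd1 : (1 : ℝ) ≤ ((d - 1 : ℕ) : ℝ) := by
    have : 1 ≤ d - 1 := by have := L.three_le; omega
    exact_mod_cast this
  set D : ℝ := ((d - 1 : ℕ) : ℝ) with hD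
  have hz : (antiExp H.1 : ℝ) ≤ parZ n d := by
    simp only [goodSet, Finset.mem_filter, Finset.mem_univ, true_and] at hH
    exact_mod_cast hH
  have hzle : (parZ n d : ℝ) ≤ n / (d * Real.log n ^ 2) := Nat.floor_le (by positivity)
  have hcard : ((((n * d - antiExp H.1) * (d - 1) ^ 2 - k * (8 * d ^ 3) : ℕ) : ℝ)) ^ k
      ≤ ((sources k H).card : ℝ) * k.factorial := by
    exact_mod_cast le_card_sources_mul_factorial k H
  refine le_trans (half_pow_le_sub_pow (A := (n : ℝ) * d * D ^ 2)
    (X := parZ n d * D ^ 2 + 8 * parM n d * d ^ 3) (by positivity) ?_ (by positivity) ?_) hcard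
  · have h1 : (parM n d : ℝ) * parZ n d ≤ n * d / 4 := by
      calc (parM n d : ℝ) * parZ n d ≤ (d ^ 2 * Real.log n) * (n / (d * Real.log n ^ 2)) := by gcongr
        _ = n * d / Real.log n := by field_simp
        _ ≤ n * d / 4 := by gcongr; linarith
    have h2 : 8 * (parM n d : ℝ) ^ 2 * d ^ 3 ≤ n * d * D ^ 2 / 4 := by
      calc 8 * (parM n d : ℝ) ^ 2 * d ^ 3 ≤ 8 * (d ^ 4 * Real.log n ^ 2) * d ^ 3 := by gcongr
        _ = 8 * (d ^ 7 * Real.log n ^ 2) := by ring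
        _ ≤ n / 4 := by
          have : 0 ≤ (d : ℝ) ^ 7 * Real.log n ^ 2 := by positivity
          linarith
        _ ≤ n * d * D ^ 2 / 4 := by
          have : (1 : ℝ) ≤ d * D ^ 2 := by nlinarith
          nlinarith
    calc (k : ℝ) * (parZ n d * D ^ 2 + 8 * parM n d * d ^ 3)
        ≤ parM n d * (parZ n d * D ^ 2 + 8 * parM n d * d ^ 3) := by gcongr
      _ = (parM n d * parZ n d) * D ^ 2 + 8 * (parM n d : ℝ) ^ 2 * d ^ 3 := by ring
      _ ≤ (n * d / 4) * D ^ 2 + n * d * D ^ 2 / 4 := by gcongr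
      _ = _ := by ring
  · refine le_trans ?_ (cast_sub_le_cast _ _)
    push_cast
    rw [← hD]
    have h1 := cast_sub_le_cast (n * d) (antiExp H.1)
    push_cast at h1
    have h2 : ((n : ℝ) * d - parZ n d) * D ^ 2 ≤ ((n * d - antiExp H.1 : ℕ) : ℝ) * D ^ 2 := by
      gcongr; linarith
    have h3 : (k : ℝ) * (8 * d ^ 3) ≤ parM n d * (8 * d ^ 3) := by gcongr
    linarith

/-- Each of the three error terms is at most `1/10`; the one for too many double edges is small
because `𝔪 ≥ 999 d²`. -/
lemma half_le_sum_catLe (L : Large n d) :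
    1 / 2 ≤ ∑ G : Multigraph n d, piBC G * (if CatLe (parM n d) G then 1 else 0) := by
  have hd := L.d_ge
  have hn := L.n_pos
  have hnN : 0 < n := by exact_mod_cast hn
  have hm := L.le_parM
  have hmpos : (0 : ℝ) < parM n d := by nlinarith
  have h8 : 8 ≤ n * d := by
    have h1 := L.n_ge
    nlinarith [L.d_pos]
  have h := sum_piBC_not_catLe_le (n := n) (d := d) hnN L.d_pos h8 (m := parM n d)
    (by exact_mod_cast hmpos)
  have e1 : 8 * (d : ℝ) ^ 3 / n ≤ 1 / 10 := by
    rw [div_le_iff₀ hn]; have := L.pow_le' (a := 3) (by norm_num); nlinarith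
  have e2 : 32 * (d : ℝ) ^ 4 / n ≤ 1 / 10 := by
    rw [div_le_iff₀ hn]; have := L.pow_le' (a := 4) (by norm_num); nlinarith
  have e3 : 4 * (d : ℝ) ^ 2 / parM n d ≤ 1 / 10 := by
    rw [div_le_iff₀ hmpos]; nlinarith
  have hsum : ∑ G : Multigraph n d, piBC G * (if CatLe (parM n d) G then 1 else 0)
      + ∑ G : Multigraph n d, piBC G * (if CatLe (parM n d) G then 0 else 1) = 1 := by
    rw [← Finset.sum_add_distrib]
    refine Eq.trans ?_ (sum_piBC n d)
    refine Finset.sum_congr rfl fun G _ => ?_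
    split_ifs <;> ring
  linarith

end Large

/-- The mean number of double edges in the configuration model, up to lower order terms. -/
def poisRate (d : ℕ) : ℝ := ((d - 1 : ℕ) : ℝ) ^ 2 / 2

/-- A partial sum of the exponential series. -/
def poisSum (n d : ℕ) : ℝ := ∑ k ∈ Finset.range (parM n d + 1), poisRate d ^ k / k.factorial

/-- The multigraphs of category `k`. -/
def catSet (n d k : ℕ) : Finset (Multigraph n d) := Finset.univ.filter fun G => IsCat k G

lemma mem_catSet {G : Multigraph n d} : G ∈ catSet n d k ↔ IsCat k G := by simp [catSet]

lemma sum_catLe_eq (n d m : ℕ) :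
    ∑ G : Multigraph n d, piBC G * (if CatLe m G then 1 else 0)
      = ∑ k ∈ Finset.range (m + 1), ((catSet n d k).card : ℝ) * (simpleWeight n d / 2 ^ k) := by
  have h1 : (Finset.univ.filter fun G : Multigraph n d => CatLe m G)
      = (Finset.range (m + 1)).biUnion fun k => catSet n d k := by
    ext G
    simp only [Finset.mem_filter, Finset.mem_univ, true_and, Finset.mem_biUnion,
      Finset.mem_range, Nat.lt_succ_iff, mem_catSet]
    exact Iff.rfl
  simp only [mul_ite, mul_one, mul_zero]
  rw [← Finset.sum_filter, h1, Finset.sum_biUnion]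
  · refine Finset.sum_congr rfl fun k _ => ?_
    rw [← nsmul_eq_mul, ← Finset.sum_const]
    exact Finset.sum_congr rfl fun G hG => piBC_of_isCat (mem_catSet.1 hG)
  · intro k _ k' _ hkk
    rw [Function.onFun, Finset.disjoint_left]
    intro G hG hG'
    exact hkk ((mem_catSet.1 hG).unique (mem_catSet.1 hG'))

/-- Double counting of the pairs `(G, H)` with `G` of category `k` and `H` in its neighbourhood. -/
lemma sum_card_sNbhd_eq (n d k : ℕ) :
    ∑ G ∈ catSet n d k, (sNbhd G).card = ∑ H : SimpleBip n d, (sources k H).card := by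
  have h := Finset.sum_card_bipartiteAbove_eq_sum_card_bipartiteBelow (s := catSet n d k)
    (t := (Finset.univ : Finset (SimpleBip n d))) (fun G H => H ∈ sNbhd G)
  convert h using 2 with G _ H _
  · congr 1
    ext H
    simp [Finset.bipartiteAbove]
  · congr 1
    ext G
    simp [Finset.bipartiteBelow, sources, catSet]

/-- Large neighbourhoods and few sources per simple graph leave room for few multigraphs of category
`k`. Division by `2 ^ k` is the weight factor of that category. -/
lemma Large.card_catSet_le (L : Large n d) (hk : k ≤ parM n d) :
    ((catSet n d k).card : ℝ) / 2 ^ k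
      ≤ 2 * Fintype.card (SimpleBip n d) * (poisRate d ^ k / k.factorial) := by
  have hd := L.d_ge
  have hn := L.n_pos
  have h1 : ((catSet n d k).card : ℝ) * (((n : ℝ) * d) ^ k / 2)
      ≤ ∑ G ∈ catSet n d k, ((sNbhd G).card : ℝ) := by
    rw [← nsmul_eq_mul]
    exact Finset.card_nsmul_le_sum _ _ _ fun G hG =>
      L.half_pow_le_card_sNbhd (mem_catSet.1 hG) hk
  have h2 : ∑ G ∈ catSet n d k, ((sNbhd G).card : ℝ)
      = ∑ H : SimpleBip n d, ((sources k H).card : ℝ) := by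
    exact_mod_cast sum_card_sNbhd_eq n d k
  have h3 : ∑ H : SimpleBip n d, ((sources k H).card : ℝ)
      ≤ Fintype.card (SimpleBip n d) *
        (((n : ℝ) * d * ((d - 1 : ℕ) : ℝ) ^ 2) ^ k / k.factorial) := by
    rw [← nsmul_eq_mul, ← Finset.card_univ]
    refine Finset.sum_le_card_nsmul _ _ _ fun H _ => ?_
    rw [le_div_iff₀ (by positivity)]
    exact_mod_cast card_sources_mul_factorial_le k H
  have h4 := (h1.trans_eq h2).trans h3
  have hpos : (0 : ℝ) < ((n : ℝ) * d) ^ k := by positivity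
  have h5 : ((catSet n d k).card : ℝ) * ((n : ℝ) * d) ^ k ≤
      (2 * Fintype.card (SimpleBip n d) * ((((d - 1 : ℕ) : ℝ) ^ 2) ^ k / k.factorial))
        * ((n : ℝ) * d) ^ k := by
    rw [mul_pow _ (((d - 1 : ℕ) : ℝ) ^ 2)] at h4
    calc _ = 2 * (((catSet n d k).card : ℝ) * (((n : ℝ) * d) ^ k / 2)) := by ring
      _ ≤ 2 * _ := mul_le_mul_of_nonneg_left h4 (by norm_num)
      _ = _ := by ring
  have h6 := le_of_mul_le_mul_right h5 hpos
  calc ((catSet n d k).card : ℝ) / 2 ^ k ≤ (2 * Fintype.card (SimpleBip n d) *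
        ((((d - 1 : ℕ) : ℝ) ^ 2) ^ k / k.factorial)) / 2 ^ k := by gcongr
    _ = _ := by rw [poisRate, div_pow]; ring

/-- Categories up to `𝔪` carry half of the total mass, and `Large.card_catSet_le` compares each with
the simple graphs. The result bounds the probability of being simple from below by `1 / (4
poisSum)`. -/
lemma Large.quarter_le (L : Large n d) :
    1 / 4 ≤ simpleWeight n d * Fintype.card (SimpleBip n d) * poisSum n d := by
  have h := L.half_le_sum_catLe
  rw [sum_catLe_eq] at h
  have hw := simpleWeight_pos n d
  have h2 : ∑ k ∈ Finset.range (parM n d + 1),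
      ((catSet n d k).card : ℝ) * (simpleWeight n d / 2 ^ k)
      ≤ ∑ k ∈ Finset.range (parM n d + 1), simpleWeight n d *
        (2 * Fintype.card (SimpleBip n d) * (poisRate d ^ k / k.factorial)) := by
    refine Finset.sum_le_sum fun k hk => ?_
    have := L.card_catSet_le (k := k) (Nat.lt_succ_iff.1 (Finset.mem_range.1 hk))
    calc _ = simpleWeight n d * (((catSet n d k).card : ℝ) / 2 ^ k) := by ring
      _ ≤ _ := by gcongr
  have h3 : ∑ k ∈ Finset.range (parM n d + 1), simpleWeight n d *
        (2 * Fintype.card (SimpleBip n d) * (poisRate d ^ k / k.factorial))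
      = 2 * (simpleWeight n d * Fintype.card (SimpleBip n d) * poisSum n d) := by
    rw [poisSum, Finset.mul_sum, Finset.mul_sum]
    exact Finset.sum_congr rfl fun k _ => by ring
  linarith

lemma Large.card_simple_pos (L : Large n d) : 0 < Fintype.card (SimpleBip n d) := by
  by_contra h
  have h0 : Fintype.card (SimpleBip n d) = 0 := by omega
  have := L.quarter_le
  rw [h0] at this
  norm_num at this

/-- The set of multigraphs of categories `1, …, 𝔪`. -/
def catRange (n d : ℕ) : Finset (Multigraph n d) := Finset.univ.filter fun G => InCatRange G

lemma mem_catRange {G : Multigraph n d} : G ∈ catRange n d ↔ InCatRange G := by simp [catRange]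

/-- The law of a uniformly random element of the neighbourhood of a random multigraph of category
`1, …, 𝔪`. -/
def pushWeight {n d : ℕ} (H : SimpleBip n d) : ℝ :=
  ∑ G ∈ catRange n d, if H ∈ sNbhd G then piBC G / (sNbhd G).card else 0

/-- The sources of category `k` contribute at least half the simple weight times the `k`-th term of
`poisSum`. Summing over `k` and applying `Large.quarter_le` cancels `poisSum`. -/
lemma Large.le_pushWeight (L : Large n d) {H : SimpleBip n d} (hH : H ∈ goodSet n d) :
    1 / 16 / Fintype.card (SimpleBip n d) ≤ pushWeight H := by
  have hd := L.d_ge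
  have hn := L.n_pos
  have hw := simpleWeight_pos n d
  have hΩ : (0 : ℝ) < Fintype.card (SimpleBip n d) := by exact_mod_cast L.card_simple_pos
  have hset : (catRange n d).filter (fun G => H ∈ sNbhd G)
      = (Finset.Icc 1 (parM n d)).biUnion fun k => sources k H := by
    ext G
    simp only [Finset.mem_filter, mem_catRange, InCatRange, Finset.mem_biUnion, Finset.mem_Icc,
      sources, Finset.mem_univ, true_and]
    constructor
    · rintro ⟨⟨k, h1, h2, h3⟩, h4⟩
      exact ⟨k, ⟨h1, h2⟩, h3, h4⟩
    · rintro ⟨k, ⟨h1, h2⟩, h3, h4⟩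
      exact ⟨⟨k, h1, h2, h3⟩, h4⟩
  have hsum : pushWeight H = ∑ k ∈ Finset.Icc 1 (parM n d), ∑ G ∈ sources k H,
      piBC G / (sNbhd G).card := by
    rw [pushWeight, ← Finset.sum_filter, hset, Finset.sum_biUnion]
    intro k _ k' _ hkk
    rw [Function.onFun, Finset.disjoint_left]
    intro G hG hG'
    simp only [sources, Finset.mem_filter, Finset.mem_univ, true_and] at hG hG'
    exact hkk (hG.1.unique hG'.1)
  have hterm : ∀ k ∈ Finset.Icc 1 (parM n d), simpleWeight n d / 2 * (poisRate d ^ k / k.factorial)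
      ≤ ∑ G ∈ sources k H, piBC G / (sNbhd G).card := by
    intro k hk
    have h1 := L.half_pow_le_card_sources hH (Finset.mem_Icc.1 hk).2
    have h2 : ((sources k H).card : ℝ) * (simpleWeight n d / 2 ^ k / ((n : ℝ) * d) ^ k)
        ≤ ∑ G ∈ sources k H, piBC G / (sNbhd G).card := by
      rw [← nsmul_eq_mul]
      refine Finset.card_nsmul_le_sum _ _ _ fun G hG => ?_
      simp only [sources, Finset.mem_filter, Finset.mem_univ, true_and] at hG
      rw [piBC_of_isCat hG.1]
      have hpos : (0 : ℝ) < (sNbhd G).card := by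
        exact_mod_cast Finset.card_pos.2 ⟨H, hG.2⟩
      have : ((sNbhd G).card : ℝ) ≤ ((n : ℝ) * d) ^ k := by exact_mod_cast card_sNbhd_le hG.1
      gcongr
    refine le_trans ?_ h2
    have hf : (0 : ℝ) < k.factorial := by positivity
    rw [poisRate, div_pow]
    have h3 : ((n : ℝ) * d * ((d - 1 : ℕ) : ℝ) ^ 2) ^ k / 2 / k.factorial
        ≤ ((sources k H).card : ℝ) := by rwa [div_le_iff₀ hf]
    calc _ = (((n : ℝ) * d * ((d - 1 : ℕ) : ℝ) ^ 2) ^ k / 2 / k.factorial)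
          * (simpleWeight n d / 2 ^ k / ((n : ℝ) * d) ^ k) := by
          rw [mul_pow _ (((d - 1 : ℕ) : ℝ) ^ 2)]
          field_simp
      _ ≤ _ := by gcongr
  have hS : poisSum n d = 1 + ∑ k ∈ Finset.Icc 1 (parM n d), poisRate d ^ k / k.factorial := by
    rw [poisSum, Finset.sum_range_succ', add_comm]
    congr 1
    · simp
    · rw [← Finset.sum_image (s := Finset.range (parM n d)) (g := fun k => k + 1)
        (f := fun k => poisRate d ^ k / (k.factorial : ℝ)) (by simp)]
      congr 1
      ext k
      simp only [Finset.mem_image, Finset.mem_range, Finset.mem_Icc]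
      constructor
      · rintro ⟨a, h, rfl⟩; omega
      · rintro ⟨h1, h2⟩; exact ⟨k - 1, by omega, by omega⟩
  have hm1 : 1 ≤ parM n d := by
    have h1 := L.le_parM
    have h2 : (1 : ℝ) ≤ parM n d := by nlinarith
    exact_mod_cast h2
  -- Category `0` is excluded from the sum. Since `d ≥ 3`, the term `k = 1` is at least the missing
  -- term `1`, so at least half of `poisSum` remains.
  have hrate : (1 : ℝ) ≤ poisRate d := by
    have h1 : (2 : ℝ) ≤ ((d - 1 : ℕ) : ℝ) := by
      have : 2 ≤ d - 1 := by have := L.three_le; omega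
      exact_mod_cast this
    unfold poisRate
    nlinarith
  have hone : 1 ≤ ∑ k ∈ Finset.Icc 1 (parM n d), poisRate d ^ k / (k.factorial : ℝ) := by
    have := Finset.single_le_sum (s := Finset.Icc 1 (parM n d))
      (f := fun k => poisRate d ^ k / (k.factorial : ℝ)) (fun k _ => by positivity)
      (Finset.mem_Icc.2 ⟨le_refl 1, hm1⟩)
    simp only [pow_one, Nat.factorial_one, Nat.cast_one, div_one] at this
    linarith
  have hfin : simpleWeight n d / 2 * (poisSum n d / 2) ≤ pushWeight H := by
    rw [hsum]
    refine le_trans ?_ (Finset.sum_le_sum hterm)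
    rw [← Finset.mul_sum]
    have : poisSum n d / 2 ≤ ∑ k ∈ Finset.Icc 1 (parM n d), poisRate d ^ k / (k.factorial : ℝ) := by
      linarith
    gcongr
  refine le_trans ?_ hfin
  rw [div_le_iff₀ hΩ]
  have := L.quarter_le
  linarith

end Estimates

end SwitchChain

namespace SwitchChain

open scoped Classical

/-! ### Weighted sums of squared differences -/

section Weighted

variable {α : Type*}

/-- Pairs in relation `far` carry a positive fraction of the total weighted squared distance if
few points are not `far` from a given one. -/
lemma sum_le_sum_far (S : Finset α) (μ : α → ℝ) (hμ : ∀ a ∈ S, 0 ≤ μ a) (hμ1 : ∑ a ∈ S, μ a ≤ 1)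
    (D : α → α → ℝ) (hD : ∀ a ∈ S, ∀ b ∈ S, 0 ≤ D a b)
    (htri : ∀ a ∈ S, ∀ b ∈ S, ∀ c ∈ S, D a b ≤ 2 * D a c + 2 * D c b)
    (far : α → α → Prop) [DecidableRel far] (hsymm : ∀ a b, far a b → far b a) {δ : ℝ}
    (hδ : ∀ a ∈ S, ∑ c ∈ S, (if far a c then 0 else μ c) ≤ δ) :
    (∑ a ∈ S, μ a - 2 * δ) * ∑ a ∈ S, ∑ b ∈ S, μ a * μ b * D a b
      ≤ 4 * ∑ a ∈ S, ∑ b ∈ S, (if far a b then μ a * μ b * D a b else 0) := by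
  set θ := ∑ a ∈ S, μ a with hθ
  set F := ∑ a ∈ S, ∑ b ∈ S, (if far a b then μ a * μ b * D a b else 0) with hF
  have hF0 : 0 ≤ F := Finset.sum_nonneg fun a ha => Finset.sum_nonneg fun b hb => by
    split_ifs
    · exact mul_nonneg (mul_nonneg (hμ a ha) (hμ b hb)) (hD a ha b hb)
    · exact le_refl 0
  have hmain : ∀ a ∈ S, ∀ b ∈ S, (θ - 2 * δ) * D a b
      ≤ ∑ c ∈ S, (2 * (if far a c then μ c * D a c else 0)
        + 2 * (if far c b then μ c * D c b else 0)) := by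
    intro a ha b hb
    have h1 : θ - 2 * δ ≤ ∑ c ∈ S, (if far a c ∧ far c b then μ c else 0) := by
      have h2 := hδ a ha
      have h3 := hδ b hb
      have h4 : θ ≤ ∑ c ∈ S, ((if far a c ∧ far c b then μ c else 0)
          + (if far a c then 0 else μ c) + (if far b c then 0 else μ c)) := by
        refine Finset.sum_le_sum fun c hc => ?_
        have := hμ c hc
        by_cases h5 : far a c
        · by_cases h6 : far b c
          · simp [h5, h6, hsymm b c h6]
          · have : ¬ far c b := fun h => h6 (hsymm c b h)
            simp [h5, h6, this]
        · simp only [h5, false_and, if_false]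
          split_ifs <;> linarith
      rw [Finset.sum_add_distrib, Finset.sum_add_distrib] at h4
      linarith
    calc (θ - 2 * δ) * D a b ≤ (∑ c ∈ S, (if far a c ∧ far c b then μ c else 0)) * D a b :=
          mul_le_mul_of_nonneg_right h1 (hD a ha b hb)
      _ = ∑ c ∈ S, (if far a c ∧ far c b then μ c else 0) * D a b := Finset.sum_mul _ _ _
      _ ≤ _ := by
        refine Finset.sum_le_sum fun c hc => ?_
        have h2 := hμ c hc
        have h3 := hD a ha c hc
        have h4 := hD c hc b hb
        have h5 := htri a ha b hb c hc
        have h6 := mul_nonneg h2 h3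
        have h7 := mul_nonneg h2 h4
        by_cases h8 : far a c
        · by_cases h9 : far c b
          · simp only [h8, h9, and_self, if_true]
            nlinarith
          · simp only [h8, h9, and_false, if_false, if_true]
            linarith
        · simp only [h8, false_and, if_false]
          split_ifs <;> linarith
  calc (θ - 2 * δ) * ∑ a ∈ S, ∑ b ∈ S, μ a * μ b * D a b
      = ∑ a ∈ S, ∑ b ∈ S, μ a * μ b * ((θ - 2 * δ) * D a b) := by
        rw [Finset.mul_sum]
        refine Finset.sum_congr rfl fun a _ => ?_
        rw [Finset.mul_sum]
        exact Finset.sum_congr rfl fun b _ => by ring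
    _ ≤ ∑ a ∈ S, ∑ b ∈ S, μ a * μ b * (∑ c ∈ S, (2 * (if far a c then μ c * D a c else 0)
        + 2 * (if far c b then μ c * D c b else 0))) :=
        Finset.sum_le_sum fun a ha => Finset.sum_le_sum fun b hb =>
          mul_le_mul_of_nonneg_left (hmain a ha b hb) (mul_nonneg (hμ a ha) (hμ b hb))
    _ = ∑ a ∈ S, ∑ b ∈ S, (μ b * (2 * ∑ c ∈ S, (if far a c then μ a * μ c * D a c else 0))
        + μ a * (2 * ∑ c ∈ S, (if far c b then μ c * μ b * D c b else 0))) := by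
        refine Finset.sum_congr rfl fun a _ => Finset.sum_congr rfl fun b _ => ?_
        rw [Finset.mul_sum, Finset.mul_sum, Finset.mul_sum, Finset.mul_sum, Finset.mul_sum,
          ← Finset.sum_add_distrib]
        refine Finset.sum_congr rfl fun c _ => ?_
        split_ifs <;> ring
    _ = θ * (2 * F) + θ * (2 * F) := by
        simp only [Finset.sum_add_distrib]
        congr 1
        · rw [Finset.sum_comm, hθ, Finset.sum_mul]
          refine Finset.sum_congr rfl fun b _ => ?_
          rw [← Finset.mul_sum, ← Finset.mul_sum]
        · rw [hθ, Finset.sum_mul]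
          refine Finset.sum_congr rfl fun a _ => ?_
          rw [← Finset.mul_sum, ← Finset.mul_sum, Finset.sum_comm]
    _ ≤ 4 * F := by nlinarith

/-- Expansion around an arbitrary centre `c`. The weights need not be normalised, so it also applies
to subsets and to counting measure on neighbourhoods. -/
lemma sum_sum_sq_sub (s t : Finset α) (μ ν f : α → ℝ) (c : ℝ) :
    ∑ x ∈ s, ∑ y ∈ t, μ x * ν y * (f x - f y) ^ 2
      = (∑ y ∈ t, ν y) * ∑ x ∈ s, μ x * (f x - c) ^ 2
        + (∑ x ∈ s, μ x) * ∑ y ∈ t, ν y * (f y - c) ^ 2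
        - 2 * (∑ x ∈ s, μ x * (f x - c)) * ∑ y ∈ t, ν y * (f y - c) := by
  have h : ∀ x y, μ x * ν y * (f x - f y) ^ 2
      = ν y * (μ x * (f x - c) ^ 2) + μ x * (ν y * (f y - c) ^ 2)
        - 2 * (μ x * (f x - c)) * (ν y * (f y - c)) := fun x y => by ring
  simp only [h, Finset.sum_sub_distrib, Finset.sum_add_distrib, ← Finset.mul_sum, ← Finset.sum_mul]

lemma wVar_eq {S : Type*} [Fintype S] (μ f : S → ℝ) (hμ : ∑ x, μ x = 1) (c : ℝ) :
    wVar μ f = ∑ x, μ x * (f x - c) ^ 2 - (∑ x, μ x * (f x - c)) ^ 2 := by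
  rw [wVar, sum_sum_sq_sub _ _ _ _ _ c, hμ]
  ring

lemma wVar_eq_of_mean {S : Type*} [Fintype S] (μ f : S → ℝ) (hμ : ∑ x, μ x = 1) :
    wVar μ f = ∑ x, μ x * (f x - ∑ y, μ y * f y) ^ 2 := by
  rw [wVar_eq μ f hμ (∑ y, μ y * f y)]
  have : ∑ x, μ x * (f x - ∑ y, μ y * f y) = 0 := by
    simp only [mul_sub, Finset.sum_sub_distrib, ← Finset.sum_mul, hμ, one_mul, sub_self]
  rw [this]
  ring

end Weighted

section Variance

variable {n d k : ℕ}

/-! ### Neighbourhood averages -/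

lemma nbhdVar_nonneg (f : SimpleBip n d → ℝ) (G : Multigraph n d) : 0 ≤ nbhdVar f G := by
  unfold nbhdVar; positivity

/-- The mean squared difference of `f` over the product of two neighbourhoods. -/
def nbhdDist (f : SimpleBip n d → ℝ) (G₁ G₂ : Multigraph n d) : ℝ :=
  (nbhdMean f G₁ - nbhdMean f G₂) ^ 2 + nbhdVar f G₁ + nbhdVar f G₂

lemma nbhdDist_nonneg (f : SimpleBip n d → ℝ) (G₁ G₂ : Multigraph n d) :
    0 ≤ nbhdDist f G₁ G₂ := by
  have := nbhdVar_nonneg f G₁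
  have := nbhdVar_nonneg f G₂
  unfold nbhdDist; positivity

/-- The variances only help: `nbhdDist` does not vanish on the diagonal, yet the relaxed triangle
inequality of squared distances persists. -/
lemma nbhdDist_triangle (f : SimpleBip n d → ℝ) (G₁ G₂ G₃ : Multigraph n d) :
    nbhdDist f G₁ G₂ ≤ 2 * nbhdDist f G₁ G₃ + 2 * nbhdDist f G₃ G₂ := by
  have := nbhdVar_nonneg f G₁
  have := nbhdVar_nonneg f G₂
  have := nbhdVar_nonneg f G₃
  unfold nbhdDist
  nlinarith [sq_nonneg ((nbhdMean f G₁ - nbhdMean f G₃) - (nbhdMean f G₃ - nbhdMean f G₂))]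

/-- For independent uniform points of the two neighbourhoods, the mean squared difference is the
squared difference of the means plus both variances. -/
lemma pairWeight_eq (f : SimpleBip n d → ℝ) {G₁ G₂ : Multigraph n d} (h₁ : 0 < (sNbhd G₁).card)
    (h₂ : 0 < (sNbhd G₂).card) :
    pairWeight f (G₁, G₂) = piBC G₁ * piBC G₂ * nbhdDist f G₁ G₂ := by
  have h1 : (0 : ℝ) < (sNbhd G₁).card := by exact_mod_cast h₁
  have h2 : (0 : ℝ) < (sNbhd G₂).card := by exact_mod_cast h₂
  have hmean : ∀ G : Multigraph n d, (0 : ℝ) < (sNbhd G).card →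
      ∑ H ∈ sNbhd G, f H = (sNbhd G).card * nbhdMean f G := fun G hG => by
    unfold nbhdMean; field_simp
  have hvar : ∀ G : Multigraph n d, (0 : ℝ) < (sNbhd G).card →
      ∑ H ∈ sNbhd G, (f H - nbhdMean f G) ^ 2 = (sNbhd G).card * nbhdVar f G := fun G hG => by
    unfold nbhdVar; field_simp
  have h := sum_sum_sq_sub (sNbhd G₁) (sNbhd G₂) (fun _ => 1) (fun _ => 1) f (nbhdMean f G₁)
  have hz : ∑ H ∈ sNbhd G₁, (f H - nbhdMean f G₁) = 0 := by
    rw [Finset.sum_sub_distrib, hmean G₁ h1]; simp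
  have hv2 : ∑ H ∈ sNbhd G₂, (f H - nbhdMean f G₁) ^ 2
      = (sNbhd G₂).card * (nbhdVar f G₂ + (nbhdMean f G₁ - nbhdMean f G₂) ^ 2) := by
    have : ∀ H, (f H - nbhdMean f G₁) ^ 2 = (f H - nbhdMean f G₂) ^ 2
        + 2 * (nbhdMean f G₂ - nbhdMean f G₁) * (f H - nbhdMean f G₂)
        + (nbhdMean f G₁ - nbhdMean f G₂) ^ 2 := fun H => by ring
    simp only [this, Finset.sum_add_distrib, ← Finset.mul_sum, hvar G₂ h2, Finset.sum_sub_distrib,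
      hmean G₂ h2]
    simp
    ring
  simp only [one_mul, mul_one, Finset.sum_const, nsmul_eq_mul] at h
  rw [hz, hvar G₁ h1, hv2] at h
  unfold pairWeight nbhdDist
  simp only
  rw [h]
  field_simp
  ring

lemma Large.card_sNbhd_pos (L : Large n d) {G : Multigraph n d} (hG : InCatRange G) :
    0 < (sNbhd G).card := by
  obtain ⟨k, -, hk, hcat⟩ := hG
  have h := L.half_pow_le_card_sNbhd hcat hk
  have hn := L.n_pos
  have hd := L.d_ge
  have : (0 : ℝ) < ((n : ℝ) * d) ^ k / 2 := by positivity
  exact_mod_cast lt_of_lt_of_le this h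

lemma pairWeight_nonneg (f : SimpleBip n d → ℝ) (p : Multigraph n d × Multigraph n d) :
    0 ≤ pairWeight f p := by
  have := piBC_nonneg p.1
  have := piBC_nonneg p.2
  unfold pairWeight; positivity

/-- Both sides describe two independent draws of a multigraph followed by a point of its
neighbourhood, summed in different orders. -/
lemma sum_pairWeight_eq (f : SimpleBip n d → ℝ) :
    ∑ G₁ ∈ catRange n d, ∑ G₂ ∈ catRange n d, pairWeight f (G₁, G₂)
      = ∑ H₁, ∑ H₂, pushWeight H₁ * pushWeight H₂ * (f H₁ - f H₂) ^ 2 := by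
  have h1 : ∀ G₁ G₂ : Multigraph n d, pairWeight f (G₁, G₂)
      = ∑ H₁, ∑ H₂, (if H₁ ∈ sNbhd G₁ then piBC G₁ / (sNbhd G₁).card else 0)
        * (if H₂ ∈ sNbhd G₂ then piBC G₂ / (sNbhd G₂).card else 0) * (f H₁ - f H₂) ^ 2 := by
    intro G₁ G₂
    simp only [pairWeight, Finset.mul_sum]
    rw [← Finset.sum_filter_add_sum_filter_not Finset.univ (fun H₁ => H₁ ∈ sNbhd G₁)]
    rw [Finset.filter_mem_eq_inter, Finset.univ_inter]
    have hz : ∑ H₁ ∈ Finset.univ.filter (fun H₁ => H₁ ∉ sNbhd G₁), ∑ H₂,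
        (if H₁ ∈ sNbhd G₁ then piBC G₁ / ((sNbhd G₁).card : ℝ) else 0)
        * (if H₂ ∈ sNbhd G₂ then piBC G₂ / ((sNbhd G₂).card : ℝ) else 0) * (f H₁ - f H₂) ^ 2 = 0 := by
      refine Finset.sum_eq_zero fun H₁ hH₁ => Finset.sum_eq_zero fun H₂ _ => ?_
      simp [(Finset.mem_filter.1 hH₁).2]
    rw [hz, add_zero]
    refine Finset.sum_congr rfl fun H₁ hH₁ => ?_
    simp only [hH₁, if_true, mul_ite, mul_zero, ite_mul, zero_mul]
    rw [← Finset.sum_filter, Finset.filter_mem_eq_inter, Finset.univ_inter]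
    refine Finset.sum_congr rfl fun H₂ _ => ?_
    ring
  simp only [h1, pushWeight, Finset.sum_mul, Finset.mul_sum]
  calc _ = ∑ G₁ ∈ catRange n d, ∑ H₁, ∑ G₂ ∈ catRange n d, ∑ H₂, _ :=
        Finset.sum_congr rfl fun G₁ _ => Finset.sum_comm
    _ = ∑ H₁, ∑ G₁ ∈ catRange n d, ∑ G₂ ∈ catRange n d, ∑ H₂, _ := Finset.sum_comm
    _ = ∑ H₁, ∑ G₁ ∈ catRange n d, ∑ H₂, ∑ G₂ ∈ catRange n d, _ :=
        Finset.sum_congr rfl fun H₁ _ => Finset.sum_congr rfl fun G₁ _ => Finset.sum_comm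
    _ = ∑ H₁, ∑ H₂, ∑ G₁ ∈ catRange n d, ∑ G₂ ∈ catRange n d, _ :=
        Finset.sum_congr rfl fun H₁ _ => Finset.sum_comm
    _ = _ := Finset.sum_congr rfl fun H₁ _ => Finset.sum_congr rfl fun H₂ _ => Finset.sum_comm

lemma sum_pushWeight_le (n d : ℕ) :
    ∑ H : SimpleBip n d, pushWeight H ≤ ∑ G ∈ catRange n d, piBC G := by
  unfold pushWeight
  rw [Finset.sum_comm]
  refine Finset.sum_le_sum fun G _ => ?_
  rw [← Finset.sum_filter, Finset.filter_mem_eq_inter, Finset.univ_inter, Finset.sum_const,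
    nsmul_eq_mul]
  have := piBC_nonneg G
  rcases Nat.eq_zero_or_pos (sNbhd G).card with h | h
  · simpa [h] using this
  · have : (0 : ℝ) < (sNbhd G).card := by exact_mod_cast h
    rw [mul_div_cancel₀ _ this.ne']

lemma pushWeight_nonneg (H : SimpleBip n d) : 0 ≤ pushWeight H := by
  refine Finset.sum_nonneg fun G _ => ?_
  have := piBC_nonneg G
  split_ifs <;> positivity

lemma Large.card_not_good_le (L : Large n d) :
    ((Finset.univ.filter fun H : SimpleBip n d => H ∉ goodSet n d).card : ℝ)
      ≤ Fintype.card (SimpleBip n d) / 100 := by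
  have hd := L.d_ge
  have hn := L.n_pos
  have hlog := L.log_ge
  have h4 : 4 * d + 6 ≤ n := by
    have h1 := L.pow_le' (a := 1) (by norm_num)
    have : (4 * d + 6 : ℝ) ≤ n := by rw [pow_one] at h1; linarith
    exact_mod_cast this
  have h := card_not_good_mul_le L.d_pos h4
  have hz : 1600 * (d : ℝ) ^ 4 ≤ parZ n d + 1 := by
    refine le_trans ?_ (Nat.lt_floor_add_one ((n : ℝ) / ((d : ℝ) * Real.log n ^ 2))).le
    rw [le_div_iff₀ (by positivity)]
    have h1 := L.pow_mul_log_le (a := 5) (b := 2) (by norm_num) (by norm_num)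
    have : 0 ≤ (d : ℝ) ^ 5 * Real.log n ^ 2 := by positivity
    nlinarith
  set B := ((Finset.univ.filter fun H : SimpleBip n d => H ∉ goodSet n d).card : ℝ)
  have hB : 0 ≤ B := by positivity
  have h5 : B * (1600 * (d : ℝ) ^ 4) ≤ 16 * d ^ 4 * Fintype.card (SimpleBip n d) :=
    (mul_le_mul_of_nonneg_left hz hB).trans h
  have h6 : (0 : ℝ) < 16 * d ^ 4 := by positivity
  rw [le_div_iff₀ (by norm_num)]
  refine le_of_mul_le_mul_left ?_ h6
  linarith

/-- The total of `pushWeight` is at most this mass, and the good graphs alone contribute `99/100 ·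
1/16`. -/
lemma Large.le_sum_catRange (L : Large n d) : 1 / 32 ≤ ∑ G ∈ catRange n d, piBC G := by
  have hΩ : (0 : ℝ) < Fintype.card (SimpleBip n d) := by exact_mod_cast L.card_simple_pos
  refine le_trans ?_ (sum_pushWeight_le n d)
  have h1 : ((goodSet n d).card : ℝ) * (1 / 16 / Fintype.card (SimpleBip n d))
      ≤ ∑ H : SimpleBip n d, pushWeight H := by
    rw [← nsmul_eq_mul]
    refine (Finset.card_nsmul_le_sum _ _ _ fun H hH => L.le_pushWeight hH).trans ?_
    exact Finset.sum_le_sum_of_subset_of_nonneg (Finset.subset_univ _)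
      fun H _ _ => pushWeight_nonneg H
  refine le_trans ?_ h1
  have h2 := L.card_not_good_le
  have h3 : ((goodSet n d).card : ℝ)
      + ((Finset.univ.filter fun H : SimpleBip n d => H ∉ goodSet n d).card : ℝ)
      = Fintype.card (SimpleBip n d) := by
    have := Finset.card_filter_add_card_filter_not (s := (Finset.univ : Finset (SimpleBip n d)))
      (fun H => H ∈ goodSet n d)
    rw [Finset.filter_mem_eq_inter, Finset.univ_inter, Finset.card_univ] at this
    exact_mod_cast this
  rw [mul_div_assoc', le_div_iff₀ hΩ]
  linarith

/-- A multigraph within `𝔫` entries of `G` must place at least `n` of its `nd` edges on the support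
of `G`. The expected number there is at most `nd · d/n = d²`, so Markov's inequality gives `d²/n`.
-/
lemma Large.sum_close_le (L : Large n d) (G : Multigraph n d) :
    ∑ G' ∈ catRange n d, (if parN n d ≤ entryDist G G' then 0 else piBC G') ≤ 1 / 1000 := by
  have hd := L.d_ge
  have hn := L.n_pos
  have hN : 2 * (parN n d : ℝ) ≤ n := by
    have h1 : (parN n d : ℝ) < n / d + 1 := Nat.ceil_lt_add_one (by positivity)
    have h2 : (n : ℝ) / d ≤ n / 3 := by gcongr
    have h3 : (10 ^ 6 : ℝ) ≤ n := by exact_mod_cast L.n_ge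
    linarith
  have hover : ∀ G' ∈ catRange n d, ¬ parN n d ≤ entryDist G G' →
      (n : ℝ) ≤ ∑ x ∈ supp G, (G'.mult x.1 x.2 : ℝ) := by
    intro G' hG' hfar
    obtain ⟨k, -, -, hcat⟩ := mem_catRange.1 hG'
    -- Each entry of `G'` used outside the support of `G` is an entry where the matrices differ, and
    -- it holds at most two edges.
    have h1 : n * d ≤ ∑ x ∈ supp G, G'.mult x.1 x.2 + 2 * entryDist G G' := by
      rw [← sum_mult G', ← Finset.sum_filter_add_sum_filter_not Finset.univ (fun x => x ∈ supp G),
        Finset.filter_mem_eq_inter, Finset.univ_inter]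
      refine Nat.add_le_add_left ?_ _
      calc _ ≤ ∑ x ∈ Finset.univ.filter (fun x => x ∉ supp G),
            2 * (if G.mult x.1 x.2 ≠ G'.mult x.1 x.2 then 1 else 0) := by
            refine Finset.sum_le_sum fun x hx => ?_
            have h0 : G.mult x.1 x.2 = 0 := by
              simpa [mem_supp] using (Finset.mem_filter.1 hx).2
            have h2 := hcat.le_two x.1 x.2
            rw [h0]
            split_ifs <;> omega
        _ ≤ ∑ x : Fin n × Fin n, 2 * (if G.mult x.1 x.2 ≠ G'.mult x.1 x.2 then 1 else 0) :=
            Finset.sum_le_sum_of_subset (Finset.filter_subset _ _)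
        _ = 2 * entryDist G G' := by
            rw [← Finset.mul_sum, entryDist, Finset.card_filter]
    have h1' : (n : ℝ) * d ≤ ∑ x ∈ supp G, (G'.mult x.1 x.2 : ℝ) + 2 * entryDist G G' := by
      exact_mod_cast h1
    have h2 : (entryDist G G' : ℝ) ≤ parN n d := by exact_mod_cast (not_le.1 hfar).le
    nlinarith
  calc _ ≤ ∑ G' ∈ catRange n d, piBC G' * (∑ x ∈ supp G, (G'.mult x.1 x.2 : ℝ)) / n := by
        refine Finset.sum_le_sum fun G' hG' => ?_
        have h0 := piBC_nonneg G'
        split_ifs with h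
        · positivity
        · have := hover G' hG' h
          rw [le_div_iff₀ hn]
          gcongr
    _ ≤ ∑ G' : Multigraph n d, piBC G' * (∑ x ∈ supp G, (G'.mult x.1 x.2 : ℝ)) / n := by
        refine Finset.sum_le_sum_of_subset_of_nonneg (Finset.subset_univ _) fun G' _ _ => ?_
        have h0 := piBC_nonneg G'
        positivity
    _ = (∑ x ∈ supp G, ∑ G' : Multigraph n d, piBC G' * (G'.mult x.1 x.2 : ℝ)) / n := by
        rw [← Finset.sum_div, Finset.sum_comm]
        simp only [Finset.mul_sum]
    _ ≤ (∑ x ∈ supp G, (d / n : ℝ)) / n := by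
        gcongr with x hx
        exact sum_piBC_mult_le (by exact_mod_cast hn) L.d_pos x.1 x.2
    _ ≤ (n * d * (d / n : ℝ)) / n := by
        rw [Finset.sum_const, nsmul_eq_mul]
        have : ((supp G).card : ℝ) ≤ n * d := by exact_mod_cast card_supp_le G
        gcongr
    _ = d ^ 2 / n := by field_simp
    _ ≤ 1 / 1000 := by
        rw [div_le_iff₀ hn]
        have := L.pow_le' (a := 2) (by norm_num)
        nlinarith

lemma entryDist_comm (G H : Multigraph n d) : entryDist G H = entryDist H G := by
  unfold entryDist
  simp only [ne_comm]

lemma sum_farPairs_eq (F : Multigraph n d × Multigraph n d → ℝ) :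
    ∑ p ∈ farPairs n d, F p = ∑ G₁ ∈ catRange n d, ∑ G₂ ∈ catRange n d,
      (if parN n d ≤ entryDist G₁ G₂ then F (G₁, G₂) else 0) := by
  rw [← Finset.sum_product', ← Finset.sum_filter]
  refine Finset.sum_congr ?_ fun p _ => rfl
  ext p
  simp only [farPairs, Finset.mem_filter, Finset.mem_univ, true_and, Finset.mem_product,
    mem_catRange]
  tauto

/-- `sum_le_sum_far` with mass at least `1/32` and `δ = 1/1000`; the factor `4 / (1/32 - 2/1000)` is
below `256`. -/
lemma Large.sum_pairWeight_le (L : Large n d) (f : SimpleBip n d → ℝ) :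
    ∑ G₁ ∈ catRange n d, ∑ G₂ ∈ catRange n d, pairWeight f (G₁, G₂)
      ≤ 256 * ∑ p ∈ farPairs n d, pairWeight f p := by
  have hpw : ∀ G₁ ∈ catRange n d, ∀ G₂ ∈ catRange n d, pairWeight f (G₁, G₂)
      = piBC G₁ * piBC G₂ * nbhdDist f G₁ G₂ := fun G₁ h₁ G₂ h₂ =>
    pairWeight_eq f (L.card_sNbhd_pos (mem_catRange.1 h₁)) (L.card_sNbhd_pos (mem_catRange.1 h₂))
  have h := sum_le_sum_far (catRange n d) piBC (fun G _ => piBC_nonneg G)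
    ((Finset.sum_le_sum_of_subset_of_nonneg (Finset.subset_univ _) fun G _ _ =>
      piBC_nonneg G).trans (sum_piBC n d).le) (nbhdDist f)
    (fun _ _ _ _ => nbhdDist_nonneg f _ _) (fun _ _ _ _ _ _ => nbhdDist_triangle f _ _ _)
    (fun G₁ G₂ => parN n d ≤ entryDist G₁ G₂)
    (fun G₁ G₂ h => by rwa [entryDist_comm]) (fun G _ => L.sum_close_le G)
  have hθ := L.le_sum_catRange
  rw [sum_farPairs_eq]
  have e1 : ∑ G₁ ∈ catRange n d, ∑ G₂ ∈ catRange n d, pairWeight f (G₁, G₂)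
      = ∑ G₁ ∈ catRange n d, ∑ G₂ ∈ catRange n d, piBC G₁ * piBC G₂ * nbhdDist f G₁ G₂ :=
    Finset.sum_congr rfl fun G₁ h₁ => Finset.sum_congr rfl fun G₂ h₂ => hpw G₁ h₁ G₂ h₂
  have e2 : ∑ G₁ ∈ catRange n d, ∑ G₂ ∈ catRange n d,
      (if parN n d ≤ entryDist G₁ G₂ then pairWeight f (G₁, G₂) else 0)
      = ∑ G₁ ∈ catRange n d, ∑ G₂ ∈ catRange n d,
      (if parN n d ≤ entryDist G₁ G₂ then piBC G₁ * piBC G₂ * nbhdDist f G₁ G₂ else 0) :=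
    Finset.sum_congr rfl fun G₁ h₁ => Finset.sum_congr rfl fun G₂ h₂ => by rw [hpw G₁ h₁ G₂ h₂]
  rw [e2, e1]
  have hnn : 0 ≤ ∑ G₁ ∈ catRange n d, ∑ G₂ ∈ catRange n d,
      piBC G₁ * piBC G₂ * nbhdDist f G₁ G₂ :=
    Finset.sum_nonneg fun G₁ _ => Finset.sum_nonneg fun G₂ _ =>
      mul_nonneg (mul_nonneg (piBC_nonneg _) (piBC_nonneg _)) (nbhdDist_nonneg f _ _)
  nlinarith

/-! ### The case of substantial variation on the good set -/

/-- The constant is `2^7 · 2^8 · 2^8`: the definition of `GoodVariation`, the square of the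
comparison factor `16` between `piU` and `pushWeight`, and the passage to far pairs. -/
lemma Large.wVar_le_farPairs (L : Large n d) {f : SimpleBip n d → ℝ} (hf : GoodVariation f) :
    wVar piU f ≤ 2 ^ 23 * ∑ p ∈ farPairs n d, pairWeight f p := by
  have hΩ : (0 : ℝ) < Fintype.card (SimpleBip n d) := by exact_mod_cast L.card_simple_pos
  have h1 : ∑ G ∈ goodSet n d, ∑ H ∈ goodSet n d, piU G * piU H * (f G - f H) ^ 2
      ≤ 256 * ∑ H₁, ∑ H₂, pushWeight H₁ * pushWeight H₂ * (f H₁ - f H₂) ^ 2 := by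
    have hle : ∀ H ∈ goodSet n d, piU H ≤ 16 * pushWeight H := fun H hH => by
      have := L.le_pushWeight hH
      unfold piU
      have e : 1 / (Fintype.card (SimpleBip n d) : ℝ)
        = 16 * (1 / 16 / Fintype.card (SimpleBip n d)) := by ring
      linarith
    have hU : ∀ H : SimpleBip n d, 0 ≤ piU H := fun H => by unfold piU; positivity
    calc _ ≤ ∑ G ∈ goodSet n d, ∑ H ∈ goodSet n d,
          (16 * pushWeight G) * (16 * pushWeight H) * (f G - f H) ^ 2 :=
          Finset.sum_le_sum fun G hG => Finset.sum_le_sum fun H hH =>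
            mul_le_mul_of_nonneg_right (mul_le_mul (hle G hG) (hle H hH) (hU H)
              (by have := pushWeight_nonneg G; positivity)) (sq_nonneg _)
      _ ≤ ∑ G, ∑ H, (16 * pushWeight G) * (16 * pushWeight H) * (f G - f H) ^ 2 := by
          have hnn : ∀ G H : SimpleBip n d,
              0 ≤ (16 * pushWeight G) * (16 * pushWeight H) * (f G - f H) ^ 2 := fun G H => by
            have := pushWeight_nonneg G
            have := pushWeight_nonneg H
            positivity
          refine (Finset.sum_le_sum fun G _ => Finset.sum_le_sum_of_subset_of_nonneg
            (Finset.subset_univ _) fun H _ _ => hnn G H).trans ?_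
          exact Finset.sum_le_sum_of_subset_of_nonneg (Finset.subset_univ _) fun G _ _ =>
            Finset.sum_nonneg fun H _ => hnn G H
      _ = _ := by
          rw [Finset.mul_sum]
          refine Finset.sum_congr rfl fun G _ => ?_
          rw [Finset.mul_sum]
          exact Finset.sum_congr rfl fun H _ => by ring
  rw [← sum_pairWeight_eq] at h1
  have h2 := L.sum_pairWeight_le f
  unfold GoodVariation at hf
  norm_num at hf ⊢
  linarith

lemma InCatRange.not_isSimple {G : Multigraph n d} (hG : InCatRange G) : ¬ G.IsSimple := by
  obtain ⟨k, h1, -, h3⟩ := hG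
  intro hs
  have := (isCat_zero_iff.2 hs).unique h3
  omega

lemma extension_of_inCatRange (f : SimpleBip n d → ℝ) (x : Multigraph n d → ℝ) {G : Multigraph n d}
    (hG : InCatRange G) : extension f x G = nbhdMean f G + x G * Real.sqrt (nbhdVar f G) := by
  unfold extension
  rw [dif_neg hG.not_isSimple, if_pos hG]

lemma sq_add_le_of_signs {u a b w v : ℝ} (hua : 0 ≤ u * a) (hub : 0 ≤ u * b) (hab : 0 ≤ a * b)
    (hw : w ≤ a ^ 2) (hv : v ≤ b ^ 2) : u ^ 2 + w + v ≤ (u + a + b) ^ 2 := by nlinarith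

/-- On the event behind `signInd` all cross terms in the square of `(h₁ - h₂) + ξ₁√w₁ - ξ₂√w₂` are
nonnegative, and `|ξ| ≥ 1` keeps both variances in full. -/
lemma Large.signInd_mul_pairWeight_le (L : Large n d) (f : SimpleBip n d → ℝ)
    (x : Multigraph n d → ℝ) {G₁ G₂ : Multigraph n d} (h₁ : InCatRange G₁) (h₂ : InCatRange G₂) :
    signInd f x (G₁, G₂) * pairWeight f (G₁, G₂)
      ≤ piBC G₁ * piBC G₂ * (extension f x G₁ - extension f x G₂) ^ 2 := by
  have hπ := mul_nonneg (piBC_nonneg G₁) (piBC_nonneg G₂)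
  rw [pairWeight_eq f (L.card_sNbhd_pos h₁) (L.card_sNbhd_pos h₂), signInd]
  split_ifs with h
  · obtain ⟨c1, c2, c3, c4, c5⟩ := h
    simp only at c1 c2 c3 c4 c5
    rw [one_mul]
    refine mul_le_mul_of_nonneg_left ?_ hπ
    rw [extension_of_inCatRange f x h₁, extension_of_inCatRange f x h₂]
    set s := Real.sqrt (nbhdVar f G₁) with hs
    set t := Real.sqrt (nbhdVar f G₂) with ht
    have hs0 : 0 ≤ s := Real.sqrt_nonneg _
    have ht0 : 0 ≤ t := Real.sqrt_nonneg _
    have hs2 : s ^ 2 = nbhdVar f G₁ := Real.sq_sqrt (nbhdVar_nonneg f G₁)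
    have ht2 : t ^ 2 = nbhdVar f G₂ := Real.sq_sqrt (nbhdVar_nonneg f G₂)
    have k4 : 1 ≤ x G₁ ^ 2 := by rw [← sq_abs]; nlinarith
    have k5 : 1 ≤ x G₂ ^ 2 := by rw [← sq_abs]; nlinarith
    have key := sq_add_le_of_signs (u := nbhdMean f G₁ - nbhdMean f G₂) (a := x G₁ * s)
      (b := -x G₂ * t) (w := nbhdVar f G₁) (v := nbhdVar f G₂)
      (by nlinarith [mul_nonneg c1 hs0]) (by nlinarith [mul_nonneg c2 ht0])
      (by nlinarith [mul_nonneg c3.le (mul_nonneg hs0 ht0)])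
      (by rw [← hs2]; nlinarith [sq_nonneg s]) (by rw [← ht2]; nlinarith [sq_nonneg t])
    unfold nbhdDist
    calc _ ≤ _ := key
      _ = _ := by ring
  · rw [zero_mul]
    exact mul_nonneg hπ (sq_nonneg _)

/-- The exponent `24` combines `Large.wVar_le_farPairs` with the factor `1/2` in `wVar`. -/
lemma Large.wVar_extension_ge (L : Large n d) {f : SimpleBip n d → ℝ} (hf : GoodVariation f)
    {c₀ : ℝ} (hc₀ : 0 ≤ c₀) (x : Multigraph n d → ℝ)
    (hx : c₀ * ∑ p ∈ farPairs n d, pairWeight f p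
      ≤ ∑ p ∈ farPairs n d, signInd f x p * pairWeight f p) :
    c₀ / 2 ^ 24 * wVar piU f ≤ wVar piBC (extension f x) := by
  have h1 : ∑ p ∈ farPairs n d, signInd f x p * pairWeight f p
      ≤ ∑ p ∈ farPairs n d, piBC p.1 * piBC p.2 * (extension f x p.1 - extension f x p.2) ^ 2 := by
    refine Finset.sum_le_sum fun p hp => ?_
    simp only [farPairs, Finset.mem_filter, Finset.mem_univ, true_and] at hp
    exact L.signInd_mul_pairWeight_le f x hp.1 hp.2.1
  have h2 : ∑ p ∈ farPairs n d, piBC p.1 * piBC p.2 * (extension f x p.1 - extension f x p.2) ^ 2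
      ≤ 2 * wVar piBC (extension f x) := by
    rw [wVar, ← mul_assoc, mul_one_div_cancel two_ne_zero, one_mul, ← Fintype.sum_prod_type'
      (f := fun G H => piBC G * piBC H * (extension f x G - extension f x H) ^ 2)]
    exact Finset.sum_le_sum_of_subset_of_nonneg (Finset.subset_univ _) fun p _ _ =>
      mul_nonneg (mul_nonneg (piBC_nonneg _) (piBC_nonneg _)) (sq_nonneg _)
  have h3 := L.wVar_le_farPairs hf
  have h4 := mul_le_mul_of_nonneg_left h3 hc₀
  norm_num at h4 ⊢
  linarith

/-! ### The case of small variation on the good set -/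

lemma half_sq_sub_sq_le (g b : ℝ) : g ^ 2 / 2 - b ^ 2 ≤ (g - b) ^ 2 := by
  nlinarith [sq_nonneg (g - 2 * b)]

lemma sum_piU (h : 0 < Fintype.card (SimpleBip n d)) : ∑ H : SimpleBip n d, piU H = 1 := by
  have : (0 : ℝ) < Fintype.card (SimpleBip n d) := by exact_mod_cast h
  simp [piU]
  field_simp

/-- The terms of simple graphs alone suffice. With `A` and `B` the shares of the variance on the
good set and on its complement, and `b` the scaled shift of the mean of the extension, the good set
contributes at least `ρb²/2 - A` and its complement at least `B/2 - εb²`. Since `ρ ≥ 99/100` and `ε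
≤ 1/100`, the terms in `b` add up to something nonnegative, and `A` is small. -/
lemma Large.wVar_extension_ge_of_not (L : Large n d) {f : SimpleBip n d → ℝ}
    (hf : ¬ GoodVariation f) (x : Multigraph n d → ℝ) :
    1 / 4 * wVar piU f ≤ wVar piBC (extension f x) := by
  have hΩ : (0 : ℝ) < Fintype.card (SimpleBip n d) := by exact_mod_cast L.card_simple_pos
  have hU : ∀ H : SimpleBip n d, 0 ≤ piU H := fun H => by unfold piU; positivity
  have hU1 := sum_piU L.card_simple_pos
  set m := meanU f with hm
  set p := probSimple n d with hp
  have hpw : p = Fintype.card (SimpleBip n d) * simpleWeight n d := probSimple_eq n d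
  have hp0 : 0 < p := by rw [hpw]; exact mul_pos hΩ (simpleWeight_pos n d)
  have hp1 : p ≤ 1 := by
    rw [hp, probSimple, ← sum_piBC n d]
    rw [← Finset.sum_image (s := Finset.univ) (g := fun H : SimpleBip n d => H.1)
      (f := piBC) (fun _ _ _ _ h => Subtype.ext h)]
    exact Finset.sum_le_sum_of_subset_of_nonneg (Finset.subset_univ _) fun G _ _ => piBC_nonneg G
  set R := goodSet n d with hR
  set C := Finset.univ.filter fun H : SimpleBip n d => H ∉ goodSet n d with hC
  have hsplit : ∀ F : SimpleBip n d → ℝ, ∑ H, F H = ∑ H ∈ R, F H + ∑ H ∈ C, F H := by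
    intro F
    rw [← Finset.sum_filter_add_sum_filter_not Finset.univ (fun H => H ∈ goodSet n d),
      Finset.filter_mem_eq_inter, Finset.univ_inter]
  set ρ := ∑ H ∈ R, piU H with hρ
  set ε := ∑ H ∈ C, piU H with hε
  have hρε : ρ + ε = 1 := by rw [← hU1, hsplit]
  have hεle : ε ≤ 1 / 100 := by
    have h1 := L.card_not_good_le
    rw [hε]
    simp only [piU, Finset.sum_const, nsmul_eq_mul]
    rw [mul_one_div, div_le_iff₀ hΩ]
    linarith
  have hε0 : 0 ≤ ε := Finset.sum_nonneg fun H _ => hU H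
  set A := ∑ H ∈ R, piU H * (f H - m) ^ 2 with hA
  set B := ∑ H ∈ C, piU H * (f H - m) ^ 2 with hB
  have hA0 : 0 ≤ A := Finset.sum_nonneg fun H _ => mul_nonneg (hU H) (sq_nonneg _)
  have hB0 : 0 ≤ B := Finset.sum_nonneg fun H _ => mul_nonneg (hU H) (sq_nonneg _)
  have hV : wVar piU f = A + B := by
    rw [wVar_eq_of_mean _ _ hU1, hsplit]
    rfl
  have hmean : ∑ H ∈ R, piU H * (f H - m) + ∑ H ∈ C, piU H * (f H - m) = 0 := by
    rw [← hsplit]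
    simp only [mul_sub, Finset.sum_sub_distrib, ← Finset.sum_mul, hU1, one_mul]
    rw [hm, meanU, sub_self]
  have hcs : (∑ H ∈ C, piU H * (f H - m)) ^ 2 ≤ ε * B := by
    have := Finset.sum_mul_sq_le_sq_mul_sq C (fun H => Real.sqrt (piU H))
      (fun H => Real.sqrt (piU H) * (f H - m))
    simp only [← mul_assoc, Real.mul_self_sqrt (hU _), mul_pow, Real.sq_sqrt (hU _)] at this
    exact this
  -- The double sum over the good set is `2ρA` minus twice the square of the mean deviation there.
  -- The deviations on the two parts cancel, so by Cauchy–Schwarz that square is at most `εB`.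
  have hARle : A ≤ (A + B) / 40 := by
    have h1 := sum_sum_sq_sub R R piU piU f m
    unfold GoodVariation at hf
    rw [not_le, h1, hV] at hf
    have h2 : (∑ H ∈ R, piU H * (f H - m)) ^ 2 ≤ ε * B := by
      have : ∑ H ∈ R, piU H * (f H - m) = -∑ H ∈ C, piU H * (f H - m) := by linarith
      rw [this, neg_sq]
      exact hcs
    have h3 : ρ = 1 - ε := by linarith
    rw [← hρ, ← hA, h3] at hf
    have h4 : ε * A ≤ 1 / 100 * A := mul_le_mul_of_nonneg_right hεle hA0
    have h5 : ε * B ≤ 1 / 100 * B := mul_le_mul_of_nonneg_right hεle hB0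
    norm_num at hf
    linarith
  set E := ∑ G, piBC G * extension f x G with hE
  have hW : ∑ H : SimpleBip n d, piBC H.1 * (extension f x H.1 - E) ^ 2
      ≤ wVar piBC (extension f x) := by
    rw [wVar_eq_of_mean _ _ (sum_piBC n d),
      ← Finset.sum_image (s := Finset.univ) (g := fun H : SimpleBip n d => H.1)
      (f := fun G => piBC G * (extension f x G - E) ^ 2) (fun _ _ _ _ h => Subtype.ext h)]
    exact Finset.sum_le_sum_of_subset_of_nonneg (Finset.subset_univ _) fun G _ _ =>
      mul_nonneg (piBC_nonneg G) (sq_nonneg _)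
  have hπ : ∀ H : SimpleBip n d, piBC H.1 = p * piU H := fun H => by
    rw [piBC_of_isSimple H.2, hpw, piU]
    field_simp
  rw [hsplit] at hW
  set r := Real.sqrt p with hr
  have hr0 : 0 < r := Real.sqrt_pos.2 hp0
  have hr2 : r ^ 2 = p := Real.sq_sqrt hp0.le
  -- The factor `r = √p` turns the configuration weight `p * piU` into the uniform weight with
  -- rescaled increments.
  set b := r * (E - m) with hb
  have hX : ρ * b ^ 2 / 2 - A ≤ ∑ H ∈ R, piBC H.1 * (extension f x H.1 - E) ^ 2 := by
    have : ρ * b ^ 2 / 2 - A = ∑ H ∈ R, piU H * (b ^ 2 / 2 - (f H - m) ^ 2) := by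
      simp only [mul_sub, Finset.sum_sub_distrib, ← Finset.sum_mul]
      rw [← hρ, ← hA]
      ring
    rw [this]
    refine Finset.sum_le_sum fun H hH => ?_
    have hext : extension f x H.1 = f H := by
      unfold extension
      rw [dif_pos H.2, if_pos (Or.inr hH)]
    rw [hext, hπ H, mul_comm p, mul_assoc]
    refine mul_le_mul_of_nonneg_left ?_ (hU H)
    have e : p * (f H - E) ^ 2 = (b - r * (f H - m)) ^ 2 := by
      rw [← hr2, hb]; ring
    have e' : (r * (f H - m)) ^ 2 ≤ (f H - m) ^ 2 := by
      rw [mul_pow, hr2]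
      exact mul_le_of_le_one_left (sq_nonneg _) hp1
    rw [e]
    linarith [half_sq_sub_sq_le b (r * (f H - m))]
  have hY : B / 2 - ε * b ^ 2 ≤ ∑ H ∈ C, piBC H.1 * (extension f x H.1 - E) ^ 2 := by
    have : B / 2 - ε * b ^ 2 = ∑ H ∈ C, piU H * ((f H - m) ^ 2 / 2 - b ^ 2) := by
      simp only [mul_sub, Finset.sum_sub_distrib, ← Finset.sum_mul]
      rw [← hε, hB, Finset.sum_div]
      congr 1
      exact Finset.sum_congr rfl fun H _ => by ring
    rw [this]
    refine Finset.sum_le_sum fun H hH => ?_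
    have hext : extension f x H.1 = 1 / r * (f H - m) + m := by
      unfold extension
      rw [dif_pos H.2, if_neg]
      rintro (h | h)
      · exact hf h
      · exact (Finset.mem_filter.1 hH).2 h
    rw [hext, hπ H, mul_comm p, mul_assoc]
    refine mul_le_mul_of_nonneg_left ?_ (hU H)
    -- The rescaling in the definition of the extension cancels the factor `p` exactly.
    have e : p * (1 / r * (f H - m) + m - E) ^ 2 = (f H - m - b) ^ 2 := by
      rw [← hr2, ← mul_pow, hb]
      congr 1
      field_simp
      ring
    rw [e]
    exact half_sq_sub_sq_le _ _
  have hX0 : 0 ≤ ∑ H ∈ R, piBC H.1 * (extension f x H.1 - E) ^ 2 :=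
    Finset.sum_nonneg fun H _ => mul_nonneg (piBC_nonneg _) (sq_nonneg _)
  rw [hV]
  have hρ' : 99 / 100 ≤ ρ := by linarith
  have hb2 := sq_nonneg b
  have k1 : 99 / 100 * b ^ 2 ≤ ρ * b ^ 2 := by gcongr
  have k2 : ε * b ^ 2 ≤ 1 / 100 * b ^ 2 := by gcongr
  linarith

end Variance

end SwitchChain

namespace SwitchChain

open scoped Classical

/-! ### Linear combinations of independent standard Gaussian variables -/

section Gaussian

open MeasureTheory ProbabilityTheory

variable {ι : Type*} [Fintype ι]

/-- The law of a family of independent standard Gaussian variables. -/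
def gaussPi (ι : Type*) [Fintype ι] : Measure (ι → ℝ) := Measure.pi fun _ => gaussianReal 0 1

instance : IsProbabilityMeasure (gaussPi ι) := by
  unfold gaussPi
  infer_instance

/-- The linear combination with coefficients `a`. -/
def lin (a ω : ι → ℝ) : ℝ := ∑ s, a s * ω s

lemma measurable_lin (a : ι → ℝ) : Measurable (lin a) := by
  unfold lin
  fun_prop

lemma lin_add (a b ω : ι → ℝ) : lin (fun s => a s + b s) ω = lin a ω + lin b ω := by
  simp [lin, add_mul, Finset.sum_add_distrib]

lemma lin_neg (a ω : ι → ℝ) : lin (fun s => -a s) ω = -lin a ω := by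
  simp [lin]

lemma hasLaw_eval (s : ι) : (gaussPi ι).map (fun ω => ω s) = gaussianReal 0 1 :=
  (measurePreserving_eval (fun _ : ι => gaussianReal 0 1) s).map_eq

lemma hasGaussianLaw_eval (s : ι) : HasGaussianLaw (fun ω : ι → ℝ => ω s) (gaussPi ι) where
  isGaussian_map := by
    rw [hasLaw_eval]
    infer_instance

lemma iIndepFun_eval : iIndepFun (fun (s : ι) (ω : ι → ℝ) => ω s) (gaussPi ι) :=
  iIndepFun_pi (X := fun _ x => x) fun _ => aemeasurable_id

/-- Joint Gaussianity of a whole family is kept, so that vanishing covariances yield independence.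
-/
lemma hasGaussianLaw_lin {κ : Type*} [Fintype κ] (a : κ → ι → ℝ) :
    HasGaussianLaw (fun ω k => lin (a k) ω) (gaussPi ι) := by
  have h := iIndepFun.hasGaussianLaw (fun s => hasGaussianLaw_eval (ι := ι) s) iIndepFun_eval
  have h2 := h.map_fun (ContinuousLinearMap.pi fun k : κ =>
    ∑ s, a k s • (ContinuousLinearMap.proj s : (ι → ℝ) →L[ℝ] ℝ))
  refine h2.congr (Filter.Eventually.of_forall fun ω => ?_)
  funext k
  simp [lin]

lemma hasGaussianLaw_lin_single (a : ι → ℝ) : HasGaussianLaw (lin a) (gaussPi ι) :=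
  (hasGaussianLaw_lin (fun _ : Unit => a)).eval ()

lemma integral_eval (s : ι) : ∫ ω, ω s ∂(gaussPi ι) = 0 := by
  have := integral_map (μ := gaussPi ι) (φ := fun ω => ω s)
    (measurable_pi_apply s).aemeasurable
    (f := fun x : ℝ => x) (by fun_prop)
  rw [← this, hasLaw_eval, integral_id_gaussianReal]

lemma integral_lin (a : ι → ℝ) : ∫ ω, lin a ω ∂(gaussPi ι) = 0 := by
  unfold lin
  rw [integral_finsetSum _ fun s _ => (hasGaussianLaw_eval s).integrable.const_mul _]
  simp [integral_const_mul, integral_eval]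

lemma covariance_eval (s t : ι) :
    cov[fun ω : ι → ℝ => ω s, fun ω => ω t; gaussPi ι] = if s = t then 1 else 0 := by
  split_ifs with h
  · subst h
    rw [covariance_self (measurable_pi_apply s).aemeasurable]
    have := variance_map (μ := gaussPi ι) (Y := fun ω => ω s) (X := fun x : ℝ => x)
      (by fun_prop) (measurable_pi_apply s).aemeasurable
    rw [hasLaw_eval, variance_fun_id_gaussianReal] at this
    rw [← NNReal.coe_one, this]
    rfl
  · exact (iIndepFun_eval.indepFun h).covariance_eq_zero (hasGaussianLaw_eval s).memLp_two
      (hasGaussianLaw_eval t).memLp_two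

lemma covariance_lin (a b : ι → ℝ) : cov[lin a, lin b; gaussPi ι] = ∑ s, a s * b s := by
  unfold lin
  rw [covariance_fun_sum_fun_sum
    (fun s => (hasGaussianLaw_eval s).memLp_two.const_mul _)
    (fun s => (hasGaussianLaw_eval s).memLp_two.const_mul _)]
  simp only [covariance_const_mul_left, covariance_const_mul_right, covariance_eval]
  simp [mul_comm]

lemma variance_lin (a : ι → ℝ) : Var[lin a; gaussPi ι] = ∑ s, a s ^ 2 := by
  rw [← covariance_self (measurable_lin a).aemeasurable, covariance_lin]
  simp [pow_two]

/-- The probability that a standard Gaussian variable is at least `8`. -/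
def gaussTail : ℝ := (gaussianReal 0 1).real (Set.Ici 8)

lemma gaussTail_pos : 0 < gaussTail := by
  have h : (gaussianReal 0 1) (Set.Ici 8) ≠ 0 := fun h => by
    have := gaussianReal_absolutelyContinuous' 0 one_ne_zero h
    simp at this
  exact ENNReal.toReal_pos h (measure_ne_top _ _)

lemma gaussTail_le_one : gaussTail ≤ 1 := measureReal_le_one

/-- The standard deviation is at least `1/4`, so exceeding `8` standard deviations implies exceeding
`2`. -/
lemma gaussTail_le_lin (b : ι → ℝ) (hb : 1 / 16 ≤ ∑ s, b s ^ 2) :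
    gaussTail ≤ (gaussPi ι).real {ω | 2 ≤ lin b ω} := by
  set δ := ∑ s, b s ^ 2 with hδ
  have hδ0 : 0 < δ := by linarith
  have hs : 1 / 4 ≤ Real.sqrt δ := Real.le_sqrt_of_sq_le (by norm_num; linarith)
  have hmap : (gaussPi ι).map (lin fun s => (Real.sqrt δ)⁻¹ * b s) = gaussianReal 0 1 := by
    rw [(hasGaussianLaw_lin_single _).map_eq_gaussianReal, variance_lin, integral_lin]
    have : ∑ s, ((Real.sqrt δ)⁻¹ * b s) ^ 2 = 1 := by
      simp only [mul_pow, ← Finset.mul_sum, inv_pow, Real.sq_sqrt hδ0.le, ← hδ]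
      exact inv_mul_cancel₀ hδ0.ne'
    rw [this, Real.toNNReal_one]
  unfold gaussTail
  rw [← hmap, map_measureReal_apply (measurable_lin _) measurableSet_Ici]
  refine measureReal_mono fun ω hω => ?_
  have h1 : lin (fun s => (Real.sqrt δ)⁻¹ * b s) ω = (Real.sqrt δ)⁻¹ * lin b ω := by
    simp [lin, Finset.mul_sum, mul_assoc]
  have h2 : (8 : ℝ) ≤ (Real.sqrt δ)⁻¹ * lin b ω := by
    rw [← h1]
    exact hω
  have h3 : lin b ω = Real.sqrt δ * ((Real.sqrt δ)⁻¹ * lin b ω) := by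
    rw [mul_inv_cancel_left₀ (by linarith)]
  show 2 ≤ lin b ω
  rw [h3]
  nlinarith

/-- Chebyshev's inequality at level one. -/
lemma le_measureReal_abs_lin_lt_one (a : ι → ℝ) {δ : ℝ} (ha : ∑ s, a s ^ 2 ≤ 1 - δ) :
    δ ≤ (gaussPi ι).real {ω | |lin a ω| < 1} := by
  have h := meas_ge_le_variance_div_sq (μ := gaussPi ι) (X := lin a)
    (hasGaussianLaw_lin_single a).memLp_two one_pos
  rw [integral_lin, variance_lin] at h
  simp only [sub_zero, one_pow, div_one] at h
  have hm : MeasurableSet {ω : ι → ℝ | |lin a ω| < 1} :=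
    measurableSet_lt (measurable_lin a).abs measurable_const
  have h1 : (gaussPi ι).real {ω | 1 ≤ |lin a ω|} ≤ ∑ s, a s ^ 2 :=
    ENNReal.toReal_le_of_le_ofReal (Finset.sum_nonneg fun _ _ => sq_nonneg _) h
  have h2 : {ω : ι → ℝ | 1 ≤ |lin a ω|} = {ω | |lin a ω| < 1}ᶜ := by
    ext ω
    simp
  rw [h2, measureReal_compl hm, probReal_univ] at h1
  linarith

/-- Two linear combinations with a common part and otherwise disjoint supports are separated with
positive probability. -/
lemma le_measureReal_lin_separated (a b b' : ι → ℝ) (hab : ∀ s, a s * b s = 0)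
    (hab' : ∀ s, a s * b' s = 0) (hbb' : ∀ s, b s * b' s = 0)
    (ha : ∑ s, a s ^ 2 ≤ 1 - 1 / 16)
    (hb : 1 / 16 ≤ ∑ s, b s ^ 2) (hb' : 1 / 16 ≤ ∑ s, b' s ^ 2) :
    1 / 16 * gaussTail ^ 2
      ≤ (gaussPi ι).real {ω | 1 ≤ lin a ω + lin b ω ∧ lin a ω + lin b' ω ≤ -1} := by
  -- The sign of the third part is reversed so that both remainders are asked to be at least `2`.
  -- With a common part in `(-1, 1)` this separates the sums by `±1`.
  set v : Fin 3 → ι → ℝ := ![a, b, fun s => -b' s] with hv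
  have hind : iIndepFun (fun k => lin (v k)) (gaussPi ι) := by
    refine (hasGaussianLaw_lin v).iIndepFun_of_covariance_eq_zero fun i j hij => ?_
    rw [covariance_lin]
    refine Finset.sum_eq_zero fun s _ => ?_
    have h1 := hab s
    have h2 := hab' s
    have h3 := hbb' s
    fin_cases i <;> fin_cases j <;> simp_all [mul_comm]
  set E : Fin 3 → Set ℝ := ![{x | |x| < 1}, Set.Ici 2, Set.Ici 2] with hE
  have hmE : ∀ k, MeasurableSet (E k) := by
    intro k
    fin_cases k
    · exact measurableSet_lt measurable_id.abs measurable_const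
    · exact measurableSet_Ici
    · exact measurableSet_Ici
  have h := hind.measure_inter_preimage_eq_mul Finset.univ (sets := E) fun k _ => hmE k
  have h' := congrArg ENNReal.toReal h
  rw [ENNReal.toReal_prod] at h'
  simp only [Fin.prod_univ_three] at h'
  have e0 : 1 / 16 ≤ ((gaussPi ι) (lin (v 0) ⁻¹' E 0)).toReal :=
    le_measureReal_abs_lin_lt_one a ha
  have e1 : gaussTail ≤ ((gaussPi ι) (lin (v 1) ⁻¹' E 1)).toReal := gaussTail_le_lin b hb
  have e2 : gaussTail ≤ ((gaussPi ι) (lin (v 2) ⁻¹' E 2)).toReal :=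
    gaussTail_le_lin (fun s => -b' s) (by simpa using hb')
  have ht := gaussTail_pos
  calc 1 / 16 * gaussTail ^ 2 = 1 / 16 * gaussTail * gaussTail := by ring
    _ ≤ _ := mul_le_mul (mul_le_mul e0 e1 ht.le (by positivity)) e2 ht.le (by positivity)
    _ = _ := h'.symm
    _ ≤ _ := by
      refine measureReal_mono fun ω hω => ?_
      simp only [Set.mem_iInter, Finset.mem_univ, true_implies, Set.mem_preimage] at hω
      have w0 : |lin a ω| < 1 := hω 0
      have w1 : 2 ≤ lin b ω := hω 1
      have w2 : 2 ≤ lin (fun s => -b' s) ω := hω 2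
      rw [lin_neg] at w2
      rw [abs_lt] at w0
      constructor <;> linarith

end Gaussian

end SwitchChain

namespace SwitchChain

open scoped Classical

/-! ### The covariance structure of the field -/

section Field

open MeasureTheory ProbabilityTheory

variable {n d : ℕ} (𝒯 : FieldData n d)

/-- The number of edges of `G` in the `ℓ`-th block, as used by the field, lies in `W`. -/
def FieldData.Sel (ℓ : Fin (parN n d)) (G : Multigraph n d) : Prop :=
  ∑ e ∈ 𝒯.T ℓ, G.mult e.1 e.2 ∈ 𝒯.W

/-- The coefficients of the field at `G`. -/
def FieldData.coef (G : Multigraph n d) : Fin (parN n d) ⊕ Fin (parN n d) → ℝ :=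
  Sum.elim (fun ℓ => if 𝒯.Sel ℓ G then 1 / Real.sqrt (parN n d) else 0)
    (fun ℓ => if 𝒯.Sel ℓ G then 0 else 1 / Real.sqrt (parN n d))

/-- A block never contains more than `nd` edges. Hence exactly one of the two indicators in
`gaussField` is active, and each block uses exactly one of its two variables. -/
lemma gaussField_eq_lin (G : Multigraph n d) : gaussField 𝒯 G = lin (𝒯.coef G) := by
  funext ω
  unfold gaussField lin
  rw [Fintype.sum_sum_type, ← Finset.sum_add_distrib, Finset.mul_sum]
  refine Finset.sum_congr rfl fun ℓ _ => ?_
  have hle : ∑ e ∈ 𝒯.T ℓ, G.mult e.1 e.2 ∈ Finset.range (n * d + 1) := by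
    rw [Finset.mem_range, ← sum_mult G]
    exact Nat.lt_succ_of_le (Finset.sum_le_sum_of_subset (Finset.subset_univ _))
  by_cases h : ∑ e ∈ 𝒯.T ℓ, G.mult e.1 e.2 ∈ 𝒯.W
  · have h' : 𝒯.Sel ℓ G := h
    simp [FieldData.coef, h, h']
  · have h' : ¬ 𝒯.Sel ℓ G := h
    simp only [FieldData.coef, Finset.mem_sdiff, Sum.elim_inl, Sum.elim_inr, if_neg h',
      hle, h, not_false_eq_true, and_self, if_true, if_false]
    ring

/-- The blocks on which the fields at `G` and `H` use different variables. -/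
def FieldData.disagree (G H : Multigraph n d) : Finset (Fin (parN n d)) :=
  Finset.univ.filter fun ℓ => ¬ (𝒯.Sel ℓ G ↔ 𝒯.Sel ℓ H)

lemma FieldData.disagree_comm (G H : Multigraph n d) : 𝒯.disagree G H = 𝒯.disagree H G := by
  unfold FieldData.disagree
  simp only [iff_comm]

/-- An agreeing block contributes `1/𝔫`; on a disagreeing block the two fields use independent
variables. -/
lemma sum_coef_mul (hN : 0 < parN n d) (G H : Multigraph n d) :
    ∑ s, 𝒯.coef G s * 𝒯.coef H s = 1 - ((𝒯.disagree G H).card : ℝ) / parN n d := by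
  have hN' : (0 : ℝ) < parN n d := Nat.cast_pos.2 hN
  have hsq : 1 / Real.sqrt (parN n d) * (1 / Real.sqrt (parN n d)) = 1 / (parN n d : ℝ) := by
    rw [div_mul_div_comm, Real.mul_self_sqrt hN'.le, one_mul]
  rw [Fintype.sum_sum_type, ← Finset.sum_add_distrib]
  have h : ∀ ℓ : Fin (parN n d), 𝒯.coef G (Sum.inl ℓ) * 𝒯.coef H (Sum.inl ℓ)
      + 𝒯.coef G (Sum.inr ℓ) * 𝒯.coef H (Sum.inr ℓ)
      = 1 / (parN n d : ℝ) - (if ℓ ∈ 𝒯.disagree G H then 1 / (parN n d : ℝ) else 0) := by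
    intro ℓ
    rw [← hsq]
    by_cases h1 : 𝒯.Sel ℓ G <;> by_cases h2 : 𝒯.Sel ℓ H <;>
      simp [FieldData.coef, FieldData.disagree, h1, h2]
  rw [Finset.sum_congr rfl fun ℓ _ => h ℓ, Finset.sum_sub_distrib, Finset.sum_ite_mem,
    Finset.univ_inter]
  simp only [Finset.sum_const, Finset.card_univ, Fintype.card_fin, nsmul_eq_mul]
  field_simp

/-- Every disagreeing block contains an entry where the matrices differ, and disjoint blocks have
different such entries. -/
lemma card_disagree_le (G H : Multigraph n d) : (𝒯.disagree G H).card ≤ entryDist G H := by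
  have h : ∀ ℓ ∈ 𝒯.disagree G H, ∃ e ∈ 𝒯.T ℓ, G.mult e.1 e.2 ≠ H.mult e.1 e.2 := by
    intro ℓ hℓ
    by_contra! hc
    have : ∑ e ∈ 𝒯.T ℓ, G.mult e.1 e.2 = ∑ e ∈ 𝒯.T ℓ, H.mult e.1 e.2 :=
      Finset.sum_congr rfl hc
    exact (Finset.mem_filter.1 hℓ).2 (by rw [FieldData.Sel, FieldData.Sel, this])
  rcases (𝒯.disagree G H).eq_empty_or_nonempty with h0 | ⟨ℓ₀, hℓ₀⟩
  · simp [h0]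
  have : Nonempty (Fin n × Fin n) := ⟨(h ℓ₀ hℓ₀).choose⟩
  choose! e he using h
  refine Finset.card_le_card_of_injOn e (fun ℓ hℓ => ?_) fun ℓ hℓ ℓ' hℓ' heq => ?_
  · simpa using (he ℓ hℓ).2
  · by_contra hne
    exact Finset.disjoint_left.1 (𝒯.disjoint ℓ ℓ' hne) (he ℓ hℓ).1 (heq ▸ (he ℓ' hℓ').1)

lemma Adjacent.entryDist_le {G H : Multigraph n d} (h : Adjacent G H) : entryDist G H ≤ 4 := by
  obtain ⟨i₁, i₂, j₁, j₂, h⟩ := h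
  have hsub : (Finset.univ.filter fun e : Fin n × Fin n => G.mult e.1 e.2 ≠ H.mult e.1 e.2)
      ⊆ ({i₁, i₂} : Finset (Fin n)) ×ˢ ({j₁, j₂} : Finset (Fin n)) := by
    intro e he
    by_contra hc
    have := h.other e.1 e.2 (by simpa using hc)
    simp [this] at he
  refine (Finset.card_le_card hsub).trans ?_
  rw [Finset.card_product]
  exact Nat.mul_le_mul Finset.card_le_two Finset.card_le_two

lemma isGaussianProcess_gaussField : IsGaussianProcess (gaussField 𝒯) (stdGauss (parN n d)) where
  hasGaussianLaw I := by
    have h := hasGaussianLaw_lin (fun G : I => 𝒯.coef G)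
    refine h.congr (Filter.Eventually.of_forall fun ω => ?_)
    funext G
    simp [gaussField_eq_lin]

lemma integral_gaussField (G : Multigraph n d) :
    ∫ ω, gaussField 𝒯 G ω ∂(stdGauss (parN n d)) = 0 := by
  rw [gaussField_eq_lin]
  exact integral_lin _

lemma covariance_gaussField (hN : 0 < parN n d) (G H : Multigraph n d) :
    cov[gaussField 𝒯 G, gaussField 𝒯 H; stdGauss (parN n d)]
      = 1 - ((𝒯.disagree G H).card : ℝ) / parN n d := by
  rw [gaussField_eq_lin, gaussField_eq_lin, ← sum_coef_mul 𝒯 hN]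
  exact covariance_lin _ _

lemma variance_gaussField (hN : 0 < parN n d) (G : Multigraph n d) :
    Var[gaussField 𝒯 G; stdGauss (parN n d)] = 1 := by
  have hm : Measurable (gaussField 𝒯 G) := by
    rw [gaussField_eq_lin]
    exact measurable_lin _
  rw [← covariance_self hm.aemeasurable, covariance_gaussField 𝒯 hN]
  simp [FieldData.disagree]

lemma le_covariance_gaussField (hN : 0 < parN n d) {G H : Multigraph n d} (h : Adjacent G H) :
    1 - 4 / (parN n d : ℝ) ≤ cov[gaussField 𝒯 G, gaussField 𝒯 H; stdGauss (parN n d)] := by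
  rw [covariance_gaussField 𝒯 hN]
  have h1 : ((𝒯.disagree G H).card : ℝ) ≤ 4 := by
    exact_mod_cast (card_disagree_le 𝒯 G H).trans h.entryDist_le
  gcongr

/-- If the fields at `G` and `H` use different variables on many blocks, they are separated with
positive probability. -/
lemma le_measureReal_separated (hN : 0 < parN n d) (G H : Multigraph n d)
    (h : parN n d ≤ 16 * (𝒯.disagree G H).card) :
    1 / 16 * gaussTail ^ 2 ≤ (stdGauss (parN n d)).real
      {ω | 1 ≤ gaussField 𝒯 G ω ∧ gaussField 𝒯 H ω ≤ -1} := by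
  have hN' : (0 : ℝ) < parN n d := Nat.cast_pos.2 hN
  have h' : 1 / 16 ≤ ((𝒯.disagree G H).card : ℝ) / parN n d := by
    rw [le_div_iff₀ hN']
    have : (parN n d : ℝ) ≤ 16 * (𝒯.disagree G H).card := by exact_mod_cast h
    linarith
  set R : Fin (parN n d) ⊕ Fin (parN n d) → Prop :=
    fun s => s.elim id id ∈ 𝒯.disagree G H with hR
  set a := fun s => if R s then 0 else 𝒯.coef G s with ha
  set b := fun s => if R s then 𝒯.coef G s else 0 with hb
  set b' := fun s => if R s then 𝒯.coef H s else 0 with hb'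
  have hab : ∀ s, 𝒯.coef G s = a s + b s := fun s => by
    by_cases hs : R s <;> simp [ha, hb, hs]
  have hRc : ∀ s, R s → 𝒯.coef G s * 𝒯.coef H s = 0 := by
    rintro (ℓ | ℓ) hs <;>
    · simp only [hR, Sum.elim_inl, Sum.elim_inr, id, FieldData.disagree, Finset.mem_filter,
        Finset.mem_univ, true_and] at hs
      by_cases h1 : 𝒯.Sel ℓ G <;> by_cases h2 : 𝒯.Sel ℓ H <;>
        first
          | exact (hs (iff_of_true h1 h2)).elim
          | exact (hs (iff_of_false h1 h2)).elim
          | simp [FieldData.coef, h1, h2]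
  have hRe : ∀ s, ¬ R s → 𝒯.coef G s = 𝒯.coef H s := by
    rintro (ℓ | ℓ) hs <;>
    · simp only [hR, Sum.elim_inl, Sum.elim_inr, id, FieldData.disagree, Finset.mem_filter,
        Finset.mem_univ, true_and, not_not] at hs
      simp [FieldData.coef, hs]
  have hab' : ∀ s, 𝒯.coef H s = a s + b' s := fun s => by
    by_cases hs : R s
    · simp [ha, hb', hs]
    · simp [ha, hb', hs, hRe s hs]
  have hGG := sum_coef_mul 𝒯 hN G G
  have hHH := sum_coef_mul 𝒯 hN H H
  have hGH := sum_coef_mul 𝒯 hN G H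
  simp only [FieldData.disagree, not_true_eq_false, Finset.filter_false, Finset.card_empty,
    Nat.cast_zero, zero_div, sub_zero] at hGG hHH
  -- The variance of the common part equals the covariance of the two fields, which the assumed
  -- disagreement makes at most `15/16`; the remainders then have variance at least `1/16`.
  have hasq : ∑ s, a s ^ 2 = ∑ s, 𝒯.coef G s * 𝒯.coef H s := Finset.sum_congr rfl fun s _ => by
    by_cases hs : R s
    · simp [ha, hs, hRc s hs]
    · simp [ha, hs, pow_two, ← hRe s hs]
  have hbsq : ∑ s, a s ^ 2 + ∑ s, b s ^ 2 = ∑ s, 𝒯.coef G s * 𝒯.coef G s := by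
    rw [← Finset.sum_add_distrib]
    refine Finset.sum_congr rfl fun s _ => ?_
    by_cases hs : R s <;> simp [ha, hb, hs, pow_two]
  have hbsq' : ∑ s, a s ^ 2 + ∑ s, b' s ^ 2 = ∑ s, 𝒯.coef H s * 𝒯.coef H s := by
    rw [← Finset.sum_add_distrib]
    refine Finset.sum_congr rfl fun s _ => ?_
    by_cases hs : R s
    · simp [ha, hb', hs, pow_two]
    · simp [ha, hb', hs, pow_two, hRe s hs]
  have key := le_measureReal_lin_separated a b b'
    (fun s => by by_cases hs : R s <;> simp [ha, hb, hs])
    (fun s => by by_cases hs : R s <;> simp [ha, hb', hs])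
    (fun s => by
      by_cases hs : R s
      · simpa [hb, hb', hs] using hRc s hs
      · simp [hb, hs])
    (by linarith) (by linarith) (by linarith)
  have e1 : ∀ ω, gaussField 𝒯 G ω = lin a ω + lin b ω := fun ω => by
    rw [gaussField_eq_lin, ← lin_add, ← funext hab]
  have e2 : ∀ ω, gaussField 𝒯 H ω = lin a ω + lin b' ω := fun ω => by
    rw [gaussField_eq_lin, ← lin_add, ← funext hab']
  simp only [e1, e2]
  exact key

lemma measurable_signInd (f : SimpleBip n d → ℝ) (p : Multigraph n d × Multigraph n d) :
    Measurable fun ω => signInd f (fun G => gaussField 𝒯 G ω) p := by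
  have hm : ∀ G, Measurable (gaussField 𝒯 G) := fun G => by
    rw [gaussField_eq_lin]
    exact measurable_lin _
  have h1 := hm p.1
  have h2 := hm p.2
  unfold signInd
  refine Measurable.ite ?_ measurable_const measurable_const
  refine MeasurableSet.inter (measurableSet_le measurable_const (h1.mul_const _)) ?_
  refine MeasurableSet.inter (measurableSet_le measurable_const (h2.neg.mul_const _)) ?_
  refine MeasurableSet.inter (measurableSet_lt measurable_const (h1.mul h2.neg)) ?_
  exact MeasurableSet.inter (measurableSet_le measurable_const h1.abs)
    (measurableSet_le measurable_const h2.abs)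

lemma signInd_nonneg (f : SimpleBip n d → ℝ) (x : Multigraph n d → ℝ)
    (p : Multigraph n d × Multigraph n d) : 0 ≤ signInd f x p := by
  unfold signInd
  split_ifs <;> norm_num

lemma signInd_le_one (f : SimpleBip n d → ℝ) (x : Multigraph n d → ℝ)
    (p : Multigraph n d × Multigraph n d) : signInd f x p ≤ 1 := by
  unfold signInd
  split_ifs <;> norm_num

instance (m : ℕ) : IsProbabilityMeasure (stdGauss m) := by
  unfold stdGauss
  infer_instance

lemma integrable_signInd (f : SimpleBip n d → ℝ) (p : Multigraph n d × Multigraph n d) :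
    Integrable (fun ω => signInd f (fun G => gaussField 𝒯 G ω) p) (stdGauss (parN n d)) :=
  Integrable.of_bound (measurable_signInd 𝒯 f p).aestronglyMeasurable 1
    (Filter.Eventually.of_forall fun ω => by
      rw [Real.norm_of_nonneg (signInd_nonneg _ _ _)]
      exact signInd_le_one _ _ _)

/-- The field is required to be at least `1` at the multigraph with the larger neighbourhood mean
and at most `-1` at the other; this forces all conditions in `signInd`. -/
lemma le_integral_signInd (hN : 0 < parN n d) (f : SimpleBip n d → ℝ)
    (p : Multigraph n d × Multigraph n d) (h : parN n d ≤ 16 * (𝒯.disagree p.1 p.2).card) :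
    1 / 16 * gaussTail ^ 2
      ≤ ∫ ω, signInd f (fun G => gaussField 𝒯 G ω) p ∂(stdGauss (parN n d)) := by
  have hm : ∀ G, Measurable (gaussField 𝒯 G) := fun G => by
    rw [gaussField_eq_lin]
    exact measurable_lin _
  have hset : ∀ A : Set (Fin (parN n d) ⊕ Fin (parN n d) → ℝ), MeasurableSet A →
      (∀ ω ∈ A, signInd f (fun G => gaussField 𝒯 G ω) p = 1) →
      (stdGauss (parN n d)).real A
        ≤ ∫ ω, signInd f (fun G => gaussField 𝒯 G ω) p ∂(stdGauss (parN n d)) := by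
    intro A hA h1
    rw [← integral_indicator_one hA]
    refine integral_mono ((integrable_const (1 : ℝ)).indicator hA) (integrable_signInd 𝒯 f p)
      fun ω => ?_
    by_cases hω : ω ∈ A
    · simp [hω, h1 ω hω]
    · simp [hω, signInd_nonneg]
  rcases le_total (nbhdMean f p.2) (nbhdMean f p.1) with hle | hle
  · refine (le_measureReal_separated 𝒯 hN p.1 p.2 h).trans (hset _
      ((measurableSet_le measurable_const (hm _)).inter
        (measurableSet_le (hm _) measurable_const)) ?_)
    rintro ω ⟨h1, h2⟩
    unfold signInd
    rw [if_pos]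
    have h3 : 0 ≤ nbhdMean f p.1 - nbhdMean f p.2 := by linarith
    refine ⟨mul_nonneg (by linarith) h3, mul_nonneg (by linarith) h3,
      mul_pos (by linarith) (by linarith), le_abs.2 (Or.inl h1), le_abs.2 (Or.inr (by linarith))⟩
  · rw [FieldData.disagree_comm] at h
    refine (le_measureReal_separated 𝒯 hN p.2 p.1 h).trans (hset _
      ((measurableSet_le measurable_const (hm _)).inter
        (measurableSet_le (hm _) measurable_const)) ?_)
    rintro ω ⟨h1, h2⟩
    unfold signInd
    rw [if_pos]
    have h3 : nbhdMean f p.1 - nbhdMean f p.2 ≤ 0 := by linarith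
    refine ⟨mul_nonneg_of_nonpos_of_nonpos (by linarith) h3,
      mul_nonneg_of_nonpos_of_nonpos (by linarith) h3,
      mul_pos_of_neg_of_neg (by linarith) (by linarith), le_abs.2 (Or.inr (by linarith)),
      le_abs.2 (Or.inl h1)⟩

end Field

end SwitchChain

namespace SwitchChain

open scoped Classical

/-! ### Random blocks separate distinct multigraphs -/

section RandomBlocks

/-- `(1 - 1/N)^N ≥ 1/4`: Bernoulli's inequality with the real exponent `N/2 ≥ 1` gives `1/2`, which
is then squared. -/
lemma four_mul_pow_ge {N : ℕ} (hN : 2 ≤ N) : N ^ N ≤ 4 * (N - 1) ^ N := by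
  have hN0 : (0 : ℝ) < N := by
    have : 0 < N := by omega
    exact_mod_cast this
  have hN2 : (2 : ℝ) ≤ N := by exact_mod_cast hN
  have h0 : 0 ≤ 1 + -(1 / (N : ℝ)) := by
    have : 1 / (N : ℝ) ≤ 1 := by
      rw [div_le_one hN0]
      linarith
    linarith
  have h1 := one_add_mul_self_le_rpow_one_add (s := -(1 / (N : ℝ))) (by linarith)
    (p := (N : ℝ) / 2) (by linarith)
  have h2 : 1 + (N : ℝ) / 2 * -(1 / (N : ℝ)) = 1 / 2 := by
    field_simp
    norm_num
  rw [h2] at h1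
  have h3 : (1 / 4 : ℝ) ≤ (1 + -(1 / (N : ℝ))) ^ N := by
    have h4 : (1 + -(1 / (N : ℝ))) ^ N = ((1 + -(1 / (N : ℝ))) ^ ((N : ℝ) / 2)) ^ 2 := by
      rw [← Real.rpow_natCast _ 2, ← Real.rpow_mul h0, ← Real.rpow_natCast]
      congr 1
      push_cast
      ring
    rw [h4]
    nlinarith
  have h5 : ((N : ℝ)) ^ N ≤ 4 * ((N : ℝ) - 1) ^ N := by
    have h6 : (N : ℝ) - 1 = N * (1 + -(1 / (N : ℝ))) := by
      field_simp
      ring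
    rw [h6, mul_pow]
    have : 0 < (N : ℝ) ^ N := by positivity
    nlinarith
  have h7 : ((N - 1 : ℕ) : ℝ) = (N : ℝ) - 1 := by
    rw [Nat.cast_sub (by omega)]
    simp
  rw [← h7] at h5
  exact_mod_cast h5

/-- If `N` nonzero integers are each selected with probability `1 / N`, then the sum of the selected
ones avoids any given value with probability at least `1 / 4`. -/
lemma card_fun_le_four_mul {D : Type*} [Fintype D] {N : ℕ} (hN : 2 ≤ N) (hD : Fintype.card D = N)
    (x : D → ℤ) (hx : ∀ e, x e ≠ 0) (s : ℤ) (ℓ : Fin N) :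
    N ^ N ≤ 4 * (Finset.univ.filter fun g : D → Fin N =>
      s + ∑ e, (if g e = ℓ then x e else 0) ≠ 0).card := by
  refine (four_mul_pow_ge hN).trans (Nat.mul_le_mul_left 4 ?_)
  have hcard : (Finset.univ.erase ℓ).card = N - 1 := by simp
  -- If `s = 0`, the sum is nonzero whenever exactly one entry is selected, which happens for `N
  -- (N-1)^(N-1)` functions. If `s ≠ 0`, selecting none suffices, which happens for `(N-1)^N`.
  by_cases hs : s = 0
  · have hP : ∀ e₀ : D, (Fintype.piFinset fun e : D =>
        if e = e₀ then {ℓ} else Finset.univ.erase ℓ).card = (N - 1) ^ (N - 1) := by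
      intro e₀
      rw [Fintype.card_piFinset, ← Finset.mul_prod_erase Finset.univ _ (Finset.mem_univ e₀)]
      rw [if_pos rfl, Finset.card_singleton, one_mul,
        Finset.prod_congr rfl (fun e he => by rw [if_neg (Finset.ne_of_mem_erase he), hcard]),
        Finset.prod_const, Finset.card_erase_of_mem (Finset.mem_univ _), Finset.card_univ, hD]
    have hdisj : ∀ e₁ ∈ (Finset.univ : Finset D), ∀ e₂ ∈ (Finset.univ : Finset D), e₁ ≠ e₂ →
        Disjoint (Fintype.piFinset fun e : D => if e = e₁ then {ℓ} else Finset.univ.erase ℓ)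
          (Fintype.piFinset fun e : D => if e = e₂ then {ℓ} else Finset.univ.erase ℓ) := by
      intro e₁ _ e₂ _ hne
      rw [Finset.disjoint_left]
      intro g h1 h2
      have h3 := Fintype.mem_piFinset.1 h1 e₁
      have h4 := Fintype.mem_piFinset.1 h2 e₁
      rw [if_pos rfl, Finset.mem_singleton] at h3
      rw [if_neg hne] at h4
      exact Finset.ne_of_mem_erase h4 h3
    have hU := Finset.card_biUnion hdisj
    rw [Finset.sum_congr rfl fun e _ => hP e, Finset.sum_const, Finset.card_univ, hD,
      smul_eq_mul] at hU
    calc (N - 1) ^ N = (N - 1) * (N - 1) ^ (N - 1) := by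
          rw [← pow_succ', Nat.sub_add_cancel (by omega)]
      _ ≤ N * (N - 1) ^ (N - 1) := Nat.mul_le_mul_right _ (Nat.sub_le _ _)
      _ = _ := hU.symm
      _ ≤ _ := by
        refine Finset.card_le_card fun g hg => ?_
        obtain ⟨e₀, -, hg⟩ := Finset.mem_biUnion.1 hg
        rw [Fintype.mem_piFinset] at hg
        rw [Finset.mem_filter, hs, zero_add]
        refine ⟨Finset.mem_univ _, ?_⟩
        rw [Finset.sum_eq_single e₀]
        · have := hg e₀
          rw [if_pos rfl, Finset.mem_singleton] at this
          rw [if_pos this]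
          exact hx e₀
        · intro e _ he
          have := hg e
          rw [if_neg he] at this
          rw [if_neg (Finset.ne_of_mem_erase this)]
        · simp
  · calc (N - 1) ^ N = (Fintype.piFinset fun _ : D => Finset.univ.erase ℓ).card := by
          rw [Fintype.card_piFinset, Finset.prod_const, hcard, Finset.card_univ, hD]
      _ ≤ _ := by
        refine Finset.card_le_card fun g hg => ?_
        rw [Fintype.mem_piFinset] at hg
        rw [Finset.mem_filter, Finset.sum_eq_zero, add_zero]
        · exact ⟨Finset.mem_univ _, hs⟩
        · intro e _
          rw [if_neg (Finset.ne_of_mem_erase (hg e))]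

/-- Fix exactly `N` of the nonzero entries and condition on the colours of all others: these only
produce the constant `s` in `card_fun_le_four_mul`. -/
lemma card_coloring_le_four_mul {α : Type*} [Fintype α] [DecidableEq α] {N : ℕ} (hN : 2 ≤ N) (x : α → ℤ)
    (hx : N ≤ (Finset.univ.filter fun e => x e ≠ 0).card) (ℓ : Fin N) :
    Fintype.card (α → Fin N) ≤ 4 * (Finset.univ.filter fun τ : α → Fin N =>
      ∑ e, (if τ e = ℓ then x e else 0) ≠ 0).card := by
  obtain ⟨q, hq, hxq⟩ : ∃ q : α → Prop, Fintype.card {e // q e} = N ∧ ∀ e, q e → x e ≠ 0 := by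
    obtain ⟨D, hDsub, hDcard⟩ := Finset.exists_subset_card_eq hx
    exact ⟨fun e => e ∈ D, by rw [Fintype.card_subtype, ← hDcard]; simp,
      fun e he => (Finset.mem_filter.1 (hDsub he)).2⟩
  set Φ := Equiv.piEquivPiSubtypeProd q (fun _ : α => Fin N) with hΦ
  have hsplit : ∀ τ : α → Fin N, ∑ e, (if τ e = ℓ then x e else 0)
      = ∑ e : {e // ¬ q e}, (if (Φ τ).2 e = ℓ then x e else 0)
        + ∑ e : {e // q e}, (if (Φ τ).1 e = ℓ then x e else 0) := fun τ => by
    rw [add_comm, ← Fintype.sum_subtype_add_sum_subtype q]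
    rfl
  have h1 : (Finset.univ.filter fun τ : α → Fin N => ∑ e, (if τ e = ℓ then x e else 0) ≠ 0).card
      = ∑ ρ : {e // ¬ q e} → Fin N, (Finset.univ.filter fun g : {e // q e} → Fin N =>
        ∑ e : {e // ¬ q e}, (if ρ e = ℓ then x e else 0)
          + ∑ e : {e // q e}, (if g e = ℓ then x e else 0) ≠ 0).card := by
    simp only [Finset.card_filter]
    rw [← Fintype.sum_prod_type_right (fun z : ({e // q e} → Fin N) × ({e // ¬ q e} → Fin N) =>
      if ∑ e : {e // ¬ q e}, (if z.2 e = ℓ then x e else 0)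
          + ∑ e : {e // q e}, (if z.1 e = ℓ then x e else 0) ≠ 0 then 1 else 0),
      ← Equiv.sum_comp Φ]
    exact Finset.sum_congr rfl fun τ _ => by rw [hsplit τ]
  have hcard : Fintype.card ({e // q e} → Fin N) = N ^ N := by
    rw [Fintype.card_fun, hq, Fintype.card_fin]
  rw [h1, Finset.mul_sum, Fintype.card_congr Φ, Fintype.card_prod, mul_comm, hcard]
  calc Fintype.card ({e // ¬ q e} → Fin N) * N ^ N
      = ∑ _ρ : {e // ¬ q e} → Fin N, N ^ N := by simp
    _ ≤ _ := Finset.sum_le_sum fun ρ _ => by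
      refine (card_fun_le_four_mul hN hq (fun e => x e) (fun e => hxq e e.2)
        (∑ e : {e // ¬ q e}, (if ρ e = ℓ then x e else 0)) ℓ).trans_eq ?_
      congr!

/-- Half of all subsets separate two given points. -/
lemma card_finset_eq_two_mul {β : Type*} [Fintype β] {s t : β} (hst : s ≠ t) :
    Fintype.card (Finset β)
      = 2 * (Finset.univ.filter fun W : Finset β => ¬ (s ∈ W ↔ t ∈ W)).card := by
  have hbij : (Finset.univ.filter fun W : Finset β => (s ∈ W ↔ t ∈ W)).card
      = (Finset.univ.filter fun W : Finset β => ¬ (s ∈ W ↔ t ∈ W)).card := by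
    -- Toggling the membership of `s` is an involution exchanging separating and non-separating
    -- subsets.
    have hiff : ∀ W : Finset β, (s ∈ symmDiff W {s} ↔ ¬ s ∈ W) ∧ (t ∈ symmDiff W {s} ↔ t ∈ W) := by
      intro W
      simp [Finset.mem_symmDiff, hst.symm]
    refine Finset.card_bij' (fun W _ => symmDiff W {s}) (fun W _ => symmDiff W {s})
      (fun W hW => ?_) (fun W hW => ?_) (fun W _ => ?_) (fun W _ => ?_)
    · simp only [Finset.mem_filter, Finset.mem_univ, true_and, hiff] at hW ⊢
      tauto
    · simp only [Finset.mem_filter, Finset.mem_univ, true_and, hiff] at hW ⊢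
      tauto
    · simp
    · simp
  have h := Finset.card_filter_add_card_filter_not (s := (Finset.univ : Finset (Finset β)))
    (fun W => (s ∈ W ↔ t ∈ W))
  rw [Finset.card_univ] at h
  omega

end RandomBlocks

end SwitchChain

namespace SwitchChain

open scoped Classical

/-! ### Existence of the field -/

section Existence

open MeasureTheory ProbabilityTheory

variable {n d : ℕ}

/-- The field data given by a colouring of the entries and a set of numbers. -/
def blockData (τ : Fin n × Fin n → Fin (parN n d)) (W : Finset (Fin (n * d + 1))) :
    FieldData n d where
  T ℓ := Finset.univ.filter fun e => τ e = ℓ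
  disjoint ℓ ℓ' h := Finset.disjoint_left.2 fun e h1 h2 => by
    rw [Finset.mem_filter] at h1 h2
    exact h (h1.2.symm.trans h2.2)
  W := W.map Fin.valEmbedding
  W_subset x hx := by
    obtain ⟨y, -, rfl⟩ := Finset.mem_map.1 hx
    exact Finset.mem_range.2 y.2

/-- A random colouring gives the two multigraphs different numbers of edges in block `ℓ` with
probability at least `1/4`, and a random `W` separates two different numbers with probability `1/2`.
-/
lemma card_le_mul_card_mem_disagree (hN : 2 ≤ parN n d) (G H : Multigraph n d)
    (h : parN n d ≤ entryDist G H) (ℓ : Fin (parN n d)) :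
    Fintype.card ((Fin n × Fin n → Fin (parN n d)) × Finset (Fin (n * d + 1)))
      ≤ 8 * (Finset.univ.filter
        fun θ : (Fin n × Fin n → Fin (parN n d)) × Finset (Fin (n * d + 1)) =>
          ℓ ∈ (blockData (d := d) θ.1 θ.2).disagree G H).card := by
  have hlt : ∀ (K : Multigraph n d) (τ : Fin n × Fin n → Fin (parN n d)),
      ∑ e ∈ Finset.univ.filter (fun e => τ e = ℓ), K.mult e.1 e.2 < n * d + 1 := fun K τ => by
    rw [← sum_mult K]
    exact Nat.lt_succ_of_le (Finset.sum_le_sum_of_subset (Finset.subset_univ _))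
  have hcol := card_coloring_le_four_mul hN
    (fun e : Fin n × Fin n => (G.mult e.1 e.2 : ℤ) - H.mult e.1 e.2)
    (h.trans_eq (by simp [entryDist, sub_eq_zero])) ℓ
  set A := Finset.univ.filter fun τ : Fin n × Fin n → Fin (parN n d) =>
    ∑ e, (if τ e = ℓ then (G.mult e.1 e.2 : ℤ) - H.mult e.1 e.2 else 0) ≠ 0 with hA
  have hW : ∀ τ ∈ A, Fintype.card (Finset (Fin (n * d + 1)))
      = 2 * (Finset.univ.filter fun W : Finset (Fin (n * d + 1)) =>
        ℓ ∈ (blockData (d := d) τ W).disagree G H).card := by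
    intro τ hτ
    have hne : (⟨_, hlt G τ⟩ : Fin (n * d + 1)) ≠ ⟨_, hlt H τ⟩ := by
      intro heq
      refine (Finset.mem_filter.1 hτ).2 ?_
      rw [← Finset.sum_filter, Finset.sum_sub_distrib, sub_eq_zero]
      exact_mod_cast congrArg Fin.val heq
    have hsel : ∀ (W : Finset (Fin (n * d + 1))) (K : Multigraph n d), (blockData (d := d) τ W).Sel ℓ K ↔
        (⟨_, hlt K τ⟩ : Fin (n * d + 1)) ∈ W := fun W K => by
      constructor
      · intro hK
        obtain ⟨y, hy, hyK⟩ := Finset.mem_map.1 hK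
        have : y = ⟨_, hlt K τ⟩ := Fin.ext hyK
        rwa [← this]
      · intro hK
        exact Finset.mem_map.2 ⟨_, hK, rfl⟩
    rw [card_finset_eq_two_mul hne]
    refine congrArg (fun S : Finset (Finset (Fin (n * d + 1))) => 2 * S.card) ?_
    ext W
    simp [FieldData.disagree, hsel]
  calc Fintype.card ((Fin n × Fin n → Fin (parN n d)) × Finset (Fin (n * d + 1)))
      = Fintype.card (Fin n × Fin n → Fin (parN n d))
        * Fintype.card (Finset (Fin (n * d + 1))) := Fintype.card_prod _ _
    _ ≤ 4 * A.card * Fintype.card (Finset (Fin (n * d + 1))) := Nat.mul_le_mul_right _ hcol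
    _ = 4 * ∑ τ ∈ A, Fintype.card (Finset (Fin (n * d + 1))) := by
      rw [Finset.sum_const, smul_eq_mul, mul_assoc]
    _ = 4 * ∑ τ ∈ A, 2 * (Finset.univ.filter fun W : Finset (Fin (n * d + 1)) =>
        ℓ ∈ (blockData (d := d) τ W).disagree G H).card := by
      rw [Finset.sum_congr rfl hW]
    _ = 8 * ∑ τ ∈ A, (Finset.univ.filter fun W : Finset (Fin (n * d + 1)) =>
        ℓ ∈ (blockData (d := d) τ W).disagree G H).card := by
      rw [← Finset.mul_sum]
      ring
    _ ≤ 8 * ∑ τ, (Finset.univ.filter fun W : Finset (Fin (n * d + 1)) =>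
        ℓ ∈ (blockData (d := d) τ W).disagree G H).card :=
      Nat.mul_le_mul_left 8 (Finset.sum_le_sum_of_subset (Finset.subset_univ _))
    _ = _ := by
      simp only [Finset.card_filter]
      rw [Fintype.sum_prod_type]

/-- The mean number of disagreeing blocks is at least `𝔫/8` and the maximum is `𝔫`. The reverse
Markov inequality gives at least `𝔫/16` with probability at least `1/16`. -/
lemma card_le_mul_card_disagree_ge (hN : 2 ≤ parN n d) (G H : Multigraph n d)
    (h : parN n d ≤ entryDist G H) :
    Fintype.card ((Fin n × Fin n → Fin (parN n d)) × Finset (Fin (n * d + 1)))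
      ≤ 16 * (Finset.univ.filter
        fun θ : (Fin n × Fin n → Fin (parN n d)) × Finset (Fin (n * d + 1)) =>
          parN n d ≤ 16 * ((blockData (d := d) θ.1 θ.2).disagree G H).card).card := by
  set Θ := (Fin n × Fin n → Fin (parN n d)) × Finset (Fin (n * d + 1)) with hΘ
  set D : Θ → Finset (Fin (parN n d)) := fun θ => (blockData (d := d) θ.1 θ.2).disagree G H with hD
  have h1 : parN n d * Fintype.card Θ ≤ 8 * ∑ θ, (D θ).card := by
    have h2 : ∑ θ, (D θ).card = ∑ ℓ, (Finset.univ.filter fun θ : Θ => ℓ ∈ D θ).card := by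
      simp only [Finset.card_filter]
      rw [Finset.sum_comm]
      refine Finset.sum_congr rfl fun θ _ => ?_
      rw [← Finset.card_filter]
      congr 1
      ext ℓ
      simp
    rw [h2, Finset.mul_sum]
    calc parN n d * Fintype.card Θ = ∑ _ℓ : Fin (parN n d), Fintype.card Θ := by simp
      _ ≤ _ := Finset.sum_le_sum fun ℓ _ => card_le_mul_card_mem_disagree hN G H h ℓ
  have h3 : 16 * ∑ θ, (D θ).card ≤ ∑ θ : Θ, (parN n d
      + 16 * parN n d * (if parN n d ≤ 16 * (D θ).card then 1 else 0)) := by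
    rw [Finset.mul_sum]
    refine Finset.sum_le_sum fun θ _ => ?_
    have h4 : (D θ).card ≤ parN n d := (Finset.card_le_univ _).trans_eq (Fintype.card_fin _)
    split_ifs with h5 <;> omega
  rw [Finset.sum_add_distrib, ← Finset.mul_sum, ← Finset.card_filter, Finset.sum_const,
    Finset.card_univ, smul_eq_mul] at h3
  have h6 : parN n d * Fintype.card Θ ≤ parN n d * (16 * (Finset.univ.filter
      fun θ : Θ => parN n d ≤ 16 * (D θ).card).card) := by
    have h7 : 16 * parN n d * (Finset.univ.filter
      fun θ : Θ => parN n d ≤ 16 * (D θ).card).card = parN n d * (16 * (Finset.univ.filter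
      fun θ : Θ => parN n d ≤ 16 * (D θ).card).card) := by ring
    rw [h7, mul_comm (Fintype.card Θ)] at h3
    omega
  exact Nat.le_of_mul_le_mul_left h6 (by omega)

/-- The constant in the sign property of the field. -/
def signConst : ℝ := gaussTail ^ 2 / 512

lemma signConst_pos : 0 < signConst := by
  have := gaussTail_pos
  unfold signConst
  positivity

lemma signConst_le_one : signConst ≤ 1 := by
  have := gaussTail_pos
  have := gaussTail_le_one
  unfold signConst
  nlinarith

/-- The lower bound holds for each far pair on average over the data. It may be weighted by
`pairWeight` and summed, and some choice of data is at least as good as the average. -/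
lemma exists_fieldData_integral_ge (hN : 2 ≤ parN n d) (f : SimpleBip n d → ℝ) :
    ∃ 𝒯 : FieldData n d, 2 * signConst * ∑ p ∈ farPairs n d, pairWeight f p
      ≤ ∫ ω, ∑ p ∈ farPairs n d, signInd f (fun G => gaussField 𝒯 G ω) p * pairWeight f p
        ∂(stdGauss (parN n d)) := by
  set Θ := (Fin n × Fin n → Fin (parN n d)) × Finset (Fin (n * d + 1)) with hΘ
  have hN0 : 0 < parN n d := by omega
  have : Nonempty (Fin (parN n d)) := ⟨⟨0, hN0⟩⟩
  have : Nonempty Θ := inferInstance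
  set E : Θ → Multigraph n d × Multigraph n d → ℝ := fun θ p =>
    ∫ ω, signInd f (fun G => gaussField (blockData θ.1 θ.2) G ω) p ∂(stdGauss (parN n d)) with hE
  have hE0 : ∀ θ p, 0 ≤ E θ p := fun θ p => integral_nonneg fun ω => signInd_nonneg _ _ _
  have hp : ∀ p ∈ farPairs n d, 2 * signConst * Fintype.card Θ ≤ ∑ θ, E θ p := by
    intro p hp
    have hfar := card_le_mul_card_disagree_ge hN p.1 p.2 (Finset.mem_filter.1 hp).2.2.2
    set A := Finset.univ.filter fun θ : Θ =>
      parN n d ≤ 16 * ((blockData (d := d) θ.1 θ.2).disagree p.1 p.2).card with hA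
    have hfar' : (Fintype.card Θ : ℝ) ≤ 16 * A.card := by exact_mod_cast hfar
    have ht := gaussTail_pos
    -- Here `2 * signConst` is `1/16` for the data times `gaussTail ^ 2 / 16` for the Gaussian
    -- variables. The factor `2` is spent in `le_measureReal_of_le_integral` on passing from a mean
    -- to a probability.
    calc 2 * signConst * Fintype.card Θ ≤ 2 * signConst * (16 * A.card) := by
          have := signConst_pos
          gcongr
      _ = ∑ θ ∈ A, 1 / 16 * gaussTail ^ 2 := by
          rw [Finset.sum_const, nsmul_eq_mul, signConst]
          ring
      _ ≤ ∑ θ ∈ A, E θ p := Finset.sum_le_sum fun θ hθ =>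
          le_integral_signInd _ hN0 f p (Finset.mem_filter.1 hθ).2
      _ ≤ _ := Finset.sum_le_sum_of_subset_of_nonneg (Finset.subset_univ _) fun θ _ _ => hE0 θ p
  have hsum : ∑ _θ : Θ, 2 * signConst * ∑ p ∈ farPairs n d, pairWeight f p
      ≤ ∑ θ : Θ, ∑ p ∈ farPairs n d, E θ p * pairWeight f p := by
    rw [Finset.sum_comm, Finset.sum_const, Finset.card_univ, nsmul_eq_mul, ← mul_assoc,
      Finset.mul_sum]
    refine Finset.sum_le_sum fun p hpm => ?_
    rw [← Finset.sum_mul]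
    refine mul_le_mul_of_nonneg_right ?_ (pairWeight_nonneg f p)
    rw [mul_comm]
    exact hp p hpm
  obtain ⟨θ, -, hθ⟩ := Finset.exists_le_of_sum_le Finset.univ_nonempty hsum
  refine ⟨blockData θ.1 θ.2, hθ.trans_eq ?_⟩
  rw [integral_finsetSum _ fun p _ => (integrable_signInd _ f p).mul_const _]
  exact Finset.sum_congr rfl fun p _ => (integral_mul_const _ _).symm

/-- A variable with values in `[0, Λ]` and mean at least `2 c Λ` is at least `c Λ` with probability
at least `c`. -/
lemma le_measureReal_of_le_integral {Ω : Type*} [MeasurableSpace Ω] {P : Measure Ω}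
    [IsProbabilityMeasure P] {X : Ω → ℝ} (hX : Measurable X) {Λ c : ℝ}
    (h0 : ∀ ω, 0 ≤ X ω) (hΛ : ∀ ω, X ω ≤ Λ) (hc : 0 ≤ c) (hc1 : c ≤ 1)
    (h : 2 * c * Λ ≤ ∫ ω, X ω ∂P) : c ≤ P.real {ω | c * Λ ≤ X ω} := by
  obtain ⟨ω₀⟩ : Nonempty Ω := P.nonempty_of_neZero
  rcases ((h0 ω₀).trans (hΛ ω₀)).eq_or_lt with hz | hpos
  · have : {ω | c * Λ ≤ X ω} = Set.univ := by
      ext ω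
      simp [← hz, h0 ω]
    rw [this, probReal_univ]
    exact hc1
  · set A := {ω | c * Λ ≤ X ω} with hA
    have hAm : MeasurableSet A := measurableSet_le measurable_const hX
    have hXint : Integrable X P := Integrable.of_bound hX.aestronglyMeasurable Λ
      (Filter.Eventually.of_forall fun ω => by
        rw [Real.norm_of_nonneg (h0 ω)]
        exact hΛ ω)
    -- On the event `A` the variable is bounded by `Λ`, off it by `c * Λ`.
    have hle : ∫ ω, X ω ∂P ≤ ∫ ω, (A.indicator (fun _ => Λ) ω + c * Λ) ∂P := by
      refine integral_mono hXint (((integrable_const Λ).indicator hAm).add (integrable_const _))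
        fun ω => ?_
      have hcΛ : 0 ≤ c * Λ := by positivity
      by_cases hω : ω ∈ A
      · simp only [Set.indicator_of_mem hω]
        linarith [hΛ ω]
      · simp only [Set.indicator_of_notMem hω, zero_add]
        exact (not_le.1 hω).le
    rw [integral_add ((integrable_const Λ).indicator hAm) (integrable_const _),
      integral_indicator_const _ hAm, integral_const, probReal_univ, one_smul, smul_eq_mul] at hle
    have : c * Λ ≤ P.real A * Λ := by linarith
    exact le_of_mul_le_mul_right this hpos

theorem exists_isRandomizingField (hN : 2 ≤ parN n d) (f : SimpleBip n d → ℝ) :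
    ∃ 𝒯 : FieldData n d,
      IsRandomizingField signConst f (stdGauss (parN n d)) (gaussField 𝒯) := by
  obtain ⟨𝒯, h𝒯⟩ := exists_fieldData_integral_ge hN f
  have hN0 : 0 < parN n d := by omega
  refine ⟨𝒯, isGaussianProcess_gaussField 𝒯, integral_gaussField 𝒯, variance_gaussField 𝒯 hN0,
    fun G H h => le_covariance_gaussField 𝒯 hN0 h, ?_⟩
  refine le_measureReal_of_le_integral
    (Finset.measurable_sum _ fun p _ => (measurable_signInd 𝒯 f p).mul_const _)
    (fun ω => Finset.sum_nonneg fun p _ => mul_nonneg (signInd_nonneg _ _ _) (pairWeight_nonneg f p))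
    (fun ω => Finset.sum_le_sum fun p _ => ?_) signConst_pos.le signConst_le_one h𝒯
  exact mul_le_of_le_one_left (pairWeight_nonneg f p) (signInd_le_one _ _ _)

lemma Large.two_le_parN (L : Large n d) : 2 ≤ parN n d := by
  have hd := L.d_pos
  have hd1 : (1 : ℝ) ≤ d := by exact_mod_cast (by have := L.three_le; omega : 1 ≤ d)
  have h1 : (d : ℝ) ≤ (d : ℝ) ^ 10 := le_self_pow₀ hd1 (by norm_num)
  have h2 : (1 : ℝ) ≤ Real.log n ^ 4 := one_le_pow₀ (by linarith [L.log_ge])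
  have h3 := L.pow_le
  have h4 : 2 * (d : ℝ) ≤ n := by nlinarith
  have hd' : (0 : ℝ) < d := by linarith
  have h5 : (2 : ℝ) ≤ (n : ℝ) / d := by rwa [le_div_iff₀ hd']
  have h6 : (2 : ℝ) ≤ (parN n d : ℝ) := h5.trans (Nat.le_ceil _)
  exact_mod_cast h6

end Existence

/-! ### The final estimate -/

section Final

variable {n d : ℕ}

/-- The exponent `1/1143` leaves ample room: only `d^10 ≤ n^(1/4)` is used. The bound `log n ≤
n^(1/8) / 100` yields `10^(-8)` after taking fourth powers, which absorbs the constant `10^6`. -/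
lemma eventually_large : ∃ N : ℕ, ∀ n : ℕ, N ≤ n → ∀ d : ℕ, 3 ≤ d →
    (d : ℝ) ≤ (n : ℝ) ^ ((1 : ℝ) / 1143) → Large n d := by
  have h1 : ∀ᶠ n : ℕ in Filter.atTop, 1000 ≤ Real.log n :=
    (Real.tendsto_log_atTop.comp tendsto_natCast_atTop_atTop).eventually_ge_atTop 1000
  have h2 : ∀ᶠ n : ℕ in Filter.atTop, ‖Real.log n‖ ≤ 10⁻¹ ^ 2 * ‖(n : ℝ) ^ ((1 : ℝ) / 8)‖ :=
    tendsto_natCast_atTop_atTop.eventually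
      ((isLittleO_log_rpow_atTop (by norm_num : (0 : ℝ) < 1 / 8)).bound
        (by norm_num : (0 : ℝ) < 10⁻¹ ^ 2))
  obtain ⟨N, hN⟩ := Filter.eventually_atTop.1 (h1.and h2)
  refine ⟨N, fun n hn d hd hdn => ?_⟩
  obtain ⟨h3, h4⟩ := hN n hn
  refine ⟨hd, h3, ?_⟩
  have hn1 : (1 : ℝ) ≤ n := by
    rcases Nat.eq_zero_or_pos n with h | h
    · rw [h] at h3
      norm_num at h3
    · exact_mod_cast h
  have hn0 : (0 : ℝ) ≤ n := by linarith
  rw [Real.norm_of_nonneg (by linarith), Real.norm_of_nonneg (by positivity)] at h4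
  have h5 : (d : ℝ) ^ 10 ≤ (n : ℝ) ^ ((1 : ℝ) / 4) := by
    calc (d : ℝ) ^ 10 ≤ ((n : ℝ) ^ ((1 : ℝ) / 1143)) ^ 10 := by gcongr
      _ = (n : ℝ) ^ ((1 : ℝ) / 1143 * 10) := by
        rw [← Real.rpow_natCast, ← Real.rpow_mul hn0]
        norm_num
      _ ≤ _ := Real.rpow_le_rpow_of_exponent_le hn1 (by norm_num)
  have h6 : Real.log n ^ 4 ≤ 10⁻¹ ^ 8 * (n : ℝ) ^ ((1 : ℝ) / 2) := by
    calc Real.log n ^ 4 ≤ (10⁻¹ ^ 2 * (n : ℝ) ^ ((1 : ℝ) / 8)) ^ 4 := by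
          have : 0 ≤ Real.log n := by linarith
          gcongr
      _ = _ := by
        rw [mul_pow, ← pow_mul, ← Real.rpow_natCast ((n : ℝ) ^ _), ← Real.rpow_mul hn0]
        norm_num
  calc 10 ^ 6 * (d : ℝ) ^ 10 * Real.log n ^ 4
      ≤ 10 ^ 6 * (n : ℝ) ^ ((1 : ℝ) / 4) * (10⁻¹ ^ 8 * (n : ℝ) ^ ((1 : ℝ) / 2)) := by
        have : 0 ≤ Real.log n := by linarith
        gcongr
    _ = 10⁻¹ ^ 2 * ((n : ℝ) ^ ((1 : ℝ) / 4) * (n : ℝ) ^ ((1 : ℝ) / 2)) := by ring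
    _ = 10⁻¹ ^ 2 * (n : ℝ) ^ ((3 : ℝ) / 4) := by
        rw [← Real.rpow_add (by linarith)]
        norm_num
    _ ≤ 1 * (n : ℝ) ^ (1 : ℝ) := by
        gcongr
        · norm_num
        · norm_num
    _ = n := by rw [one_mul, Real.rpow_one]

lemma wVar_piU_nonneg (f : SimpleBip n d → ℝ) : 0 ≤ wVar piU f := by
  unfold wVar piU
  positivity

end Final

end SwitchChain

end

/-! ### Combination of the two cases. -/

theorem mainTheorem7 :
    ∃ c₀ : ℝ, 0 < c₀ ∧ ∃ c : ℝ, 0 < c ∧ ∃ N : ℕ, ∀ n : ℕ, N ≤ n → ∀ d : ℕ, 3 ≤ d →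
      (d : ℝ) ≤ (n : ℝ) ^ ((1 : ℝ) / 1143) →
      ∀ f : SwitchChain.SimpleBip n d → ℝ,
        (∃ 𝒯 : SwitchChain.FieldData n d,
          SwitchChain.IsRandomizingField c₀ f
            (SwitchChain.stdGauss (SwitchChain.parN n d)) (SwitchChain.gaussField 𝒯)) ∧
        ∀ (Ω : Type*) [MeasurableSpace Ω] (P : MeasureTheory.Measure Ω)
          [MeasureTheory.IsProbabilityMeasure P]
          (ξ : SwitchChain.Multigraph n d → Ω → ℝ),
          SwitchChain.IsRandomizingField c₀ f P ξ →
          c ≤ P.real {ω |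
            c * SwitchChain.wVar SwitchChain.piU f ≤
              SwitchChain.wVar SwitchChain.piBC
                (SwitchChain.extension f (fun G => ξ G ω))} := by
  obtain ⟨N, hN⟩ := SwitchChain.eventually_large
  have hc := SwitchChain.signConst_pos
  have hc1 := SwitchChain.signConst_le_one
  refine ⟨SwitchChain.signConst, hc, SwitchChain.signConst / 2 ^ 24, by positivity, N,
    fun n hn d hd hdn f => ?_⟩
  have L := hN n hn d hd hdn
  have hV := SwitchChain.wVar_piU_nonneg f
  have hsmall : SwitchChain.signConst / 2 ^ 24 ≤ SwitchChain.signConst :=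
    div_le_self hc.le (by norm_num)
  refine ⟨SwitchChain.exists_isRandomizingField L.two_le_parN f, ?_⟩
  intro Ω _ P _ ξ hξ
  by_cases hf : SwitchChain.GoodVariation f
  · exact hsmall.trans (hξ.sign.trans (MeasureTheory.measureReal_mono fun ω hω =>
      L.wVar_extension_ge hf hc.le (fun G => ξ G ω) hω))
  -- Without substantial variation on the good set the estimate holds for every realization, so the
  -- event is the whole space.
  · have huniv : {ω | SwitchChain.signConst / 2 ^ 24 * SwitchChain.wVar SwitchChain.piU f ≤
        SwitchChain.wVar SwitchChain.piBC (SwitchChain.extension f (fun G => ξ G ω))}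
          = Set.univ := by
      refine Set.eq_univ_of_forall fun ω => ?_
      refine le_trans (mul_le_mul_of_nonneg_right ?_ hV)
        (L.wVar_extension_ge_of_not hf (fun G => ξ G ω))
      rw [div_le_div_iff₀ (by norm_num) (by norm_num)]
      norm_num
      linarith
    rw [huniv, MeasureTheory.probReal_univ]
    exact hsmall.trans hc1
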